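/- Let $\Gamma\subset\mathbb R^2$ be an embedded metric graph: it has a countably infinite set of vertices (points of the plane) and edges that are nondegenerate straight line segments between vertices, measured by Euclidean length; there are no loops or multiple edges, two different closed edges meet at most in common endpoints, every vertex has finite positive valency, and the family of edges is locally finite in the plane. The edges may be oriented, but the orientation plays no role. Let $n\in\{1,2\}$ and let $\Gamma$ be $\mathbb Z^n$-periodic: $\mathbb Z^n$ acts freely on $\Gamma$ by translations of the plane, written $x\mapsto x+g$, which map vertices to vertices and edges to edges; the quotient $\Gamma/\mathbb Z^n$ is compact; and $\rho(x,y+g)\to\infty$ as $g\to\infty$ for all $x,y\in\Gamma$, where $\rho$ is the path metric of $\Gamma$ (with $\rho=\infty$ between points not joined by a path). Equip $\Gamma$ with the arc length measure, let $1<p<\infty$, and let $(V_gu)(x)=u(x-g)$ be the shifts on $L^p(\Gamma)$. Let $a,b:\Gamma\to\mathbb C$ be bounded, uniformly continuous with respect to $\rho$, and slowly oscillating at infinity; the latter means that for every $\beta\in\mathbb Z^n$ and every compact $M\subset\Gamma$, $\sup_{y\in M}|f(y+\beta+\alpha)-f(y+\alpha)|\to0$ as $\mathbb Z^n\ni\alpha\to\infty$.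 Let $k:\mathbb R^2\to\mathbb C$ be continuous with $|k(z)|\le C(1+|z|)^{-2-\varepsilon}$ for all $z\in\mathbb R^2$, for some constants $C,\varepsilon>0$, and put $(Tu)(x)=\int_\Gamma k(x-y)u(y)\,dy$. For a bounded operator $A$ on $L^p(\Gamma)$ and a sequence $h:\mathbb N\to\mathbb Z^n$ tending to infinity, a bounded operator $A^h$ is called the limit operator of $A$ with respect to $h$ if, for every compact $M\subset\Gamma$, both $\|(V_{h(m)}^{-1}AV_{h(m)}-A^h)\chi_MI\|\to0$ and $\|\chi_M(V_{h(m)}^{-1}AV_{h(m)}-A^h)\|\to0$ as $m\to\infty$. Then $A=aI+bT$ is a well-defined bounded operator on $L^p(\Gamma)$ (the integrals converging absolutely), and $A$ is Fredholm if and only if (a) $\inf_{x\in\Gamma}|a(x)|>0$, and (b) every limit operator $A^g$ of $A$ is invertible on $L^p(\Gamma)$. Moreover, every sequence $h$ in $\mathbb Z^n$ tending to infinity has a subsequence $g$ for which there are functions $a^g,b^g$ on $\Gamma$ with $a(\cdot+g(m))\to a^g$ and $b(\cdot+g(m))\to b^g$ uniformly on every compact subset of $\Gamma$, and the limit operator of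 $A$ with respect to $g$ exists and is the bounded operator $A^g=a^gI+b^gT$; hence all limit operators of $A$ are of this form. -/

import Mathlib

open MeasureTheory Filter Topology
open scoped ENNReal

/-- The Euclidean plane. -/
abbrev Plane : Type := EuclideanSpace ℝ (Fin 2)

/-- The operator of multiplication by the characteristic function of `M` on `L^p(μ)`. -/
noncomputable def indicatorOp {α : Type*} [MeasurableSpace α] (μ : Measure α) (p : ℝ≥0∞)
    [Fact (1 ≤ p)] (M : Set α) (hM : MeasurableSet M) : Lp ℂ p μ →L[ℂ] Lp ℂ p μ :=
  LinearMap.mkContinuous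
    { toFun := fun u => ((Lp.memLp u).indicator hM).toLp (M.indicator u)
      map_add' := fun u v => by
        rw [← MemLp.toLp_add]
        refine MemLp.toLp_congr _ _ ?_
        filter_upwards [Lp.coeFn_add u v] with x hx
        by_cases h : x ∈ M
        · simpa [h] using hx
        · simp [h]
      map_smul' := fun c u => by
        rw [RingHom.id_apply, ← MemLp.toLp_const_smul]
        refine MemLp.toLp_congr _ _ ?_
        filter_upwards [Lp.coeFn_smul c u] with x hx
        by_cases h : x ∈ M
        · simpa [h] using hx
        · simp [h] }
    1 (fun u => by
      rw [one_mul, LinearMap.coe_mk, AddHom.coe_mk, Lp.norm_toLp, Lp.norm_def]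
      exact ENNReal.toReal_mono (Lp.eLpNorm_ne_top u) (eLpNorm_indicator_le _))

/-- A metric graph embedded into the plane: its vertices are points, its (oriented) edges are
nondegenerate line segments with the Euclidean length, two different closed edges meet at most in
common endpoints, and the family of edges is locally finite, so that the graph topology is the
topology induced by the plane. There are no loops and no multiple edges, and the valency of every
vertex is finite and positive. -/
structure PlaneGraph where
  vertices : Set Plane
  edges : Set (Plane × Plane)
  countable_vertices : vertices.Countable
  infinite_vertices : vertices.Infinite
  mem_vertices : ∀ e ∈ edges, e.1 ∈ vertices ∧ e.2 ∈ vertices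
  no_loop : ∀ e ∈ edges, e.1 ≠ e.2
  no_reverse : ∀ e ∈ edges, (e.2, e.1) ∉ edges
  valency_finite : ∀ v ∈ vertices, {e ∈ edges | e.1 = v ∨ e.2 = v}.Finite
  valency_pos : ∀ v ∈ vertices, {e ∈ edges | e.1 = v ∨ e.2 = v}.Nonempty
  inter_subset : ∀ e ∈ edges, ∀ f ∈ edges, e ≠ f →
    segment ℝ e.1 e.2 ∩ segment ℝ f.1 f.2 ⊆ ({e.1, e.2} : Set Plane) ∩ {f.1, f.2}
  locallyFinite : LocallyFinite (fun e : edges => segment ℝ e.1.1 e.1.2)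

namespace PlaneGraph

/-- The point set `Γ` of the graph, the union of its closed edges. -/
def carrier (G : PlaneGraph) : Set Plane := ⋃ e ∈ G.edges, segment ℝ e.1 e.2

/-- The path metric of the graph: the infimum of the lengths of all finite chains
`x = z 0, …, z m = y` in which consecutive points lie on a common closed edge
(`⊤` if there is no such chain). -/
noncomputable def pathEDist (G : PlaneGraph) (x y : Plane) : ℝ≥0∞ :=
  ⨅ (m : ℕ) (z : ℕ → Plane) (_ : z 0 = x ∧ z m = y ∧ ∀ i < m, ∃ e ∈ G.edges,
      z i ∈ segment ℝ e.1 e.2 ∧ z (i + 1) ∈ segment ℝ e.1 e.2),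
    ∑ i ∈ Finset.range m, edist (z i) (z (i + 1))

/-- The measure on `Γ` given by arc length on every edge: the one-dimensional Hausdorff measure
of the plane, restricted to `Γ`. -/
noncomputable def measure (G : PlaneGraph) : Measure Plane :=
  (Measure.hausdorffMeasure 1).restrict G.carrier

/-- `f ∈ BUC(Γ)`: on `Γ`, the function `f` is bounded and uniformly continuous with respect to
the path metric. Only the values of `f` on `Γ` matter. -/
def IsBUC (G : PlaneGraph) (f : Plane → ℂ) : Prop :=
  (∃ C : ℝ, ∀ x ∈ G.carrier, ‖f x‖ ≤ C) ∧
  ∀ ε > 0, ∃ δ : ℝ, 0 < δ ∧ ∀ x ∈ G.carrier, ∀ y ∈ G.carrier,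
    G.pathEDist x y < ENNReal.ofReal δ → ‖f x - f y‖ < ε

end PlaneGraph

/-- A `ℤⁿ`-periodic metric graph in the plane with compact quotient: `g ∈ ℤⁿ` acts by the
translation `x ↦ x + trans g`. -/
structure PeriodicPlaneGraph (n : ℕ) extends PlaneGraph where
  trans : (Fin n → ℤ) →+ Plane
  free : ∀ g, trans g = 0 → g = 0
  vertices_add : ∀ g, ∀ v ∈ vertices, v + trans g ∈ vertices
  edges_add : ∀ g, ∀ e ∈ edges, (e.1 + trans g, e.2 + trans g) ∈ edges ∨
    (e.2 + trans g, e.1 + trans g) ∈ edges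
  tendsto_pathEDist : ∀ x ∈ toPlaneGraph.carrier, ∀ y ∈ toPlaneGraph.carrier,
    Tendsto (fun g => toPlaneGraph.pathEDist x (y + trans g))
      (Bornology.cobounded (Fin n → ℤ)) (𝓝 ⊤)
  cocompact : ∃ K : Set Plane, IsCompact K ∧ K ⊆ toPlaneGraph.carrier ∧
    ∀ x ∈ toPlaneGraph.carrier, ∃ g, ∃ y ∈ K, x = y + trans g

namespace PeriodicPlaneGraph

variable {n : ℕ} (G : PeriodicPlaneGraph n)

theorem add_mem_carrier (g : Fin n → ℤ) {x : Plane} (hx : x ∈ G.carrier) :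
    x + G.trans g ∈ G.carrier := by
  simp only [PlaneGraph.carrier, Set.mem_iUnion] at hx ⊢
  obtain ⟨e, he, hxe⟩ := hx
  have h : x + G.trans g ∈ segment ℝ (e.1 + G.trans g) (e.2 + G.trans g) := by
    rw [add_comm x, add_comm e.1, add_comm e.2]
    exact (mem_segment_translate ℝ _).2 hxe
  rcases G.edges_add g e he with h1 | h1
  · exact ⟨_, h1, h⟩
  · exact ⟨_, h1, by rw [segment_symm]; exact h⟩

theorem sub_mem_carrier_iff (g : Fin n → ℤ) (x : Plane) :
    x - G.trans g ∈ G.carrier ↔ x ∈ G.carrier := by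
  constructor
  · intro h
    simpa using G.add_mem_carrier g h
  · intro h
    have := G.add_mem_carrier (-g) h
    rwa [map_neg, ← sub_eq_add_neg] at this

theorem measurePreserving_sub (g : Fin n → ℤ) :
    MeasurePreserving (fun x : Plane => x - G.trans g) G.measure G.measure := by
  have h := (IsometryEquiv.subRight (G.trans g)).measurePreserving_hausdorffMeasure 1
  have h2 := h.restrict_preimage_emb
    (IsometryEquiv.subRight (G.trans g)).toHomeomorph.measurableEmbedding G.carrier
  have h3 : (IsometryEquiv.subRight (G.trans g)) ⁻¹' G.carrier = G.carrier := by
    ext x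
    exact G.sub_mem_carrier_iff g x
  rw [h3] at h2
  exact h2

/-- The space `L^p(Γ)` of complex-valued functions. -/
noncomputable abbrev LpSpace (p : ℝ≥0∞) := Lp ℂ p G.measure

variable (p : ℝ≥0∞) [Fact (1 ≤ p)]

/-- The shift `(V_g u)(x) = u(x - g)` on `L^p(Γ)`. -/
noncomputable def shift (g : Fin n → ℤ) : G.LpSpace p →L[ℂ] G.LpSpace p :=
  (Lp.compMeasurePreservingₗᵢ ℂ _ (G.measurePreserving_sub g)).toContinuousLinearMap

/-- The operator of multiplication by the characteristic function of `M` on `L^p(Γ)`. -/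
noncomputable def cutoff (M : Set Plane) (hM : MeasurableSet M) :
    G.LpSpace p →L[ℂ] G.LpSpace p :=
  indicatorOp G.measure p M hM

/-- `B` is the limit operator of `A` with respect to the sequence `h` in `ℤⁿ` tending to
infinity. -/
def IsLimitOperator (A : G.LpSpace p →L[ℂ] G.LpSpace p) (h : ℕ → Fin n → ℤ)
    (B : G.LpSpace p →L[ℂ] G.LpSpace p) : Prop :=
  Tendsto h atTop (Bornology.cobounded (Fin n → ℤ)) ∧
  ∀ (M : Set Plane) (hM : IsCompact M), M ⊆ G.carrier →
    Tendsto (fun m => ‖(G.shift p (-h m) * A * G.shift p (h m) - B) *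
      G.cutoff p M hM.measurableSet‖) atTop (𝓝 0) ∧
    Tendsto (fun m => ‖G.cutoff p M hM.measurableSet *
      (G.shift p (-h m) * A * G.shift p (h m) - B)‖) atTop (𝓝 0)

/-- `A = aI + bT` on `L^p(Γ)`, where `(Tu)(x) = ∫_Γ k(x - y) u(y) dy`. The integrals are required
to converge absolutely. -/
def ActsAs (a b k : Plane → ℂ) (A : G.LpSpace p →L[ℂ] G.LpSpace p) : Prop :=
  ∀ u : G.LpSpace p,
    (∀ x ∈ G.carrier, Integrable (fun y => k (x - y) * u y) G.measure) ∧
    A u =ᵐ[G.measure] fun x => a x * u x + b x * ∫ y, k (x - y) * u y ∂G.measure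

/-- `f ∈ SO(Γ)`: for every `β ∈ ℤⁿ`, `f(y + β + α) - f(y + α) → 0` as `α → ∞`, uniformly for `y`
in every compact subset of `Γ` (equivalently, in a relatively compact fundamental domain). -/
def IsSO (f : Plane → ℂ) : Prop :=
  ∀ β : Fin n → ℤ, ∀ M : Set Plane, IsCompact M → M ⊆ G.carrier →
    TendstoUniformlyOn (fun (α : Fin n → ℤ) y => f (y + G.trans (β + α)) - f (y + G.trans α))
      (fun _ => 0) (Bornology.cobounded (Fin n → ℤ)) M

/-- `f'` is the limit function of `f` with respect to the sequence `g` in `ℤⁿ`: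
`f(x + g(m)) → f'(x)` uniformly on every compact subset of `Γ`. -/
def IsLimitFunction (f : Plane → ℂ) (g : ℕ → Fin n → ℤ) (f' : Plane → ℂ) : Prop :=
  ∀ M : Set Plane, IsCompact M → M ⊆ G.carrier →
    TendstoUniformlyOn (fun m x => f (x + G.trans (g m))) f' atTop M

end PeriodicPlaneGraph

/-! ### Schur's test -/

theorem lintegral_rpow_le_measure_univ_mul {α : Type*} [MeasurableSpace α] (ν : Measure α)
    {r : ℝ} (hr : 1 < r) {u : α → ℝ≥0∞} (hu : AEMeasurable u ν) :
    (∫⁻ y, u y ∂ν) ^ r ≤ ν Set.univ ^ (r - 1) * ∫⁻ y, u y ^ r ∂ν := by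
  have hpq := Real.HolderConjugate.conjExponent hr
  have h := ENNReal.lintegral_mul_le_Lp_mul_Lq ν hpq hu (aemeasurable_const (b := (1 : ℝ≥0∞)))
  have hr0 : 0 < r := by linarith
  simp only [Pi.mul_apply, mul_one, ENNReal.one_rpow, lintegral_const, one_mul] at h
  refine (ENNReal.rpow_le_rpow h hr0.le).trans_eq ?_
  rw [ENNReal.mul_rpow_of_nonneg _ _ hr0.le, ← ENNReal.rpow_mul, ← ENNReal.rpow_mul, mul_comm,
    one_div_mul_cancel hr0.ne', ENNReal.rpow_one]
  congr 2
  have h1 : (r - 1) ≠ 0 := by linarith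
  rw [Real.conjExponent]
  field_simp

theorem schur_test {μ : Measure Plane} [SFinite μ] {W : Plane → ℝ≥0∞} (hW : Measurable W)
    (hsymm : ∀ z, W (-z) = W z) {S : ℝ≥0∞} (hS : ∀ x, ∫⁻ y, W (x - y) ∂μ ≤ S)
    {r : ℝ} (hr : 1 < r) {u : Plane → ℝ≥0∞} (hu : Measurable u) :
    ∫⁻ x, (∫⁻ y, W (x - y) * u y ∂μ) ^ r ∂μ ≤ S ^ r * ∫⁻ y, u y ^ r ∂μ := by
  have hr0 : 0 < r := by linarith
  have hW2 : Measurable (fun q : Plane × Plane => W (q.1 - q.2)) := by fun_prop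
  have key : ∀ x, (∫⁻ y, W (x - y) * u y ∂μ) ^ r ≤
      S ^ (r - 1) * ∫⁻ y, W (x - y) * u y ^ r ∂μ := by
    intro x
    have hWx : Measurable (fun y => W (x - y)) := by fun_prop
    have h := lintegral_rpow_le_measure_univ_mul (μ.withDensity fun y => W (x - y)) hr
      hu.aemeasurable
    rw [lintegral_withDensity_eq_lintegral_mul _ hWx hu,
      lintegral_withDensity_eq_lintegral_mul _ hWx (hu.pow_const r),
      withDensity_apply _ MeasurableSet.univ, setLIntegral_univ] at h
    refine h.trans ?_
    exact mul_le_mul (ENNReal.rpow_le_rpow (hS x) (by linarith)) le_rfl zero_le zero_le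
  calc ∫⁻ x, (∫⁻ y, W (x - y) * u y ∂μ) ^ r ∂μ
      ≤ ∫⁻ x, S ^ (r - 1) * ∫⁻ y, W (x - y) * u y ^ r ∂μ ∂μ := lintegral_mono key
    _ = S ^ (r - 1) * ∫⁻ x, ∫⁻ y, W (x - y) * u y ^ r ∂μ ∂μ := by
        rw [lintegral_const_mul]
        exact Measurable.lintegral_prod_right' (f := fun q : Plane × Plane =>
          W (q.1 - q.2) * u q.2 ^ r) (by fun_prop)
    _ = S ^ (r - 1) * ∫⁻ y, ∫⁻ x, W (x - y) * u y ^ r ∂μ ∂μ := by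
        rw [lintegral_lintegral_swap]
        exact (by fun_prop : Measurable fun q : Plane × Plane =>
          W (q.1 - q.2) * u q.2 ^ r).aemeasurable
    _ ≤ S ^ (r - 1) * ∫⁻ y, S * u y ^ r ∂μ := by
        gcongr with y
        rw [lintegral_mul_const _ (by fun_prop)]
        gcongr
        refine le_trans (le_of_eq ?_) (hS y)
        exact lintegral_congr fun x => by rw [← hsymm, neg_sub]
    _ = S ^ r * ∫⁻ y, u y ^ r ∂μ := by
        rw [lintegral_const_mul _ (by fun_prop), ← mul_assoc]
        congr 1
        nth_rewrite 2 [← ENNReal.rpow_one S]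
        rw [← ENNReal.rpow_add_of_nonneg _ _ (by linarith) zero_le_one, sub_add_cancel]

/-! ### Multiplication and kernel operators -/

section Operators

variable {μ : Measure Plane} {p : ℝ≥0∞} [Fact (1 ≤ p)]

theorem exists_clm_of_ae (Φ : Lp ℂ p μ → Plane → ℂ)
    (hm : ∀ u, AEStronglyMeasurable (Φ u) μ)
    (hadd : ∀ u v, Φ (u + v) =ᵐ[μ] Φ u + Φ v) (hsmul : ∀ (c : ℂ) u, Φ (c • u) =ᵐ[μ] c • Φ u)
    {C : ℝ} (hC : 0 ≤ C) (hb : ∀ u, eLpNorm (Φ u) p μ ≤ ENNReal.ofReal C * eLpNorm u p μ) :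
    ∃ T : Lp ℂ p μ →L[ℂ] Lp ℂ p μ, (∀ u, T u =ᵐ[μ] Φ u) ∧ ‖T‖ ≤ C := by
  have hL : ∀ u, MemLp (Φ u) p μ := fun u =>
    ⟨hm u, (hb u).trans_lt (ENNReal.mul_lt_top ENNReal.ofReal_lt_top (Lp.eLpNorm_lt_top u))⟩
  let T₀ : Lp ℂ p μ →ₗ[ℂ] Lp ℂ p μ :=
    { toFun := fun u => (hL u).toLp (Φ u)
      map_add' := fun u v => by
        rw [← MemLp.toLp_add]
        exact MemLp.toLp_congr _ _ (hadd u v)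
      map_smul' := fun c u => by
        rw [RingHom.id_apply, ← MemLp.toLp_const_smul]
        exact MemLp.toLp_congr _ _ (hsmul c u) }
  have hT₀ : ∀ u, ‖T₀ u‖ ≤ C * ‖u‖ := by
    intro u
    change ‖(hL u).toLp (Φ u)‖ ≤ _
    rw [Lp.norm_toLp, Lp.norm_def]
    refine (ENNReal.toReal_mono (ENNReal.mul_ne_top ENNReal.ofReal_ne_top
      (Lp.eLpNorm_ne_top u)) (hb u)).trans_eq ?_
    rw [ENNReal.toReal_mul, ENNReal.toReal_ofReal hC]
  exact ⟨T₀.mkContinuous C hT₀, fun u => (hL u).coeFn_toLp, T₀.mkContinuous_norm_le hC _⟩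

theorem clm_ext_ae {A B : Lp ℂ p μ →L[ℂ] Lp ℂ p μ} (h : ∀ u, A u =ᵐ[μ] B u) : A = B :=
  ContinuousLinearMap.ext fun u => Lp.ext (h u)

variable (μ p) in
/-- Multiplication by `f` on `L^p(μ)` (zero if it is not defined). -/
noncomputable def mulOp (f : Plane → ℂ) : Lp ℂ p μ →L[ℂ] Lp ℂ p μ :=
  open Classical in
  if h : ∃ T : Lp ℂ p μ →L[ℂ] Lp ℂ p μ, ∀ u, T u =ᵐ[μ] fun x => f x * u x then h.choose else 0

variable (μ p) in
/-- The integral operator with kernel `K` on `L^p(μ)` (zero if it is not defined). -/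
noncomputable def kerOp (K : Plane → Plane → ℂ) : Lp ℂ p μ →L[ℂ] Lp ℂ p μ :=
  open Classical in
  if h : ∃ T : Lp ℂ p μ →L[ℂ] Lp ℂ p μ, ∀ u, T u =ᵐ[μ] fun x => ∫ y, K x y * u y ∂μ
  then h.choose else 0

theorem mulOp_eq {f : Plane → ℂ} {T : Lp ℂ p μ →L[ℂ] Lp ℂ p μ}
    (hT : ∀ u, T u =ᵐ[μ] fun x => f x * u x) : mulOp μ p f = T := by
  have h : ∃ T : Lp ℂ p μ →L[ℂ] Lp ℂ p μ, ∀ u, T u =ᵐ[μ] fun x => f x * u x := ⟨T, hT⟩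
  rw [mulOp, dif_pos h]
  exact clm_ext_ae fun u => (h.choose_spec u).trans (hT u).symm

theorem kerOp_eq {K : Plane → Plane → ℂ} {T : Lp ℂ p μ →L[ℂ] Lp ℂ p μ}
    (hT : ∀ u, T u =ᵐ[μ] fun x => ∫ y, K x y * u y ∂μ) : kerOp μ p K = T := by
  have h : ∃ T : Lp ℂ p μ →L[ℂ] Lp ℂ p μ, ∀ u, T u =ᵐ[μ] fun x => ∫ y, K x y * u y ∂μ :=
    ⟨T, hT⟩
  rw [kerOp, dif_pos h]
  exact clm_ext_ae fun u => (h.choose_spec u).trans (hT u).symm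

/-- `f` is measurable and bounded by `C`. -/
structure BddMeas (f : Plane → ℂ) (C : ℝ) : Prop where
  meas : Measurable f
  bound : ∀ x, ‖f x‖ ≤ C

theorem BddMeas.nonneg {f : Plane → ℂ} {C : ℝ} (h : BddMeas f C) : 0 ≤ C :=
  (norm_nonneg _).trans (h.bound 0)

theorem exists_mulOp {f : Plane → ℂ} {C : ℝ} (hf : BddMeas f C) :
    ∃ T : Lp ℂ p μ →L[ℂ] Lp ℂ p μ, (∀ u, T u =ᵐ[μ] fun x => f x * u x) ∧ ‖T‖ ≤ C := by
  refine exists_clm_of_ae (fun u x => f x * u x)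
    (fun u => hf.meas.aestronglyMeasurable.mul (Lp.aestronglyMeasurable u)) ?_ ?_ hf.nonneg ?_
  · intro u v
    filter_upwards [Lp.coeFn_add u v] with x hx
    simp only [Pi.add_apply, hx, mul_add]
  · intro c u
    filter_upwards [Lp.coeFn_smul c u] with x hx
    simp [hx, mul_left_comm]
  · intro u
    refine eLpNorm_le_mul_eLpNorm_of_ae_le_mul (Eventually.of_forall fun x => ?_) p
    rw [norm_mul]
    exact mul_le_mul_of_nonneg_right (hf.bound x) (norm_nonneg _)

theorem BddMeas.mulOp_ae {f : Plane → ℂ} {C : ℝ} (hf : BddMeas f C) (u : Lp ℂ p μ) :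
    mulOp μ p f u =ᵐ[μ] fun x => f x * u x := by
  obtain ⟨T, hT, -⟩ := exists_mulOp (μ := μ) (p := p) hf
  rw [mulOp_eq hT]
  exact hT u

theorem BddMeas.norm_mulOp_le {f : Plane → ℂ} {C : ℝ} (hf : BddMeas f C) :
    ‖mulOp μ p f‖ ≤ C := by
  obtain ⟨T, hT, h⟩ := exists_mulOp (μ := μ) (p := p) hf
  rwa [mulOp_eq hT]

/-- The weight `(1 + |z|)^(-s)`. -/
noncomputable def wt (s : ℝ) (z : Plane) : ℝ := (1 + ‖z‖) ^ (-s)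

theorem wt_pos (s : ℝ) (z : Plane) : 0 < wt s z :=
  Real.rpow_pos_of_pos (by positivity) _

theorem wt_neg (s : ℝ) (z : Plane) : wt s (-z) = wt s z := by
  simp [wt]

theorem wt_le_one {s : ℝ} (hs : 0 ≤ s) (z : Plane) : wt s z ≤ 1 :=
  Real.rpow_le_one_of_one_le_of_nonpos (by linarith [norm_nonneg z]) (by linarith)

theorem continuous_wt (s : ℝ) : Continuous (wt s) := by
  unfold wt
  refine Continuous.rpow_const (by fun_prop) fun z => Or.inl ?_
  positivity

/-- Schur's condition with constant `S` for the weight `wt s` and the measure `μ`. -/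
structure SchurBound (μ : Measure Plane) (s S : ℝ) : Prop where
  s_nonneg : 0 ≤ s
  nonneg : 0 ≤ S
  bound : ∀ x, ∫⁻ y, ENNReal.ofReal (wt s (x - y)) ∂μ ≤ ENNReal.ofReal S

/-- `K` is a measurable kernel dominated by `c` times the weight `wt s (x - y)`. -/
structure IsKer (s : ℝ) (K : Plane → Plane → ℂ) (c : ℝ) : Prop where
  meas : Measurable (Function.uncurry K)
  bound : ∀ x y, ‖K x y‖ ≤ c * wt s (x - y)

theorem IsKer.nonneg {s : ℝ} {K : Plane → Plane → ℂ} {c : ℝ} (h : IsKer s K c) : 0 ≤ c := by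
  have := (norm_nonneg _).trans (h.bound 0 0)
  exact nonneg_of_mul_nonneg_left this (wt_pos _ _)

omit [Fact (1 ≤ p)] in
theorem toReal_one_lt (hp1 : 1 < p) (hp : p < ∞) : 1 < p.toReal := by
  rw [← ENNReal.toReal_one]
  exact (ENNReal.toReal_lt_toReal ENNReal.one_ne_top hp.ne).2 hp1

omit [Fact (1 ≤ p)] in
theorem IsKer.integrable [SFinite μ] {s S : ℝ} {K : Plane → Plane → ℂ} {c : ℝ}
    (hK : IsKer s K c) (hS : SchurBound μ s S) (hp1 : 1 < p) (hp : p < ∞) (u : Lp ℂ p μ)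
    (x : Plane) : Integrable (fun y => K x y * u y) μ := by
  have hr := toReal_one_lt hp1 hp
  have hKx : Measurable (K x) := hK.meas.comp (measurable_prodMk_left)
  refine ⟨hKx.aestronglyMeasurable.mul (Lp.aestronglyMeasurable u), ?_⟩
  have hu : ∫⁻ y, ‖u y‖ₑ ^ p.toReal ∂μ < ∞ :=
    lintegral_rpow_enorm_lt_top_of_eLpNorm_lt_top (by positivity) hp.ne (Lp.eLpNorm_lt_top u)
  have hum : Measurable (u : Plane → ℂ) := (Lp.stronglyMeasurable u).measurable
  have hle : ∀ y, ‖K x y * u y‖ₑ ≤ ENNReal.ofReal c *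
      (ENNReal.ofReal (wt s (x - y)) + ‖u y‖ₑ ^ p.toReal) := by
    intro y
    rw [enorm_mul]
    have h1 : ‖K x y‖ₑ ≤ ENNReal.ofReal c * ENNReal.ofReal (wt s (x - y)) := by
      rw [← ENNReal.ofReal_mul hK.nonneg, ← ofReal_norm]
      exact ENNReal.ofReal_le_ofReal (hK.bound x y)
    have hw : ENNReal.ofReal (wt s (x - y)) ≤ 1 := by
      rw [← ENNReal.ofReal_one]
      exact ENNReal.ofReal_le_ofReal (wt_le_one hS.s_nonneg _)
    refine (mul_le_mul_left h1 _).trans ?_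
    rw [mul_assoc]
    gcongr
    rcases le_total ‖u y‖ₑ 1 with h | h
    · exact le_add_right (mul_le_of_le_one_right' h)
    · refine le_add_left ((mul_le_of_le_one_left' hw).trans ?_)
      nth_rewrite 1 [← ENNReal.rpow_one ‖u y‖ₑ]
      exact ENNReal.rpow_le_rpow_of_exponent_le h hr.le
  refine (lintegral_mono hle).trans_lt ?_
  have hw : Measurable fun y => ENNReal.ofReal (wt s (x - y)) :=
    ((continuous_wt s).comp (by fun_prop : Continuous fun y => x - y)).measurable.ennreal_ofReal
  rw [lintegral_const_mul _ (by fun_prop), lintegral_add_left hw]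
  exact ENNReal.mul_lt_top ENNReal.ofReal_lt_top (ENNReal.add_lt_top.2
    ⟨(hS.bound x).trans_lt ENNReal.ofReal_lt_top, hu⟩)

theorem exists_kerOp [SFinite μ] {s S : ℝ} {K : Plane → Plane → ℂ} {c : ℝ}
    (hK : IsKer s K c) (hS : SchurBound μ s S) (hp1 : 1 < p) (hp : p < ∞) :
    ∃ T : Lp ℂ p μ →L[ℂ] Lp ℂ p μ, (∀ u, T u =ᵐ[μ] fun x => ∫ y, K x y * u y ∂μ) ∧
      ‖T‖ ≤ c * S := by
  have hr := toReal_one_lt hp1 hp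
  have hp0 : p ≠ 0 := (zero_lt_one.trans hp1).ne'
  have hint := fun u x => hK.integrable hS hp1 hp u x
  refine exists_clm_of_ae (fun u x => ∫ y, K x y * u y ∂μ) ?_ ?_ ?_
    (mul_nonneg hK.nonneg hS.nonneg) ?_
  · intro u
    have hum : Measurable (u : Plane → ℂ) := (Lp.stronglyMeasurable u).measurable
    have : Measurable (fun q : Plane × Plane => K q.1 q.2 * u q.2) :=
      hK.meas.mul (hum.comp measurable_snd)
    exact (this.stronglyMeasurable.integral_prod_right'
      (f := fun q : Plane × Plane => K q.1 q.2 * u q.2)).aestronglyMeasurable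
  · intro u v
    refine Eventually.of_forall fun x => ?_
    simp only [Pi.add_apply]
    rw [← integral_add (hint u x) (hint v x)]
    refine integral_congr_ae ?_
    filter_upwards [Lp.coeFn_add u v] with y hy
    simp only [Pi.add_apply, hy, mul_add]
  · intro a u
    refine Eventually.of_forall fun x => ?_
    simp only [Pi.smul_apply, smul_eq_mul]
    rw [← integral_const_mul]
    refine integral_congr_ae ?_
    filter_upwards [Lp.coeFn_smul a u] with y hy
    simp [hy, mul_left_comm]
  · intro u
    have hum : Measurable (u : Plane → ℂ) := (Lp.stronglyMeasurable u).measurable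
    set W : Plane → ℝ≥0∞ := fun z => ENNReal.ofReal (wt s z) with hW
    have hWm : Measurable W := (continuous_wt s).measurable.ennreal_ofReal
    have hsch := schur_test hWm (fun z => by simp only [hW, wt_neg]) hS.bound hr
      hum.enorm
    have hle : ∀ x, ‖∫ y, K x y * u y ∂μ‖ₑ ≤ ENNReal.ofReal c * ∫⁻ y, W (x - y) * ‖u y‖ₑ ∂μ := by
      intro x
      refine (enorm_integral_le_lintegral_enorm _).trans ?_
      rw [← lintegral_const_mul _ (by fun_prop)]
      refine lintegral_mono fun y => ?_
      rw [enorm_mul, ← mul_assoc]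
      refine mul_le_mul_left ?_ _
      rw [hW, ← ENNReal.ofReal_mul hK.nonneg, ← ofReal_norm]
      exact ENNReal.ofReal_le_ofReal (hK.bound x y)
    rw [eLpNorm_eq_lintegral_rpow_enorm_toReal hp0 hp.ne,
      eLpNorm_eq_lintegral_rpow_enorm_toReal hp0 hp.ne]
    have hr0 : 0 < p.toReal := by linarith
    calc (∫⁻ x, ‖∫ y, K x y * u y ∂μ‖ₑ ^ p.toReal ∂μ) ^ (1 / p.toReal)
        ≤ (ENNReal.ofReal (c * S) ^ p.toReal * ∫⁻ y, ‖u y‖ₑ ^ p.toReal ∂μ) ^ (1 / p.toReal) := by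
          refine ENNReal.rpow_le_rpow ?_ (by positivity)
          rw [ENNReal.ofReal_mul hK.nonneg, ENNReal.mul_rpow_of_nonneg _ _ hr0.le, mul_assoc]
          refine le_trans ?_ (mul_le_mul_right hsch _)
          rw [← lintegral_const_mul']
          · refine lintegral_mono fun x => ?_
            rw [← ENNReal.mul_rpow_of_nonneg _ _ hr0.le]
            exact ENNReal.rpow_le_rpow (hle x) hr0.le
          · exact ENNReal.rpow_ne_top_of_nonneg hr0.le ENNReal.ofReal_ne_top
      _ = _ := by
          rw [ENNReal.mul_rpow_of_nonneg _ _ (by positivity), ← ENNReal.rpow_mul,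
            mul_one_div_cancel hr0.ne', ENNReal.rpow_one]

end Operators

/-! ### Algebraic rules for multiplication and kernel operators -/

section Algebra

theorem BddMeas.mul {f g : Plane → ℂ} {C D : ℝ} (hf : BddMeas f C) (hg : BddMeas g D) :
    BddMeas (fun x => f x * g x) (C * D) :=
  ⟨hf.meas.mul hg.meas, fun x => by
    rw [norm_mul]
    exact mul_le_mul (hf.bound x) (hg.bound x) (norm_nonneg _) hf.nonneg⟩

theorem BddMeas.sub {f g : Plane → ℂ} {C D : ℝ} (hf : BddMeas f C) (hg : BddMeas g D) :
    BddMeas (fun x => f x - g x) (C + D) :=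
  ⟨hf.meas.sub hg.meas, fun x => (norm_sub_le _ _).trans (add_le_add (hf.bound x) (hg.bound x))⟩

theorem IsKer.mul_left {s : ℝ} {K : Plane → Plane → ℂ} {c : ℝ} (hK : IsKer s K c)
    {f : Plane → ℂ} {C : ℝ} (hf : BddMeas f C) : IsKer s (fun x y => f x * K x y) (C * c) :=
  ⟨(hf.meas.comp measurable_fst).mul hK.meas, fun x y => by
    rw [norm_mul, mul_assoc]
    exact mul_le_mul (hf.bound x) (hK.bound x y) (norm_nonneg _) hf.nonneg⟩

theorem IsKer.mul_right {s : ℝ} {K : Plane → Plane → ℂ} {c : ℝ} (hK : IsKer s K c)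
    {f : Plane → ℂ} {C : ℝ} (hf : BddMeas f C) : IsKer s (fun x y => K x y * f y) (C * c) :=
  ⟨hK.meas.mul (hf.meas.comp measurable_snd), fun x y => by
    rw [norm_mul, mul_comm, mul_assoc]
    exact mul_le_mul (hf.bound y) (hK.bound x y) (norm_nonneg _) hf.nonneg⟩

theorem IsKer.sub {s : ℝ} {K L : Plane → Plane → ℂ} {c d : ℝ} (hK : IsKer s K c)
    (hL : IsKer s L d) : IsKer s (fun x y => K x y - L x y) (c + d) :=
  ⟨hK.meas.sub hL.meas, fun x y => by
    rw [add_mul]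
    exact (norm_sub_le _ _).trans (add_le_add (hK.bound x y) (hL.bound x y))⟩

variable {μ : Measure Plane} {p : ℝ≥0∞} [Fact (1 ≤ p)]

theorem mulOp_congr_ae {f g : Plane → ℂ} {C : ℝ} (hg : BddMeas g C) (h : f =ᵐ[μ] g) :
    mulOp μ p f = mulOp μ p g :=
  mulOp_eq fun u => by
    filter_upwards [hg.mulOp_ae u, h] with x hx hfg
    rw [hx, hfg]

theorem mulOp_one : mulOp μ p (fun _ => 1) = 1 :=
  mulOp_eq fun u => Eventually.of_forall fun x => by simp

theorem mulOp_mul_mulOp {f g : Plane → ℂ} {C D : ℝ} (hf : BddMeas f C) (hg : BddMeas g D) :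
    mulOp μ p f * mulOp μ p g = mulOp μ p (fun x => f x * g x) :=
  (mulOp_eq fun u => by
    filter_upwards [hf.mulOp_ae (mulOp μ p g u), hg.mulOp_ae u] with x h1 h2
    rw [mul_apply_eq_comp, h1, h2, mul_assoc]).symm

theorem mulOp_sub {f g : Plane → ℂ} {C D : ℝ} (hf : BddMeas f C) (hg : BddMeas g D) :
    mulOp μ p f - mulOp μ p g = mulOp μ p (fun x => f x - g x) :=
  (mulOp_eq fun u => by
    filter_upwards [hf.mulOp_ae u, hg.mulOp_ae u, Lp.coeFn_sub (mulOp μ p f u) (mulOp μ p g u)]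
      with x h1 h2 h3
    rw [sub_apply, h3, Pi.sub_apply, h1, h2, sub_mul]).symm

theorem mulOp_add {f g : Plane → ℂ} {C D : ℝ} (hf : BddMeas f C) (hg : BddMeas g D) :
    mulOp μ p f + mulOp μ p g = mulOp μ p (fun x => f x + g x) :=
  (mulOp_eq fun u => by
    filter_upwards [hf.mulOp_ae u, hg.mulOp_ae u, Lp.coeFn_add (mulOp μ p f u) (mulOp μ p g u)]
      with x h1 h2 h3
    rw [add_apply, h3, Pi.add_apply, h1, h2, add_mul]).symm

variable [SFinite μ] {s S : ℝ}

theorem IsKer.kerOp_ae {K : Plane → Plane → ℂ} {c : ℝ} (hK : IsKer s K c)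
    (hS : SchurBound μ s S) (hp1 : 1 < p) (hp : p < ∞) (u : Lp ℂ p μ) :
    kerOp μ p K u =ᵐ[μ] fun x => ∫ y, K x y * u y ∂μ := by
  obtain ⟨T, hT, -⟩ := exists_kerOp (μ := μ) (p := p) hK hS hp1 hp
  rw [kerOp_eq hT]
  exact hT u

theorem IsKer.norm_kerOp_le {K : Plane → Plane → ℂ} {c : ℝ} (hK : IsKer s K c)
    (hS : SchurBound μ s S) (hp1 : 1 < p) (hp : p < ∞) : ‖kerOp μ p K‖ ≤ c * S := by
  obtain ⟨T, hT, h⟩ := exists_kerOp (μ := μ) (p := p) hK hS hp1 hp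
  rwa [kerOp_eq hT]

theorem mulOp_mul_kerOp {f : Plane → ℂ} {C : ℝ} (hf : BddMeas f C)
    {K : Plane → Plane → ℂ} {c : ℝ} (hK : IsKer s K c)
    (hS : SchurBound μ s S) (hp1 : 1 < p) (hp : p < ∞) :
    mulOp μ p f * kerOp μ p K = kerOp μ p (fun x y => f x * K x y) :=
  (kerOp_eq fun u => by
    filter_upwards [hf.mulOp_ae (kerOp μ p K u), hK.kerOp_ae hS hp1 hp u] with x h1 h2
    rw [mul_apply_eq_comp, h1, h2, ← integral_const_mul]
    simp only [mul_assoc]).symm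

theorem kerOp_mul_mulOp {f : Plane → ℂ} {C : ℝ} (hf : BddMeas f C)
    {K : Plane → Plane → ℂ} {c : ℝ} (hK : IsKer s K c)
    (hS : SchurBound μ s S) (hp1 : 1 < p) (hp : p < ∞) :
    kerOp μ p K * mulOp μ p f = kerOp μ p (fun x y => K x y * f y) :=
  (kerOp_eq fun u => by
    filter_upwards [hK.kerOp_ae hS hp1 hp (mulOp μ p f u)] with x h1
    rw [mul_apply_eq_comp, h1]
    refine integral_congr_ae ?_
    filter_upwards [hf.mulOp_ae u] with y hy
    rw [hy, mul_assoc]).symm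

theorem kerOp_sub {K L : Plane → Plane → ℂ} {c d : ℝ} (hK : IsKer s K c) (hL : IsKer s L d)
    (hS : SchurBound μ s S) (hp1 : 1 < p) (hp : p < ∞) :
    kerOp μ p K - kerOp μ p L = kerOp μ p (fun x y => K x y - L x y) :=
  (kerOp_eq fun u => by
    filter_upwards [hK.kerOp_ae hS hp1 hp u, hL.kerOp_ae hS hp1 hp u,
      Lp.coeFn_sub (kerOp μ p K u) (kerOp μ p L u)] with x h1 h2 h3
    rw [sub_apply, h3, Pi.sub_apply, h1, h2,
      ← integral_sub (hK.integrable hS hp1 hp u x) (hL.integrable hS hp1 hp u x)]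
    simp only [sub_mul]).symm

/-- The characteristic function of `M`, with complex values. -/
noncomputable def chi (M : Set Plane) : Plane → ℂ := M.indicator fun _ => 1

theorem chi_of_mem {M : Set Plane} {x : Plane} (h : x ∈ M) : chi M x = 1 :=
  Set.indicator_of_mem h _

theorem chi_of_notMem {M : Set Plane} {x : Plane} (h : x ∉ M) : chi M x = 0 :=
  Set.indicator_of_notMem h _

theorem bddMeas_chi {M : Set Plane} (hM : MeasurableSet M) : BddMeas (chi M) 1 :=
  ⟨measurable_const.indicator hM, fun x => by
    by_cases h : x ∈ M
    · simp [chi_of_mem h]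
    · simp [chi_of_notMem h]⟩

omit [SFinite μ] in
theorem indicatorOp_eq_mulOp {M : Set Plane} (hM : MeasurableSet M) :
    indicatorOp μ p M hM = mulOp μ p (chi M) :=
  (mulOp_eq fun u => by
    have h : (indicatorOp μ p M hM u : Plane → ℂ) =ᵐ[μ] M.indicator u :=
      ((Lp.memLp u).indicator hM).coeFn_toLp
    filter_upwards [h] with x hx
    rw [hx]
    by_cases h : x ∈ M
    · simp [chi_of_mem h, h]
    · simp [chi_of_notMem h, h]).symm

end Algebra

/-! ### Sums of operators with supports of finite overlap -/

section BlockSum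

variable {μ : Measure Plane} {p : ℝ≥0∞} [Fact (1 ≤ p)]

theorem ofReal_norm_rpow (hp1 : 1 < p) (hp : p < ∞) (u : Lp ℂ p μ) :
    ENNReal.ofReal (‖u‖ ^ p.toReal) = ∫⁻ x, ‖u x‖ₑ ^ p.toReal ∂μ := by
  have hr := toReal_one_lt hp1 hp
  rw [← ENNReal.ofReal_rpow_of_nonneg (norm_nonneg _) (by linarith), ofReal_norm, Lp.enorm_def,
    eLpNorm_eq_lintegral_rpow_enorm_toReal (zero_lt_one.trans hp1).ne' hp.ne, ← ENNReal.rpow_mul,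
    one_div_mul_cancel (by linarith), ENNReal.rpow_one]

variable {ι : Type*} {N : ι → Set Plane} {N₀ : ℕ}

theorem norm_sum_rpow_le (hp1 : 1 < p) (hp : p < ∞)
    (hover : ∀ x, ∀ F : Finset ι, (∀ i ∈ F, x ∈ N i) → F.card ≤ N₀) (F : Finset ι)
    (w : ι → Lp ℂ p μ) (hw : ∀ i, ∀ᵐ x ∂μ, x ∉ N i → w i x = 0) :
    ‖∑ i ∈ F, w i‖ ^ p.toReal ≤ (N₀ : ℝ) ^ (p.toReal - 1) * ∑ i ∈ F, ‖w i‖ ^ p.toReal := by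
  classical
  have hr := toReal_one_lt hp1 hp
  have hr0 : 0 < p.toReal := by linarith
  have hm : ∀ i, Measurable (w i : Plane → ℂ) := fun i => (Lp.stronglyMeasurable _).measurable
  rw [← ENNReal.ofReal_le_ofReal_iff (by positivity), ofReal_norm_rpow hp1 hp,
    ENNReal.ofReal_mul (by positivity), ENNReal.ofReal_sum_of_nonneg (fun _ _ => by positivity)]
  simp only [ofReal_norm_rpow hp1 hp]
  rw [← lintegral_finsetSum _ fun i _ => by have := hm i; fun_prop,
    ← lintegral_const_mul _ (by have := hm; fun_prop)]
  refine lintegral_mono_ae ?_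
  have hall : ∀ᵐ x ∂μ, ∀ i ∈ F, x ∉ N i → w i x = 0 :=
    (Filter.eventually_all_finset F).2 fun i _ => hw i
  filter_upwards [Lp.coeFn_finsetSum F w, hall] with x hx hx2
  rw [hx, Finset.sum_apply]
  set Fx := F.filter fun i => x ∈ N i with hFx
  have h1 : ∑ i ∈ F, w i x = ∑ i ∈ Fx, w i x := by
    refine (Finset.sum_subset (Finset.filter_subset _ _) fun i hi hi2 => ?_).symm
    exact hx2 i hi fun h => hi2 (Finset.mem_filter.2 ⟨hi, h⟩)
  have hcard : Fx.card ≤ N₀ := hover x Fx fun i hi => (Finset.mem_filter.1 hi).2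
  calc ‖∑ i ∈ F, w i x‖ₑ ^ p.toReal ≤ (∑ i ∈ Fx, ‖w i x‖ₑ) ^ p.toReal := by
        rw [h1]
        exact ENNReal.rpow_le_rpow (enorm_sum_le _ _) hr0.le
    _ ≤ (Fx.card : ℝ≥0∞) ^ (p.toReal - 1) * ∑ i ∈ Fx, ‖w i x‖ₑ ^ p.toReal :=
        ENNReal.rpow_sum_le_const_mul_sum_rpow _ _ hr.le
    _ ≤ ENNReal.ofReal ((N₀ : ℝ) ^ (p.toReal - 1)) * ∑ i ∈ F, ‖w i x‖ₑ ^ p.toReal := by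
        rw [← ENNReal.ofReal_rpow_of_nonneg (by positivity) (by linarith), ENNReal.ofReal_natCast]
        refine mul_le_mul (ENNReal.rpow_le_rpow (by exact_mod_cast hcard) (by linarith))
          (Finset.sum_le_sum_of_subset (Finset.filter_subset _ _)) zero_le zero_le

theorem sum_norm_chi_rpow_le (hp1 : 1 < p) (hp : p < ∞) (hN : ∀ i, MeasurableSet (N i))
    (hover : ∀ x, ∀ F : Finset ι, (∀ i ∈ F, x ∈ N i) → F.card ≤ N₀) (F : Finset ι)
    (u : Lp ℂ p μ) :
    ∑ i ∈ F, ‖mulOp μ p (chi (N i)) u‖ ^ p.toReal ≤ N₀ * ‖u‖ ^ p.toReal := by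
  classical
  have hr := toReal_one_lt hp1 hp
  have hr0 : 0 < p.toReal := by linarith
  have hm : Measurable (u : Plane → ℂ) := (Lp.stronglyMeasurable _).measurable
  have hm2 : ∀ i, Measurable (mulOp μ p (chi (N i)) u : Plane → ℂ) :=
    fun i => (Lp.stronglyMeasurable _).measurable
  rw [← ENNReal.ofReal_le_ofReal_iff (by positivity),
    ENNReal.ofReal_mul (by positivity), ENNReal.ofReal_sum_of_nonneg (fun _ _ => by positivity)]
  simp only [ofReal_norm_rpow hp1 hp]
  rw [← lintegral_finsetSum _ fun i _ => by have := hm2 i; fun_prop,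
    ← lintegral_const_mul _ (by fun_prop)]
  refine lintegral_mono_ae ?_
  have hall : ∀ᵐ x ∂μ, ∀ i ∈ F, mulOp μ p (chi (N i)) u x = chi (N i) x * u x :=
    (Filter.eventually_all_finset F).2 fun i _ => (bddMeas_chi (hN i)).mulOp_ae u
  filter_upwards [hall] with x hx
  set Fx := F.filter fun i => x ∈ N i with hFx
  have hcard : Fx.card ≤ N₀ := hover x Fx fun i hi => (Finset.mem_filter.1 hi).2
  have h1 : ∑ i ∈ F, ‖mulOp μ p (chi (N i)) u x‖ₑ ^ p.toReal = ∑ i ∈ Fx, ‖u x‖ₑ ^ p.toReal := by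
    rw [hFx, Finset.sum_filter]
    refine Finset.sum_congr rfl fun i hi => ?_
    rw [hx i hi]
    by_cases h : x ∈ N i
    · simp [chi_of_mem h, h]
    · simp [chi_of_notMem h, h, hr0]
  rw [h1, Finset.sum_const, nsmul_eq_mul, ENNReal.ofReal_natCast]
  exact mul_le_mul_left (by exact_mod_cast hcard) _

theorem exists_blockSum (hp1 : 1 < p) (hp : p < ∞) (hN : ∀ i, MeasurableSet (N i))
    (hover : ∀ x, ∀ F : Finset ι, (∀ i ∈ F, x ∈ N i) → F.card ≤ N₀)
    {Z : ι → Lp ℂ p μ →L[ℂ] Lp ℂ p μ} (hl : ∀ i, mulOp μ p (chi (N i)) * Z i = Z i)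
    (hr : ∀ i, Z i * mulOp μ p (chi (N i)) = Z i) {z : ℝ} (hz0 : 0 ≤ z) (hz : ∀ i, ‖Z i‖ ≤ z) :
    ∃ Y : Lp ℂ p μ →L[ℂ] Lp ℂ p μ, (∀ u, HasSum (fun i => Z i u) (Y u)) ∧ ‖Y‖ ≤ N₀ * z := by
  have hr1 := toReal_one_lt hp1 hp
  set r := p.toReal with hrdef
  have hr0 : 0 < r := by linarith
  have hsupp : ∀ (u : Lp ℂ p μ) (i : ι), ∀ᵐ x ∂μ, x ∉ N i → (Z i u : Plane → ℂ) x = 0 := by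
    intro u i
    have h1 : Z i u = mulOp μ p (chi (N i)) (Z i u) := by
      conv_lhs => rw [← hl i]
      rfl
    rw [h1]
    filter_upwards [(bddMeas_chi (hN i)).mulOp_ae (Z i u)] with x hx hxN
    rw [hx, chi_of_notMem hxN, zero_mul]
  have hkey : ∀ (u : Lp ℂ p μ) (F : Finset ι), ‖∑ i ∈ F, Z i u‖ ^ r ≤
      (N₀ : ℝ) ^ (r - 1) * z ^ r * ∑ i ∈ F, ‖mulOp μ p (chi (N i)) u‖ ^ r := by
    intro u F
    refine (norm_sum_rpow_le hp1 hp hover F (fun i => Z i u) (hsupp u)).trans ?_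
    rw [mul_assoc, Finset.mul_sum _ _ (z ^ r)]
    refine mul_le_mul_of_nonneg_left (Finset.sum_le_sum fun i _ => ?_)
      (Real.rpow_nonneg (Nat.cast_nonneg _) _)
    rw [← Real.mul_rpow hz0 (norm_nonneg _)]
    refine Real.rpow_le_rpow (norm_nonneg _) ?_ hr0.le
    have h1 : Z i u = Z i (mulOp μ p (chi (N i)) u) := by
      conv_lhs => rw [← hr i]
      rfl
    rw [h1]
    exact (Z i).le_of_opNorm_le (hz i) _
  have hbound : ∀ (u : Lp ℂ p μ) (F : Finset ι), ‖∑ i ∈ F, Z i u‖ ≤ N₀ * z * ‖u‖ := by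
    intro u F
    rw [← Real.rpow_le_rpow_iff (norm_nonneg _) (by positivity) hr0]
    refine (hkey u F).trans ((mul_le_mul_of_nonneg_left
      (sum_norm_chi_rpow_le hp1 hp hN hover F u) (by positivity)).trans_eq ?_)
    rw [Real.mul_rpow (by positivity) (norm_nonneg _), Real.mul_rpow (by positivity) hz0]
    rcases Nat.eq_zero_or_pos N₀ with h0 | h0
    · simp [h0, hr0.ne']
    · have : (N₀ : ℝ) ^ r = (N₀ : ℝ) ^ (r - 1) * N₀ := by
        rw [Real.rpow_sub_one (by positivity)]
        field_simp
      rw [this]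
      ring
  have hsum : ∀ u : Lp ℂ p μ, Summable fun i => Z i u := by
    intro u
    have hs : Summable fun i => ‖mulOp μ p (chi (N i)) u‖ ^ r :=
      summable_of_sum_le (fun _ => by positivity)
        (fun F => sum_norm_chi_rpow_le hp1 hp hN hover F u)
    rw [summable_iff_vanishing_norm]
    intro ε hε
    set c := (N₀ : ℝ) ^ (r - 1) * z ^ r with hc
    have hc0 : 0 ≤ c := by positivity
    obtain ⟨s, hs⟩ := summable_iff_vanishing_norm.1 hs (ε ^ r / (c + 1)) (by positivity)
    refine ⟨s, fun t ht => ?_⟩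
    rw [← Real.rpow_lt_rpow_iff (norm_nonneg _) hε.le hr0]
    have h1 := hs t ht
    rw [Real.norm_of_nonneg (Finset.sum_nonneg fun _ _ => by positivity)] at h1
    calc _ ≤ c * ∑ i ∈ t, ‖mulOp μ p (chi (N i)) u‖ ^ r := hkey u t
      _ ≤ c * (ε ^ r / (c + 1)) := mul_le_mul_of_nonneg_left h1.le hc0
      _ < ε ^ r := by
        rw [mul_div_assoc', div_lt_iff₀ (by positivity)]
        have : 0 < ε ^ r := by positivity
        nlinarith
  let Y₀ : Lp ℂ p μ →ₗ[ℂ] Lp ℂ p μ :=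
    { toFun := fun u => ∑' i, Z i u
      map_add' := fun u v => by simp only [map_add, (hsum u).tsum_add (hsum v)]
      map_smul' := fun c u => by simp only [map_smul, RingHom.id_apply, (hsum u).tsum_const_smul] }
  have hY : ∀ u, ‖Y₀ u‖ ≤ N₀ * z * ‖u‖ := fun u =>
    le_of_tendsto (hsum u).hasSum.norm (Eventually.of_forall (hbound u))
  exact ⟨Y₀.mkContinuous _ hY, fun u => (hsum u).hasSum,
    Y₀.mkContinuous_norm_le (by positivity) _⟩

end BlockSum

/-! ### A decomposition of the plane into square cells -/

section Cells

/-- The index of the square cell of side `L` that contains `x`. -/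
noncomputable def cellIdx (L : ℝ) (x : Plane) : Fin 2 → ℤ := fun j => ⌊x j / L⌋

/-- The corner of the cell with index `i`. -/
noncomputable def cellPt (L : ℝ) (i : Fin 2 → ℤ) : Plane := WithLp.toLp 2 fun j => L * i j

/-- The square cell with index `i`. -/
def cell (L : ℝ) (i : Fin 2 → ℤ) : Set Plane := {x | cellIdx L x = i}

theorem measurable_cellIdx (L : ℝ) : Measurable (cellIdx L) := by
  unfold cellIdx
  refine measurable_pi_lambda _ fun j => ?_
  exact Int.measurable_floor.comp (by fun_prop)

theorem measurableSet_cell (L : ℝ) (i : Fin 2 → ℤ) : MeasurableSet (cell L i) :=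
  measurable_cellIdx L (measurableSet_singleton i)

theorem plane_norm_le (x : Plane) : ‖x‖ ≤ |x 0| + |x 1| := by
  rw [EuclideanSpace.norm_eq, Fin.sum_univ_two, Real.sqrt_le_left (by positivity)]
  simp only [Real.norm_eq_abs]
  nlinarith [abs_nonneg (x 0), abs_nonneg (x 1)]

theorem norm_sub_cellPt_le {L : ℝ} (hL : 0 < L) (x : Plane) :
    ‖x - cellPt L (cellIdx L x)‖ ≤ 2 * L := by
  have h : ∀ j, |(x - cellPt L (cellIdx L x)) j| ≤ L := by
    intro j
    have h1 : (x - cellPt L (cellIdx L x)) j = x j - L * ⌊x j / L⌋ := rfl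
    have h2 := Int.floor_le (x j / L)
    have h3 := Int.lt_floor_add_one (x j / L)
    rw [le_div_iff₀ hL] at h2
    rw [div_lt_iff₀ hL] at h3
    rw [h1, abs_le]
    constructor <;> nlinarith
  linarith [plane_norm_le (x - cellPt L (cellIdx L x)), h 0, h 1]

theorem norm_sub_cellPt_le_of_mem {L : ℝ} (hL : 0 < L) {x : Plane} {i : Fin 2 → ℤ}
    (hx : x ∈ cell L i) : ‖x - cellPt L i‖ ≤ 2 * L := by
  have h : cellIdx L x = i := hx
  rw [← h]
  exact norm_sub_cellPt_le hL x

theorem mem_Icc_of_norm_sub_cellPt_le {L : ℝ} (hL : 0 < L) {m : ℤ} {x : Plane} {i : Fin 2 → ℤ}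
    (h : ‖x - cellPt L i‖ ≤ m * L) (j : Fin 2) :
    i j ∈ Finset.Icc (⌊x j / L⌋ - m) (⌊x j / L⌋ + m + 1) := by
  have h1 : |x j - L * i j| ≤ m * L := (PiLp.norm_apply_le (x - cellPt L i) j).trans h
  have h2 := Int.floor_le (x j / L)
  have h3 := Int.lt_floor_add_one (x j / L)
  rw [abs_le] at h1
  have h4 : (i j : ℝ) ≤ x j / L + m := by
    rw [← sub_le_iff_le_add, le_div_iff₀ hL]
    nlinarith
  have h5 : x j / L - m ≤ i j := by
    rw [sub_le_iff_le_add, div_le_iff₀ hL]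
    nlinarith
  rw [Finset.mem_Icc]
  constructor
  · have : ((⌊x j / L⌋ - m : ℤ) : ℝ) ≤ i j := by push_cast; linarith
    exact_mod_cast this
  · have : (i j : ℝ) < ((⌊x j / L⌋ + m + 1 : ℤ) : ℝ) := by push_cast; linarith
    exact le_of_lt (by exact_mod_cast this)

theorem card_le_of_norm_sub_cellPt_le {L : ℝ} (hL : 0 < L) (x : Plane)
    (F : Finset (Fin 2 → ℤ)) (hF : ∀ i ∈ F, ‖x - cellPt L i‖ ≤ 4 * L) : F.card ≤ 100 := by
  have hsub : F ⊆ Fintype.piFinset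
      fun j => Finset.Icc (⌊x j / L⌋ - 4) (⌊x j / L⌋ + 4 + 1) := by
    intro i hi
    rw [Fintype.mem_piFinset]
    exact fun j => mem_Icc_of_norm_sub_cellPt_le hL (m := 4) (by exact_mod_cast hF i hi) j
  refine (Finset.card_le_card hsub).trans ?_
  rw [Fintype.card_piFinset, Fin.prod_univ_two, Int.card_Icc, Int.card_Icc]
  have : ∀ a : ℤ, (a + 4 + 1 + 1 - (a - 4)).toNat = 10 := fun a => by
    have : a + 4 + 1 + 1 - (a - 4) = 10 := by ring
    rw [this]; rfl
  rw [this, this]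
  norm_num

theorem finite_cells_of_norm_le {L : ℝ} (hL : 0 < L) (ρ : ℝ) :
    {i | ∃ x ∈ cell L i, ‖x‖ ≤ ρ}.Finite := by
  obtain ⟨m, hm⟩ := exists_int_gt (ρ / L + 2)
  have hm := lt_sub_iff_add_lt.2 hm
  refine (Fintype.piFinset fun j : Fin 2 =>
    Finset.Icc (⌊(0 : Plane) j / L⌋ - m) (⌊(0 : Plane) j / L⌋ + m + 1)).finite_toSet.subset ?_
  rintro i ⟨x, hx, hρ⟩
  rw [Finset.mem_coe, Fintype.mem_piFinset]
  refine fun j => mem_Icc_of_norm_sub_cellPt_le hL ?_ j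
  have h1 := norm_sub_cellPt_le_of_mem hL hx
  have h2 : ‖0 - cellPt L i‖ ≤ ‖x - cellPt L i‖ + ‖x‖ := by
    have : 0 - cellPt L i = (x - cellPt L i) - x := by abel
    rw [this]
    exact norm_sub_le _ _
  have h3 : ρ < (m - 2) * L := by
    rw [← div_lt_iff₀ hL]
    linarith
  linarith

end Cells

/-! ### Truncated convolution kernels and approximation by operators of finite rank -/

section Trunc

/-- A continuous cut-off: `1` for `t ≥ 1` and `0` for `t ≤ 0`. -/
noncomputable def clip (t : ℝ) : ℝ := max 0 (min 1 t)

theorem continuous_clip : Continuous clip := by unfold clip; fun_prop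

theorem clip_nonneg (t : ℝ) : 0 ≤ clip t := le_max_left _ _

theorem clip_le_one (t : ℝ) : clip t ≤ 1 := max_le zero_le_one (min_le_left _ _)

theorem clip_of_one_le {t : ℝ} (h : 1 ≤ t) : clip t = 1 := by simp [clip, h]

theorem clip_of_nonpos {t : ℝ} (h : t ≤ 0) : clip t = 0 := by
  rw [clip, min_eq_right (by linarith), max_eq_left h]

theorem abs_clip_sub_le (t t' : ℝ) : |clip t - clip t'| ≤ |t - t'| := by
  unfold clip
  rw [max_comm 0, max_comm 0]
  exact (abs_max_sub_max_le_abs _ _ 0).trans ((abs_min_sub_min_le_max 1 t 1 t').trans (by simp))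

/-- The kernel `k` cut off outside the ball of radius `R + 1`. -/
noncomputable def trunc (R : ℝ) (k : Plane → ℂ) (z : Plane) : ℂ := k z * (clip (R + 1 - ‖z‖) : ℝ)

theorem continuous_trunc {k : Plane → ℂ} (hk : Continuous k) (R : ℝ) : Continuous (trunc R k) := by
  unfold trunc
  exact hk.mul (Complex.continuous_ofReal.comp (continuous_clip.comp (by fun_prop)))

theorem trunc_eq_zero {k : Plane → ℂ} {R : ℝ} {z : Plane} (h : R + 1 ≤ ‖z‖) :
    trunc R k z = 0 := by
  rw [trunc, clip_of_nonpos (by linarith)]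
  simp

theorem norm_trunc_le (k : Plane → ℂ) (R : ℝ) (z : Plane) : ‖trunc R k z‖ ≤ ‖k z‖ := by
  rw [trunc, norm_mul, Complex.norm_real, Real.norm_of_nonneg (clip_nonneg _)]
  exact mul_le_of_le_one_right (norm_nonneg _) (clip_le_one _)

theorem uniformContinuous_trunc {k : Plane → ℂ} (hk : Continuous k) (R : ℝ) :
    UniformContinuous (trunc R k) := by
  refine (continuous_trunc hk R).uniformContinuous_of_tendsto_cocompact (x := 0) ?_
  refine tendsto_const_nhds.congr' ?_
  have h : ∀ᶠ z in cocompact Plane, R + 1 ≤ ‖z‖ :=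
    tendsto_norm_cocompact_atTop.eventually (eventually_ge_atTop _)
  filter_upwards [h] with z hz
  rw [trunc_eq_zero hz]

theorem isKer_conv {s C : ℝ} {k : Plane → ℂ} (hk : Continuous k)
    (hb : ∀ z, ‖k z‖ ≤ C * wt s z) : IsKer s (fun x y => k (x - y)) C :=
  ⟨(hk.comp (by fun_prop : Continuous fun q : Plane × Plane => q.1 - q.2)).measurable,
    fun _ _ => hb _⟩

theorem wt_add (s δ : ℝ) (z : Plane) : wt (s + δ) z = wt s z * wt δ z := by
  rw [wt, wt, wt, ← Real.rpow_add (by positivity)]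
  congr 1
  ring

theorem wt_anti {s : ℝ} (hs : 0 ≤ s) {z : Plane} {R : ℝ} (h : R ≤ ‖z‖) (hR : 0 ≤ R) :
    wt s z ≤ (1 + R) ^ (-s) :=
  Real.rpow_le_rpow_of_nonpos (by linarith) (by linarith) (by linarith)

theorem le_wt {s : ℝ} (hs : 0 ≤ s) {z : Plane} {R : ℝ} (h : ‖z‖ ≤ R) :
    (1 + R) ^ (-s) ≤ wt s z :=
  Real.rpow_le_rpow_of_nonpos (by positivity) (by linarith) (by linarith)

theorem isKer_trunc {s C : ℝ} {k : Plane → ℂ} (hk : Continuous k)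
    (hb : ∀ z, ‖k z‖ ≤ C * wt s z) (R : ℝ) : IsKer s (fun x y => trunc R k (x - y)) C :=
  isKer_conv (continuous_trunc hk R) fun z => (norm_trunc_le k R z).trans (hb z)

theorem isKer_sub_trunc {s δ C : ℝ} {k : Plane → ℂ} (hk : Continuous k) (hC : 0 ≤ C) (hδ : 0 ≤ δ)
    (hb : ∀ z, ‖k z‖ ≤ C * wt (s + δ) z) {R : ℝ} (hR : 0 ≤ R) :
    IsKer s (fun x y => k (x - y) - trunc R k (x - y)) (C * (1 + R) ^ (-δ)) := by
  refine isKer_conv (k := fun z => k z - trunc R k z) (hk.sub (continuous_trunc hk R)) fun z => ?_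
  rcases le_total ‖z‖ R with h | h
  · rw [trunc, clip_of_one_le (by linarith)]
    have := wt_pos s z
    simp only [Complex.ofReal_one, mul_one, sub_self, norm_zero]
    positivity
  · have h1 : k z - trunc R k z = k z * ((1 - clip (R + 1 - ‖z‖) : ℝ) : ℂ) := by
      rw [trunc]; push_cast; ring
    rw [h1, norm_mul, Complex.norm_real, Real.norm_of_nonneg (by linarith [clip_le_one (R + 1 - ‖z‖)])]
    refine (mul_le_of_le_one_right (norm_nonneg _)
      (by linarith [clip_nonneg (R + 1 - ‖z‖)])).trans ((hb z).trans ?_)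
    rw [wt_add, mul_comm (wt s z), ← mul_assoc]
    exact mul_le_mul_of_nonneg_right (mul_le_mul_of_nonneg_left (wt_anti hδ h hR) hC)
      (wt_pos _ _).le

theorem isKer_of_bounded_range {s η ρ : ℝ} (hs : 0 ≤ s) (hη : 0 ≤ η) (hρ : 0 ≤ ρ)
    {K : Plane → Plane → ℂ}
    (hm : Measurable (Function.uncurry K)) (hb : ∀ x y, ‖K x y‖ ≤ η)
    (h0 : ∀ x y, ρ < ‖x - y‖ → K x y = 0) : IsKer s K (η * (1 + ρ) ^ s) := by
  refine ⟨hm, fun x y => ?_⟩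
  rcases le_or_gt ‖x - y‖ ρ with h | h
  · refine (hb x y).trans ?_
    have h1 := le_wt hs h
    have h2 : (1 + ρ) ^ s * (1 + ρ) ^ (-s) = 1 := by
      rw [← Real.rpow_add (by linarith), add_neg_cancel, Real.rpow_zero]
    calc η = η * ((1 + ρ) ^ s * (1 + ρ) ^ (-s)) := by rw [h2, mul_one]
      _ ≤ η * ((1 + ρ) ^ s * wt s (x - y)) := by gcongr
      _ = _ := by ring
  · rw [h0 x y h, norm_zero]
    have := wt_pos s (x - y)
    positivity

theorem SchurBound.measure_lt_top {μ : Measure Plane} {s S : ℝ} (hS : SchurBound μ s S)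
    {M : Set Plane} (hM : Bornology.IsBounded M) : μ M < ∞ := by
  obtain ⟨ρ, hρ⟩ := hM.subset_closedBall 0
  refine (measure_mono hρ).trans_lt ?_
  set c := ENNReal.ofReal ((1 + max ρ 0) ^ (-s)) with hc
  have hc0 : c ≠ 0 := by
    rw [hc, Ne, ENNReal.ofReal_eq_zero, not_le]
    have := le_max_right ρ 0
    positivity
  have h1 : c * μ (Metric.closedBall 0 ρ) ≤ ENNReal.ofReal S := by
    rw [← setLIntegral_const]
    refine le_trans ?_ (hS.bound 0)
    refine le_trans ?_ (setLIntegral_le_lintegral (Metric.closedBall 0 ρ) _)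
    refine setLIntegral_mono' Metric.isClosed_closedBall.measurableSet fun y hy => ?_
    refine ENNReal.ofReal_le_ofReal (le_wt hS.s_nonneg ?_)
    rw [zero_sub, norm_neg]
    exact (mem_closedBall_zero_iff.1 hy).trans (le_max_left _ _)
  by_contra hcon
  rw [not_lt_top_iff] at hcon
  rw [hcon, ENNReal.mul_top hc0] at h1
  exact ENNReal.ofReal_ne_top (top_le_iff.1 h1)

end Trunc

section FiniteRank

/-- `T` is a norm limit of operators of finite rank. -/
def IsFinRankLimit {E : Type*} [NormedAddCommGroup E] [NormedSpace ℂ E] (T : E →L[ℂ] E) : Prop :=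
  ∀ ε > 0, ∃ F : E →L[ℂ] E, F.toLinearMap.HasFiniteRange ∧ ‖T - F‖ < ε

section General

variable {E : Type*} [NormedAddCommGroup E] [NormedSpace ℂ E]

theorem IsFinRankLimit.of_forall_norm_sub_lt {T : E →L[ℂ] E}
    (h : ∀ ε > 0, ∃ T', IsFinRankLimit T' ∧ ‖T - T'‖ < ε) : IsFinRankLimit T := by
  intro ε hε
  obtain ⟨T', hT', h1⟩ := h (ε / 2) (by positivity)
  obtain ⟨F, hF, h2⟩ := hT' (ε / 2) (by positivity)
  refine ⟨F, hF, ?_⟩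
  calc ‖T - F‖ = ‖(T - T') + (T' - F)‖ := by congr 1; abel
    _ ≤ ‖T - T'‖ + ‖T' - F‖ := norm_add_le _ _
    _ < ε := by linarith

theorem IsFinRankLimit.mul_left {T : E →L[ℂ] E} (hT : IsFinRankLimit T) (A : E →L[ℂ] E) :
    IsFinRankLimit (A * T) := by
  intro ε hε
  obtain ⟨F, hF, h⟩ := hT (ε / (‖A‖ + 1)) (by positivity)
  refine ⟨A * F, hF.comp_left A.toLinearMap, ?_⟩
  rw [← mul_sub]
  calc ‖A * (T - F)‖ ≤ ‖A‖ * ‖T - F‖ := norm_mul_le _ _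
    _ ≤ (‖A‖ + 1) * ‖T - F‖ := by gcongr; linarith
    _ < ε := by rwa [← lt_div_iff₀' (by positivity)]

theorem IsFinRankLimit.mul_right {T : E →L[ℂ] E} (hT : IsFinRankLimit T) (A : E →L[ℂ] E) :
    IsFinRankLimit (T * A) := by
  intro ε hε
  obtain ⟨F, hF, h⟩ := hT (ε / (‖A‖ + 1)) (by positivity)
  refine ⟨F * A, hF.comp_right A.toLinearMap, ?_⟩
  rw [← sub_mul]
  calc ‖(T - F) * A‖ ≤ ‖T - F‖ * ‖A‖ := norm_mul_le _ _
    _ ≤ ‖T - F‖ * (‖A‖ + 1) := by gcongr; linarith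
    _ < ε := by rwa [← lt_div_iff₀ (by positivity)]

end General

variable {μ : Measure Plane} {p : ℝ≥0∞} [Fact (1 ≤ p)] [SFinite μ] {s S δ C : ℝ} {k : Plane → ℂ}

theorem hasFiniteRange_of_cells (hS : SchurBound μ s S) (hp1 : 1 < p) (hp : p < ∞)
    {M : Set Plane} (hM : MeasurableSet M) (hMb : Bornology.IsBounded M) {L : ℝ} (hL : 0 < L)
    {g : Plane → Plane → ℂ} {c : ℝ}
    (hK : IsKer s (fun x y => chi M x * g (cellPt L (cellIdx L x)) y) c) :
    (kerOp μ p fun x y => chi M x * g (cellPt L (cellIdx L x)) y).toLinearMap.HasFiniteRange := by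
  obtain ⟨ρ, hρ⟩ := hMb.subset_closedBall 0
  have hfin := finite_cells_of_norm_le hL ρ
  have hm : ∀ i, MeasurableSet (M ∩ cell L i) := fun i => hM.inter (measurableSet_cell L i)
  have hμ : ∀ i, μ (M ∩ cell L i) ≠ ∞ := fun i =>
    ((measure_mono Set.inter_subset_left).trans_lt (hS.measure_lt_top hMb)).ne
  let e : (Fin 2 → ℤ) → Lp ℂ p μ := fun i => indicatorConstLp p (hm i) (hμ i) 1
  set J := hfin.toFinset with hJ
  have hle : (kerOp μ p fun x y => chi M x * g (cellPt L (cellIdx L x)) y).toLinearMap.range ≤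
      Submodule.span ℂ (e '' J) := by
    rintro _ ⟨u, rfl⟩
    have hu : kerOp μ p (fun x y => chi M x * g (cellPt L (cellIdx L x)) y) u =
        ∑ i ∈ J, (∫ y, g (cellPt L i) y * u y ∂μ) • e i := by
      refine Lp.ext ?_
      have h1 : ∀ᵐ x ∂μ, ∀ i ∈ J, ((∫ y, g (cellPt L i) y * u y ∂μ) • e i : Lp ℂ p μ) x =
          (∫ y, g (cellPt L i) y * u y ∂μ) * chi (M ∩ cell L i) x := by
        refine (Filter.eventually_all_finset J).2 fun i _ => ?_
        filter_upwards [Lp.coeFn_smul (∫ y, g (cellPt L i) y * u y ∂μ) (e i),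
          indicatorConstLp_coeFn (p := p) (hs := hm i) (hμs := hμ i) (c := (1 : ℂ))] with x h1 h2
        rw [h1, Pi.smul_apply, h2, smul_eq_mul]
        rfl
      filter_upwards [hK.kerOp_ae hS hp1 hp u, h1,
        Lp.coeFn_finsetSum J fun i => (∫ y, g (cellPt L i) y * u y ∂μ) • e i] with x h2 h3 h4
      rw [h2, h4, Finset.sum_apply, Finset.sum_congr rfl h3]
      by_cases hx : x ∈ M
      · rw [Finset.sum_eq_single (cellIdx L x)]
        · rw [chi_of_mem (M := M ∩ cell L (cellIdx L x)) ⟨hx, rfl⟩, chi_of_mem hx]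
          simp
        · intro i _ hi
          rw [chi_of_notMem fun h => hi h.2.symm, mul_zero]
        · intro h
          refine absurd ?_ h
          rw [hJ, Set.Finite.mem_toFinset]
          exact ⟨x, rfl, mem_closedBall_zero_iff.1 (hρ hx)⟩
      · rw [chi_of_notMem hx, Finset.sum_eq_zero]
        · simp
        · intro i _
          rw [chi_of_notMem fun h => hx h.1, mul_zero]
    change kerOp μ p (fun x y => chi M x * g (cellPt L (cellIdx L x)) y) u ∈ _
    rw [hu]
    exact Submodule.sum_mem _ fun i hi => Submodule.smul_mem _ _
      (Submodule.subset_span ⟨i, hi, rfl⟩)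
  have : FiniteDimensional ℂ (Submodule.span ℂ (e '' J)) :=
    FiniteDimensional.span_of_finite ℂ (J.finite_toSet.image e)
  have h2 := Submodule.finiteDimensional_of_le hle
  exact Submodule.fg_iff_finiteDimensional _ |>.2 h2

theorem isFinRankLimit_chi_mul_trunc (hS : SchurBound μ s S) (hp1 : 1 < p) (hp : p < ∞)
    (hk : Continuous k) (hb : ∀ z, ‖k z‖ ≤ C * wt s z) {R : ℝ} (hR : 0 ≤ R)
    {M : Set Plane} (hM : MeasurableSet M) (hMb : Bornology.IsBounded M) :
    IsFinRankLimit (mulOp μ p (chi M) * kerOp μ p fun x y => trunc R k (x - y)) := by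
  intro ε hε
  set κ := trunc R k with hκ
  have hC : 0 ≤ C := nonneg_of_mul_nonneg_left ((norm_nonneg _).trans (hb 0)) (wt_pos _ _)
  set D := (1 + (R + 2)) ^ s with hD
  have hD0 : 0 < D := by positivity
  have hS0 := hS.nonneg
  set η := ε / (2 * (D * S + 1)) with hη
  have hη0 : 0 < η := by positivity
  obtain ⟨d, hd, hdκ⟩ := Metric.uniformContinuous_iff.1 (uniformContinuous_trunc hk R) η hη0
  set L := min (d / 4) (1 / 2) with hL
  have hL0 : 0 < L := by positivity
  have hLd : 2 * L < d := by
    have := min_le_left (d / 4) (1 / 2 : ℝ)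
    linarith
  have hL1 : 2 * L ≤ 1 := by
    have := min_le_right (d / 4) (1 / 2 : ℝ)
    linarith
  have hcell : ∀ x y : Plane, ‖(x - y) - (cellPt L (cellIdx L x) - y)‖ ≤ 2 * L := fun x y => by
    rw [sub_sub_sub_cancel_right]
    exact norm_sub_cellPt_le hL0 x
  have hfar : ∀ x y : Plane, R + 2 < ‖x - y‖ → κ (cellPt L (cellIdx L x) - y) = 0 := by
    intro x y h
    refine trunc_eq_zero ?_
    have h2 := norm_sub_norm_le (x - y) (cellPt L (cellIdx L x) - y)
    linarith [hcell x y]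
  have hcm : Measurable fun x : Plane => cellPt L (cellIdx L x) := by
    have : Measurable (cellPt L) := measurable_of_countable _
    exact this.comp (measurable_cellIdx L)
  have hmeas : Measurable fun q : Plane × Plane => κ (cellPt L (cellIdx L q.1) - q.2) :=
    (continuous_trunc hk R).measurable.comp ((hcm.comp measurable_fst).sub measurable_snd)
  have hw1 : ∀ z, ‖κ z‖ ≤ C := fun z => (norm_trunc_le k R z).trans ((hb z).trans
    (mul_le_of_le_one_right hC (wt_le_one hS.s_nonneg z)))
  have hχ := bddMeas_chi hM
  have hK₀ : IsKer s (fun x y => κ (cellPt L (cellIdx L x) - y)) (C * D) :=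
    isKer_of_bounded_range hS.s_nonneg hC (by linarith) hmeas (fun x y => hw1 _) hfar
  have hK₁ := hK₀.mul_left hχ
  have hT := isKer_trunc hk hb R
  refine ⟨_, hasFiniteRange_of_cells (g := fun z y => κ (z - y)) hS hp1 hp hM hMb hL0 hK₁, ?_⟩
  rw [mulOp_mul_kerOp hχ hT hS hp1 hp, kerOp_sub (hT.mul_left hχ) hK₁ hS hp1 hp]
  have hdiff : IsKer s (fun x y => κ (x - y) - κ (cellPt L (cellIdx L x) - y)) (η * D) := by
    refine isKer_of_bounded_range hS.s_nonneg hη0.le (by linarith)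
      (hT.meas.sub hmeas) (fun x y => ?_) fun x y h => ?_
    · rw [← dist_eq_norm]
      refine (hdκ ?_).le
      rw [dist_eq_norm]
      exact (hcell x y).trans_lt hLd
    · rw [hfar x y h, sub_zero]
      exact trunc_eq_zero (by linarith)
  have h := (hdiff.mul_left hχ).norm_kerOp_le (p := p) hS hp1 hp
  simp only [mul_sub] at h
  refine h.trans_lt ?_
  rw [one_mul, mul_assoc, hη, div_mul_eq_mul_div, div_lt_iff₀ (by positivity)]
  have : 0 ≤ D * S := by positivity
  nlinarith

theorem exists_trunc_norm_lt (hS : SchurBound μ s S) (hp1 : 1 < p) (hp : p < ∞)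
    (hk : Continuous k) (hδ : 0 < δ) (hC : 0 ≤ C) (hb : ∀ z, ‖k z‖ ≤ C * wt (s + δ) z)
    {ε : ℝ} (hε : 0 < ε) : ∃ R : ℝ, 0 ≤ R ∧
      ‖(kerOp μ p fun x y => k (x - y)) - kerOp μ p fun x y => trunc R k (x - y)‖ < ε := by
  have hb' : ∀ z, ‖k z‖ ≤ C * wt s z := fun z => (hb z).trans (mul_le_mul_of_nonneg_left
    (by rw [wt_add]; exact mul_le_of_le_one_right (wt_pos _ _).le (wt_le_one hδ.le z)) hC)
  have hlim : Tendsto (fun R : ℝ => C * (1 + R) ^ (-δ) * S) atTop (𝓝 0) := by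
    have h1 : Tendsto (fun R : ℝ => (1 + R) ^ (-δ)) atTop (𝓝 0) :=
      (tendsto_rpow_neg_atTop hδ).comp (tendsto_atTop_add_const_left _ 1 tendsto_id)
    simpa using (h1.const_mul C).mul_const S
  obtain ⟨R, hR, hR0⟩ := ((hlim.eventually (gt_mem_nhds hε)).and (eventually_ge_atTop 0)).exists
  refine ⟨R, hR0, lt_of_le_of_lt ?_ hR⟩
  rw [kerOp_sub (isKer_conv hk hb') (isKer_trunc hk hb' R) hS hp1 hp]
  exact (isKer_sub_trunc hk hC hδ.le hb hR0).norm_kerOp_le hS hp1 hp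

theorem trunc_mul_chi (hS : SchurBound μ s S) (hp1 : 1 < p) (hp : p < ∞)
    (hk : Continuous k) (hb : ∀ z, ‖k z‖ ≤ C * wt s z) {R r : ℝ}
    {M : Set Plane} (hM : MeasurableSet M) (hMb : M ⊆ Metric.closedBall 0 r) :
    (mulOp μ p (chi (Metric.closedBall 0 (r + R + 1))) * kerOp μ p fun x y => trunc R k (x - y)) *
      mulOp μ p (chi M) = (kerOp μ p fun x y => trunc R k (x - y)) * mulOp μ p (chi M) := by
  have hT := isKer_trunc hk hb R
  have hB := bddMeas_chi (Metric.isClosed_closedBall (x := (0 : Plane)) (ε := r + R + 1)).measurableSet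
  rw [mulOp_mul_kerOp hB hT hS hp1 hp, kerOp_mul_mulOp (bddMeas_chi hM) (hT.mul_left hB) hS hp1 hp,
    kerOp_mul_mulOp (bddMeas_chi hM) hT hS hp1 hp]
  congr 1
  funext x y
  by_cases hy : y ∈ M
  · by_cases hx : x ∈ Metric.closedBall (0 : Plane) (r + R + 1)
    · rw [chi_of_mem hx, one_mul]
    · rw [trunc_eq_zero, mul_zero]
      rw [mem_closedBall_zero_iff, not_le] at hx
      have h1 := mem_closedBall_zero_iff.1 (hMb hy)
      have h2 := norm_sub_norm_le x y
      linarith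
  · rw [chi_of_notMem hy, mul_zero, mul_zero]

theorem isFinRankLimit_chi_mul (hS : SchurBound μ s S) (hp1 : 1 < p) (hp : p < ∞)
    (hk : Continuous k) (hδ : 0 < δ) (hC : 0 ≤ C) (hb : ∀ z, ‖k z‖ ≤ C * wt (s + δ) z)
    {M : Set Plane} (hM : MeasurableSet M) (hMb : Bornology.IsBounded M) :
    IsFinRankLimit (mulOp μ p (chi M) * kerOp μ p fun x y => k (x - y)) := by
  have hb' : ∀ z, ‖k z‖ ≤ C * wt s z := fun z => (hb z).trans (mul_le_mul_of_nonneg_left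
    (by rw [wt_add]; exact mul_le_of_le_one_right (wt_pos _ _).le (wt_le_one hδ.le z)) hC)
  refine .of_forall_norm_sub_lt fun ε hε => ?_
  obtain ⟨R, hR, h⟩ := exists_trunc_norm_lt (p := p) hS hp1 hp hk hδ hC hb hε
  refine ⟨_, isFinRankLimit_chi_mul_trunc hS hp1 hp hk hb' hR hM hMb, ?_⟩
  rw [← mul_sub]
  refine (norm_mul_le _ _).trans_lt ?_
  exact (mul_le_of_le_one_left (norm_nonneg _) (bddMeas_chi hM).norm_mulOp_le).trans_lt h

theorem isFinRankLimit_mul_chi (hS : SchurBound μ s S) (hp1 : 1 < p) (hp : p < ∞)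
    (hk : Continuous k) (hδ : 0 < δ) (hC : 0 ≤ C) (hb : ∀ z, ‖k z‖ ≤ C * wt (s + δ) z)
    {M : Set Plane} (hM : MeasurableSet M) (hMb : Bornology.IsBounded M) :
    IsFinRankLimit ((kerOp μ p fun x y => k (x - y)) * mulOp μ p (chi M)) := by
  have hb' : ∀ z, ‖k z‖ ≤ C * wt s z := fun z => (hb z).trans (mul_le_mul_of_nonneg_left
    (by rw [wt_add]; exact mul_le_of_le_one_right (wt_pos _ _).le (wt_le_one hδ.le z)) hC)
  refine .of_forall_norm_sub_lt fun ε hε => ?_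
  obtain ⟨R, hR, h⟩ := exists_trunc_norm_lt (p := p) hS hp1 hp hk hδ hC hb hε
  obtain ⟨r, hr⟩ := hMb.subset_closedBall 0
  refine ⟨(kerOp μ p fun x y => trunc R k (x - y)) * mulOp μ p (chi M), ?_, ?_⟩
  · rw [← trunc_mul_chi hS hp1 hp hk hb' hM hr]
    exact (isFinRankLimit_chi_mul_trunc hS hp1 hp hk hb' hR Metric.isClosed_closedBall.measurableSet
      Metric.isBounded_closedBall).mul_right _
  · rw [← sub_mul]
    refine (norm_mul_le _ _).trans_lt ?_
    exact (mul_le_of_le_one_right (norm_nonneg _) (bddMeas_chi hM).norm_mulOp_le).trans_lt h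

end FiniteRank

/-! ### Fredholm operators and operators of finite rank -/

section Fredholm

variable {E : Type*} [NormedAddCommGroup E] [NormedSpace ℂ E]

open scoped LinearMap.FiniteRangeSetoid in
theorem isFredholm_of_left_right {A P Q F₁ F₂ : E →L[ℂ] E} (hP : A * P = 1 + F₁)
    (hQ : Q * A = 1 + F₂) (h₁ : F₁.toLinearMap.HasFiniteRange)
    (h₂ : F₂.toLinearMap.HasFiniteRange) : A.IsFredholm := by
  have hPQ : P = Q + (Q * F₁ - F₂ * P) := by
    have h : Q * (A * P) = (Q * A) * P := (mul_assoc _ _ _).symm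
    rw [hP, hQ, mul_add, add_mul, mul_one, one_mul] at h
    rw [← add_sub_assoc, h]
    abel
  have hF : (Q * F₁ - F₂ * P).toLinearMap.HasFiniteRange :=
    (h₁.comp_left Q.toLinearMap).sub (h₂.comp_right P.toLinearMap)
  have hPA : P * A - 1 = F₂ + (Q * F₁ - F₂ * P) * A := by
    nth_rewrite 1 [hPQ]
    rw [add_mul, hQ]
    abel
  refine ContinuousLinearMap.IsFredholm.of_isQuasiInverse (v := P) ⟨?_, ?_⟩
  · refine LinearMap.FiniteRangeSetoid.equiv_iff_hasFiniteRange.2 ?_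
    have : (P.toLinearMap ∘ₗ A.toLinearMap - LinearMap.id) = (P * A - 1).toLinearMap := rfl
    rw [this, hPA]
    exact h₂.add (hF.comp_right A.toLinearMap)
  · refine LinearMap.FiniteRangeSetoid.equiv_iff_hasFiniteRange.2 ?_
    have : (A.toLinearMap ∘ₗ P.toLinearMap - LinearMap.id) = (A * P - 1).toLinearMap := rfl
    rw [this, hP, add_sub_cancel_left]
    exact h₁

open scoped LinearMap.FiniteRangeSetoid in
theorem exists_left_right_of_isFredholm {A : E →L[ℂ] E} (hA : A.IsFredholm) :
    ∃ B F₁ F₂ : E →L[ℂ] E, A * B = 1 + F₁ ∧ B * A = 1 + F₂ ∧ F₁.toLinearMap.HasFiniteRange ∧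
      F₂.toLinearMap.HasFiniteRange := by
  obtain ⟨B, h1, h2⟩ := hA.exists_isQuasiInverse
  refine ⟨B, A * B - 1, B * A - 1, by abel, by abel, ?_, ?_⟩
  · exact LinearMap.FiniteRangeSetoid.equiv_iff_hasFiniteRange.1 h2
  · exact LinearMap.FiniteRangeSetoid.equiv_iff_hasFiniteRange.1 h1

theorem isFredholm_of_near [CompleteSpace E] {A P Q T₁ T₂ E₁ E₂ : E →L[ℂ] E}
    (hP : A * P = 1 + E₁ + T₁) (hQ : Q * A = 1 + E₂ + T₂)
    (hE₁ : ‖E₁‖ ≤ 1 / 2) (hE₂ : ‖E₂‖ ≤ 1 / 2)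
    (h₁ : IsFinRankLimit T₁) (h₂ : IsFinRankLimit T₂) : A.IsFredholm := by
  obtain ⟨F₁, hF₁, hn₁⟩ := h₁ (1 / 2) (by norm_num)
  obtain ⟨F₂, hF₂, hn₂⟩ := h₂ (1 / 2) (by norm_num)
  have key : ∀ X Y F : E →L[ℂ] E, ‖X‖ ≤ 1 / 2 → ‖Y - F‖ < 1 / 2 →
      ∃ U : (E →L[ℂ] E)ˣ, (U : E →L[ℂ] E) = 1 + X + (Y - F) := by
    intro X Y F h1 h2
    have hlt : ‖-(X + (Y - F))‖ < 1 := by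
      rw [norm_neg]
      exact (norm_add_le _ _).trans_lt (by linarith)
    refine ⟨Units.oneSub _ hlt, ?_⟩
    rw [Units.val_oneSub]
    abel
  obtain ⟨U, hU⟩ := key E₁ T₁ F₁ hE₁ hn₁
  obtain ⟨V, hV⟩ := key E₂ T₂ F₂ hE₂ hn₂
  have hP' : A * (P * ↑U⁻¹) = 1 + F₁ * ↑U⁻¹ := by
    have : A * P = U + F₁ := by rw [hP, hU]; abel
    rw [← mul_assoc, this, add_mul, Units.mul_inv]
  have hQ' : (↑V⁻¹ * Q) * A = 1 + ↑V⁻¹ * F₂ := by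
    have : Q * A = V + F₂ := by rw [hQ, hV]; abel
    rw [mul_assoc, this, mul_add, Units.inv_mul]
  exact isFredholm_of_left_right hP' hQ' (hF₁.comp_right (↑U⁻¹ : E →L[ℂ] E).toLinearMap)
    (hF₂.comp_left (↑V⁻¹ : E →L[ℂ] E).toLinearMap)

theorem exists_eq_sum_smulRight {F : E →L[ℂ] E} (hF : F.toLinearMap.HasFiniteRange) :
    ∃ (n : ℕ) (f : Fin n → E →L[ℂ] ℂ) (y : Fin n → E), ∀ u, F u = ∑ j, f j u • y j := by
  have hfd : FiniteDimensional ℂ F.toLinearMap.range :=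
    (Submodule.fg_iff_finiteDimensional _).1 hF
  let F' : E →L[ℂ] F.toLinearMap.range :=
    F.codRestrict _ fun x => ⟨x, rfl⟩
  let b := Module.finBasis ℂ F.toLinearMap.range
  refine ⟨_, fun j => (LinearMap.toContinuousLinearMap (b.coord j)).comp F',
    fun j => (b j : E), fun u => ?_⟩
  have h2 : ((F' u : F.toLinearMap.range) : E) = F u := rfl
  rw [← h2]
  conv_lhs => rw [← b.sum_repr (F' u)]
  rw [Submodule.coe_sum]
  rfl

end Fredholm

/-! ### Weak convergence to zero -/

section Weak

variable {μ : Measure Plane} {p : ℝ≥0∞} [Fact (1 ≤ p)]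

theorem tendsto_dual_of_disjoint (hp1 : 1 < p) (hp : p < ∞) {s : ℕ → Set Plane}
    (hs : Pairwise fun i j => Disjoint (s i) (s j)) {u : ℕ → Lp ℂ p μ}
    (hu : ∀ m, ∀ᵐ x ∂μ, x ∉ s m → u m x = 0) (hu1 : ∀ m, ‖u m‖ ≤ 1) (φ : Lp ℂ p μ →L[ℂ] ℂ) :
    Tendsto (fun m => φ (u m)) atTop (𝓝 0) := by
  have hr := toReal_one_lt hp1 hp
  set r := p.toReal with hrdef
  have hr0 : 0 < r := by linarith
  rw [tendsto_zero_iff_norm_tendsto_zero]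
  by_contra hcon
  obtain ⟨ε, hε, hfr⟩ : ∃ ε > 0, ∃ᶠ m in atTop, ε ≤ ‖φ (u m)‖ := by
    by_contra h
    push Not at h
    refine hcon ((tendsto_order.2 ⟨fun a ha => Eventually.of_forall fun m =>
      ha.trans_le (norm_nonneg _), fun a ha => ?_⟩))
    filter_upwards [h a ha] with m hm using hm
  have hinf : {m | ε ≤ ‖φ (u m)‖}.Infinite := Nat.frequently_atTop_iff_infinite.1 hfr
  have hbound : ∀ n : ℕ, (n : ℝ) ^ (r - 1) ≤ (‖φ‖ / ε) ^ r := by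
    intro n
    obtain ⟨F, hF, hcard⟩ := hinf.exists_subset_card_eq n
    rcases Nat.eq_zero_or_pos n with h0 | h0
    · rw [h0, Nat.cast_zero, Real.zero_rpow (by linarith)]
      positivity
    have hn : (0 : ℝ) < n := by exact_mod_cast h0
    choose c hc1 hc2 using fun m : ℕ => RCLike.exists_norm_eq_mul_self (φ (u m))
    have hsum := norm_sum_rpow_le (N := s) (N₀ := 1) hp1 hp (fun x G hG => by
      refine Finset.card_le_one.2 fun i hi j hj => ?_
      by_contra hij
      exact Set.disjoint_left.1 (hs hij) (hG i hi) (hG j hj)) F (fun m => c m • u m) (fun m => by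
      filter_upwards [hu m, Lp.coeFn_smul (c m) (u m)] with x h1 h2 hx
      rw [h2, Pi.smul_apply, h1 hx, smul_zero])
    have h1 : ∑ m ∈ F, ‖c m • u m‖ ^ r ≤ n := by
      rw [← hcard]
      refine (Finset.sum_le_card_nsmul F _ 1 fun m _ => ?_).trans_eq (by simp)
      rw [norm_smul, hc1, one_mul]
      exact Real.rpow_le_one (norm_nonneg _) (hu1 m) hr0.le
    have h2 : (n : ℝ) * ε ≤ ‖φ‖ * ‖∑ m ∈ F, c m • u m‖ := by
      have h3 : φ (∑ m ∈ F, c m • u m) = ((∑ m ∈ F, ‖φ (u m)‖ : ℝ) : ℂ) := by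
        rw [map_sum, Complex.ofReal_sum]
        refine Finset.sum_congr rfl fun m _ => ?_
        rw [map_smul, smul_eq_mul]
        exact (hc2 m).symm
      refine le_trans ?_ (φ.le_opNorm _)
      rw [h3, Complex.norm_real, Real.norm_of_nonneg (Finset.sum_nonneg fun _ _ => norm_nonneg _),
        ← hcard, ← nsmul_eq_mul]
      exact Finset.card_nsmul_le_sum _ _ _ fun m hm => hF hm
    have h4 : ((n : ℝ) * ε) ^ r ≤ ‖φ‖ ^ r * n := by
      refine (Real.rpow_le_rpow (by positivity) h2 hr0.le).trans ?_
      rw [Real.mul_rpow (norm_nonneg _) (norm_nonneg _)]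
      refine mul_le_mul_of_nonneg_left (hsum.trans ?_) (by positivity)
      simpa using h1
    rw [Real.div_rpow (norm_nonneg _) hε.le, le_div_iff₀ (by positivity),
      Real.rpow_sub_one hn.ne', div_mul_eq_mul_div, div_le_iff₀ hn, ← Real.mul_rpow hn.le hε.le]
    exact h4
  have hlim : Tendsto (fun n : ℕ => (n : ℝ) ^ (r - 1)) atTop atTop :=
    (tendsto_rpow_atTop (by linarith)).comp tendsto_natCast_atTop_atTop
  obtain ⟨n, hn⟩ := (hlim.eventually (eventually_gt_atTop ((‖φ‖ / ε) ^ r))).exists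
  exact absurd (hbound n) (not_le.2 hn)

/-- The operator of restriction to the closed ball of radius `n` around the origin. -/
noncomputable def ballOp (μ : Measure Plane) (p : ℝ≥0∞) [Fact (1 ≤ p)] (n : ℝ) :
    Lp ℂ p μ →L[ℂ] Lp ℂ p μ := mulOp μ p (chi (Metric.closedBall 0 n))

theorem ballOp_ae (n : ℝ) (u : Lp ℂ p μ) :
    ballOp μ p n u =ᵐ[μ] fun x => chi (Metric.closedBall 0 n) x * u x :=
  (bddMeas_chi Metric.isClosed_closedBall.measurableSet).mulOp_ae u

theorem norm_ballOp_le (n : ℝ) : ‖ballOp μ p n‖ ≤ 1 :=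
  (bddMeas_chi Metric.isClosed_closedBall.measurableSet).norm_mulOp_le

theorem tendsto_ballOp (hp1 : 1 < p) (hp : p < ∞) (u : Lp ℂ p μ) :
    Tendsto (fun n : ℕ => ballOp μ p n u) atTop (𝓝 u) := by
  have hr := toReal_one_lt hp1 hp
  have hr0 : 0 < p.toReal := by linarith
  have hm : Measurable (u : Plane → ℂ) := (Lp.stronglyMeasurable _).measurable
  rw [tendsto_iff_norm_sub_tendsto_zero]
  have hlim : Tendsto (fun n : ℕ => ∫⁻ x, (Metric.closedBall (0 : Plane) n)ᶜ.indicator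
      (fun x => ‖u x‖ₑ ^ p.toReal) x ∂μ) atTop (𝓝 (∫⁻ _, 0 ∂μ)) := by
    refine tendsto_lintegral_of_dominated_convergence (fun x => ‖u x‖ₑ ^ p.toReal) ?_ ?_ ?_ ?_
    · intro n
      exact (by fun_prop : Measurable fun x => ‖u x‖ₑ ^ p.toReal).indicator
        Metric.isClosed_closedBall.measurableSet.compl
    · exact fun n => Eventually.of_forall fun x => Set.indicator_le_self _ _ x
    · rw [← ofReal_norm_rpow hp1 hp]
      exact ENNReal.ofReal_ne_top
    · refine Eventually.of_forall fun x => tendsto_const_nhds.congr' ?_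
      obtain ⟨n, hn⟩ := exists_nat_ge ‖x‖
      filter_upwards [eventually_ge_atTop n] with m hm
      rw [Set.indicator_of_notMem]
      simp only [Set.mem_compl_iff, mem_closedBall_zero_iff, not_not]
      exact hn.trans (by exact_mod_cast hm)
  have heq : ∀ n : ℕ, ∫⁻ x, (Metric.closedBall (0 : Plane) n)ᶜ.indicator
      (fun x => ‖u x‖ₑ ^ p.toReal) x ∂μ = ENNReal.ofReal (‖ballOp μ p n u - u‖ ^ p.toReal) := by
    intro n
    rw [ofReal_norm_rpow hp1 hp]
    refine lintegral_congr_ae ?_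
    filter_upwards [ballOp_ae n u, Lp.coeFn_sub (ballOp μ p n u) u] with x h1 h2
    rw [h2, Pi.sub_apply, h1]
    by_cases hx : x ∈ Metric.closedBall (0 : Plane) n
    · rw [chi_of_mem hx, Set.indicator_of_notMem (by simpa using hx)]
      simp [hr0]
    · rw [chi_of_notMem hx, Set.indicator_of_mem (by simpa using hx)]
      simp
  simp only [heq, lintegral_zero] at hlim
  have h3 := (ENNReal.tendsto_toReal ENNReal.zero_ne_top).comp hlim
  simp only [ENNReal.toReal_zero] at h3
  have h4 := h3.rpow_const (p := 1 / p.toReal) (Or.inr (by positivity))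
  rw [Real.zero_rpow (by positivity)] at h4
  refine h4.congr fun n => ?_
  simp only [Function.comp_apply]
  rw [ENNReal.toReal_ofReal (by positivity), ← Real.rpow_mul (norm_nonneg _),
    mul_one_div_cancel hr0.ne', Real.rpow_one]

theorem ballOp_mul_ballOp {m n : ℝ} (h : m ≤ n) : ballOp μ p m * ballOp μ p n = ballOp μ p m := by
  rw [ballOp, ballOp, mulOp_mul_mulOp (bddMeas_chi Metric.isClosed_closedBall.measurableSet)
    (bddMeas_chi Metric.isClosed_closedBall.measurableSet)]
  congr 1
  funext x
  by_cases hx : x ∈ Metric.closedBall (0 : Plane) m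
  · rw [chi_of_mem (Metric.closedBall_subset_closedBall h hx), mul_one]
  · rw [chi_of_notMem hx, zero_mul]

theorem tendsto_norm_dual_comp_ballOp (hp1 : 1 < p) (hp : p < ∞) (φ : Lp ℂ p μ →L[ℂ] ℂ) :
    Tendsto (fun n : ℕ => ‖φ.comp (1 - ballOp μ p n)‖) atTop (𝓝 0) := by
  by_contra hcon
  have hanti : ∀ m n : ℕ, m ≤ n →
      ‖φ.comp (1 - ballOp μ p n)‖ ≤ ‖φ.comp (1 - ballOp μ p m)‖ * 2 := by
    intro m n hmn
    have h1 : φ.comp (1 - ballOp μ p n) = (φ.comp (1 - ballOp μ p m)).comp (1 - ballOp μ p n) := by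
      have h2 : (1 - ballOp μ p m) * (1 - ballOp μ p n) = 1 - ballOp μ p n := by
        rw [sub_mul, one_mul, mul_sub, mul_one, ballOp_mul_ballOp (by exact_mod_cast hmn)]
        abel
      rw [ContinuousLinearMap.comp_assoc]
      exact congrArg φ.comp h2.symm
    rw [h1]
    refine (ContinuousLinearMap.opNorm_comp_le _ _).trans
      (mul_le_mul_of_nonneg_left ?_ (norm_nonneg _))
    have h3 : ‖(1 : Lp ℂ p μ →L[ℂ] Lp ℂ p μ)‖ ≤ 1 := ContinuousLinearMap.norm_id_le
    exact (norm_sub_le _ _).trans (by linarith [norm_ballOp_le (μ := μ) (p := p) n])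
  obtain ⟨ε, hε, hge⟩ : ∃ ε > 0, ∀ n : ℕ, ε < ‖φ.comp (1 - ballOp μ p n)‖ := by
    by_contra h
    push Not at h
    refine hcon (tendsto_order.2 ⟨fun a ha => Eventually.of_forall fun m =>
      ha.trans_le (norm_nonneg _), fun a ha => ?_⟩)
    obtain ⟨n, hn⟩ := h (a / 4) (by positivity)
    filter_upwards [eventually_ge_atTop n] with m hm
    linarith [hanti n m hm]
  have hstep : ∀ n : ℕ, ∃ m : ℕ, n < m ∧ ∃ v : Lp ℂ p μ, ‖v‖ ≤ 1 ∧
      ε < ‖φ ((ballOp μ p m - ballOp μ p n) v)‖ := by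
    intro n
    obtain ⟨v, hv1, hv⟩ := ContinuousLinearMap.exists_lt_apply_of_lt_opNorm _ (hge n)
    have hlim : Tendsto (fun m : ℕ => ‖φ ((ballOp μ p m - ballOp μ p n) v)‖) atTop
        (𝓝 ‖(φ.comp (1 - ballOp μ p n)) v‖) := by
      refine ((φ.continuous.tendsto _).comp ?_).norm
      exact (tendsto_ballOp hp1 hp v).sub_const _
    obtain ⟨m, hm, hm2⟩ := ((hlim.eventually (lt_mem_nhds hv)).and (eventually_gt_atTop n)).exists
    exact ⟨m, hm2, v, hv1.le, hm⟩
  choose f hf v hv1 hv using hstep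
  let t : ℕ → ℕ := fun j => f^[j] 0
  have ht : ∀ j, t (j + 1) = f (t j) := fun j => Function.iterate_succ_apply' f j 0
  have htm : StrictMono t := strictMono_nat_of_lt_succ fun j => by rw [ht]; exact hf _
  let s : ℕ → Set Plane := fun j =>
    Metric.closedBall 0 (t (j + 1)) \ Metric.closedBall 0 (t j)
  have hs : Pairwise fun i j => Disjoint (s i) (s j) := by
    have key : ∀ i j, i < j → Disjoint (s i) (s j) := by
      intro i j hij
      refine Set.disjoint_left.2 fun x hx hx2 => hx2.2 ?_
      exact Metric.closedBall_subset_closedBall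
        (by exact_mod_cast htm.monotone (Nat.succ_le_of_lt hij)) hx.1
    intro i j hij
    rcases lt_or_gt_of_ne hij with h | h
    · exact key i j h
    · exact (key j i h).symm
  have hae : ∀ j, (ballOp μ p (t (j + 1)) - ballOp μ p (t j)) (v (t j)) =ᵐ[μ]
      fun x => chi (s j) x * v (t j) x := by
    intro j
    filter_upwards [ballOp_ae (t (j + 1)) (v (t j)), ballOp_ae (t j) (v (t j)),
      Lp.coeFn_sub (ballOp μ p (t (j + 1)) (v (t j))) (ballOp μ p (t j) (v (t j)))] with x h1 h2 h3
    rw [sub_apply, h3, Pi.sub_apply, h1, h2, ← sub_mul]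
    congr 1
    have hsub : Metric.closedBall (0 : Plane) (t j) ⊆ Metric.closedBall 0 (t (j + 1)) :=
      Metric.closedBall_subset_closedBall (by exact_mod_cast (htm (Nat.lt_succ_self j)).le)
    by_cases hx : x ∈ Metric.closedBall (0 : Plane) (t j)
    · rw [chi_of_mem hx, chi_of_mem (hsub hx), chi_of_notMem fun h => h.2 hx, sub_self]
    · rw [chi_of_notMem hx, sub_zero]
      by_cases hx2 : x ∈ Metric.closedBall (0 : Plane) (t (j + 1))
      · rw [chi_of_mem hx2, chi_of_mem (M := s j) ⟨hx2, hx⟩]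
      · rw [chi_of_notMem hx2, chi_of_notMem fun h => hx2 h.1]
  have hsm : ∀ j, MeasurableSet (s j) := fun j =>
    Metric.isClosed_closedBall.measurableSet.diff Metric.isClosed_closedBall.measurableSet
  have hlim := tendsto_dual_of_disjoint hp1 hp hs
    (u := fun j => (ballOp μ p (t (j + 1)) - ballOp μ p (t j)) (v (t j)))
    (fun j => by
      filter_upwards [hae j] with x hx hxs
      rw [hx, chi_of_notMem hxs, zero_mul])
    (fun j => by
      have h1 : (ballOp μ p (t (j + 1)) - ballOp μ p (t j)) (v (t j)) =
          mulOp μ p (chi (s j)) (v (t j)) :=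
        Lp.ext ((hae j).trans ((bddMeas_chi (hsm j)).mulOp_ae _).symm)
      rw [h1]
      refine ((mulOp μ p (chi (s j))).le_of_opNorm_le (bddMeas_chi (hsm j)).norm_mulOp_le _).trans ?_
      rw [one_mul]
      exact hv1 _) φ
  rw [tendsto_zero_iff_norm_tendsto_zero] at hlim
  obtain ⟨j, hj⟩ := (hlim.eventually (gt_mem_nhds hε)).exists
  have h2 := hv (t j)
  rw [← ht j] at h2
  linarith

end Weak

/-! ### A parametrix at infinity from locally frozen operators -/

section Parametrix

variable {μ : Measure Plane} {p : ℝ≥0∞} [Fact (1 ≤ p)]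

/-- The indices of the cells of side `L` whose corner has norm at least `ρ`. -/
def farCells (L ρ : ℝ) : Set (Fin 2 → ℤ) := {i | ρ ≤ ‖cellPt L i‖}

/-- The union of the cells with index in `farCells L ρ`. -/
def farSet (L ρ : ℝ) : Set Plane := {x | cellIdx L x ∈ farCells L ρ}

theorem measurableSet_farSet (L ρ : ℝ) : MeasurableSet (farSet L ρ) :=
  measurable_cellIdx L (Set.to_countable _).measurableSet

theorem isBounded_compl_farSet {L : ℝ} (hL : 0 < L) (ρ : ℝ) :
    Bornology.IsBounded (farSet L ρ)ᶜ := by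
  refine (Metric.isBounded_closedBall (x := (0 : Plane)) (r := ρ + 2 * L)).subset fun x hx => ?_
  have hx' : ‖cellPt L (cellIdx L x)‖ < ρ := not_le.1 hx
  rw [mem_closedBall_zero_iff]
  have h := norm_sub_norm_le x (cellPt L (cellIdx L x))
  linarith [norm_sub_cellPt_le hL x]

theorem farCells_overlap {L : ℝ} (hL : 0 < L) (ρ : ℝ) (x : Plane)
    (F : Finset (farCells L ρ)) (hF : ∀ i ∈ F, x ∈ Metric.closedBall (cellPt L i) (4 * L)) :
    F.card ≤ 100 := by
  rw [← Finset.card_map (Function.Embedding.subtype _)]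
  refine card_le_of_norm_sub_cellPt_le hL x _ fun i hi => ?_
  obtain ⟨j, hj, rfl⟩ := Finset.mem_map.1 hi
  rw [← dist_eq_norm]
  exact hF j hj

theorem chi_cell_mul {L : ℝ} (i j : Fin 2 → ℤ) :
    mulOp μ p (chi (cell L i)) * mulOp μ p (chi (cell L j)) =
      if i = j then mulOp μ p (chi (cell L i)) else 0 := by
  rw [mulOp_mul_mulOp (bddMeas_chi (measurableSet_cell L i)) (bddMeas_chi (measurableSet_cell L j))]
  split_ifs with h
  · subst h
    congr 1
    funext x
    by_cases hx : x ∈ cell L i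
    · rw [chi_of_mem hx, one_mul]
    · rw [chi_of_notMem hx, zero_mul]
  · refine mulOp_eq fun u => ?_
    filter_upwards [Lp.coeFn_zero ℂ p μ] with x hx
    rw [zero_apply, hx]
    by_cases hxi : x ∈ cell L i
    · rw [chi_of_notMem fun hxj : x ∈ cell L j => h (Eq.trans (Eq.symm hxi) hxj)]
      simp
    · rw [chi_of_notMem hxi]
      simp

theorem chi_mul_chi_of_subset {M N : Set Plane} (hM : MeasurableSet M) (hN : MeasurableSet N)
    (h : M ⊆ N) : mulOp μ p (chi M) * mulOp μ p (chi N) = mulOp μ p (chi M) ∧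
      mulOp μ p (chi N) * mulOp μ p (chi M) = mulOp μ p (chi M) := by
  rw [mulOp_mul_mulOp (bddMeas_chi hM) (bddMeas_chi hN),
    mulOp_mul_mulOp (bddMeas_chi hN) (bddMeas_chi hM)]
  constructor
  all_goals
    congr 1
    funext x
    by_cases hx : x ∈ M
    · rw [chi_of_mem hx, chi_of_mem (h hx), one_mul]
    · rw [chi_of_notMem hx]
      simp

theorem cell_subset_closedBall {L : ℝ} (hL : 0 < L) (i : Fin 2 → ℤ) :
    cell L i ⊆ Metric.closedBall (cellPt L i) (4 * L) := fun x hx => by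
  rw [mem_closedBall_iff_norm]
  linarith [norm_sub_cellPt_le_of_mem hL hx]

theorem hasSum_chi_cells (hp1 : 1 < p) (hp : p < ∞) {L : ℝ} (hL : 0 < L) (ρ : ℝ)
    (u : Lp ℂ p μ) : HasSum (fun i : farCells L ρ => mulOp μ p (chi (cell L i)) u)
      (mulOp μ p (chi (farSet L ρ)) u) := by
  obtain ⟨Y, hY, -⟩ := exists_blockSum (μ := μ) hp1 hp
    (N := fun i : farCells L ρ => Metric.closedBall (cellPt L i) (4 * L))
    (fun i => Metric.isClosed_closedBall.measurableSet) (farCells_overlap hL ρ)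
    (Z := fun i => mulOp μ p (chi (cell L i)))
    (fun i => (chi_mul_chi_of_subset (measurableSet_cell L i)
      Metric.isClosed_closedBall.measurableSet (cell_subset_closedBall hL i)).2)
    (fun i => (chi_mul_chi_of_subset (measurableSet_cell L i)
      Metric.isClosed_closedBall.measurableSet (cell_subset_closedBall hL i)).1)
    zero_le_one (fun i => (bddMeas_chi (measurableSet_cell L i)).norm_mulOp_le)
  suffices h : mulOp μ p (chi (farSet L ρ)) u = Y u by
    rw [h]
    exact hY u
  have hj : ∀ j, mulOp μ p (chi (cell L j)) (Y u) =
      open Classical in if j ∈ farCells L ρ then mulOp μ p (chi (cell L j)) u else 0 := by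
    intro j
    have h1 := (hY u).mapL (mulOp μ p (chi (cell L j)))
    have h2 : ∀ i : farCells L ρ, mulOp μ p (chi (cell L j)) (mulOp μ p (chi (cell L i)) u) =
        if j = i then mulOp μ p (chi (cell L j)) u else 0 := by
      intro i
      have := congrArg (fun T => T u) (chi_cell_mul (μ := μ) (p := p) (L := L) j i)
      simp only [mul_apply_eq_comp] at this
      rw [this]
      split_ifs <;> simp
    simp only [h2] at h1
    split_ifs with hjf
    · refine h1.unique ?_
      have h3 := hasSum_single (f := fun i : farCells L ρ =>
        if j = i then mulOp μ p (chi (cell L j)) u else 0) ⟨j, hjf⟩ (fun i hi => by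
          rw [if_neg]
          rintro rfl
          exact hi rfl)
      simpa using h3
    · refine h1.unique ?_
      convert! hasSum_zero with i
      rw [if_neg]
      rintro rfl
      exact hjf i.2
  refine Lp.ext ?_
  have hall : ∀ᵐ x ∂μ, ∀ j, chi (cell L j) x * Y u x =
      open Classical in if j ∈ farCells L ρ then chi (cell L j) x * u x else 0 := by
    rw [ae_all_iff]
    intro j
    have h1 := (bddMeas_chi (measurableSet_cell L j)).mulOp_ae (p := p) (μ := μ) (Y u)
    rw [hj j] at h1
    split_ifs at h1 ⊢ with hjf
    · filter_upwards [h1, (bddMeas_chi (measurableSet_cell L j)).mulOp_ae (p := p) (μ := μ) u]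
        with x h2 h3
      rw [← h2, h3]
    · filter_upwards [h1, Lp.coeFn_zero ℂ p μ] with x h2 h3
      rw [← h2, h3, Pi.zero_apply]
  filter_upwards [hall, (bddMeas_chi (measurableSet_farSet L ρ)).mulOp_ae (p := p) (μ := μ) u]
    with x h1 h2
  rw [h2]
  have h3 := h1 (cellIdx L x)
  rw [chi_of_mem (M := cell L (cellIdx L x)) rfl, one_mul, one_mul] at h3
  by_cases hx : cellIdx L x ∈ farCells L ρ
  · rw [if_pos hx] at h3
    rw [chi_of_mem (M := farSet L ρ) hx, one_mul, h3]
  · rw [if_neg hx] at h3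
    rw [chi_of_notMem (M := farSet L ρ) hx, zero_mul, h3]

/-- The operator `aI + bT` with the convolution kernel `k`. -/
noncomputable def abOp (μ : Measure Plane) (p : ℝ≥0∞) [Fact (1 ≤ p)] (a b k : Plane → ℂ) :
    Lp ℂ p μ →L[ℂ] Lp ℂ p μ :=
  mulOp μ p a + mulOp μ p b * kerOp μ p fun x y => k (x - y)

/-- The cut-off function around `c` at scale `L`. -/
noncomputable def bump (L : ℝ) (c : Plane) (x : Plane) : ℂ := (clip (3 - ‖x - c‖ / L) : ℝ)

theorem bddMeas_bump (L : ℝ) (c : Plane) : BddMeas (bump L c) 1 :=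
  ⟨Complex.measurable_ofReal.comp (continuous_clip.measurable.comp (by fun_prop)), fun x => by
    rw [bump, Complex.norm_real, Real.norm_of_nonneg (clip_nonneg _)]
    exact clip_le_one _⟩

theorem bump_eq_one {L : ℝ} (hL : 0 < L) {c x : Plane} (h : ‖x - c‖ ≤ 2 * L) :
    bump L c x = 1 := by
  rw [bump, clip_of_one_le, Complex.ofReal_one]
  have : ‖x - c‖ / L ≤ 2 := (div_le_iff₀ hL).2 h
  linarith

theorem bump_eq_zero {L : ℝ} (hL : 0 < L) {c x : Plane} (h : 3 * L ≤ ‖x - c‖) :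
    bump L c x = 0 := by
  rw [bump, clip_of_nonpos, Complex.ofReal_zero]
  have : 3 ≤ ‖x - c‖ / L := (le_div_iff₀ hL).2 h
  linarith

theorem norm_bump_sub_le {L : ℝ} (hL : 0 < L) (c x y : Plane) :
    ‖bump L c x - bump L c y‖ ≤ ‖x - y‖ / L := by
  rw [bump, bump, ← Complex.ofReal_sub, Complex.norm_real, Real.norm_eq_abs]
  refine (abs_clip_sub_le _ _).trans ?_
  have h1 : 3 - ‖x - c‖ / L - (3 - ‖y - c‖ / L) = (‖y - c‖ - ‖x - c‖) / L := by ring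
  rw [h1, abs_div, abs_of_pos hL]
  gcongr
  have h2 := abs_norm_sub_norm_le (y - c) (x - c)
  rwa [sub_sub_sub_cancel_right, norm_sub_rev y x] at h2

theorem norm_commutator_le {b b' κ ψx ψy : ℂ} {Cb η d : ℝ} (hb : ‖b‖ ≤ Cb)
    (hψ1 : ‖ψx‖ ≤ 1) (hψ : κ ≠ 0 → ‖ψy - ψx‖ ≤ d) (hη : 0 ≤ η)
    (hbb : κ ≠ 0 → ψx ≠ 0 → ‖b - b'‖ ≤ η) :
    ‖b * κ * ψy - ψx * (b' * κ)‖ ≤ (Cb * d + η) * ‖κ‖ := by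
  by_cases hκ : κ = 0
  · simp [hκ]
  have h1 : b * κ * ψy - ψx * (b' * κ) = (b * (ψy - ψx) + ψx * (b - b')) * κ := by ring
  rw [h1, norm_mul]
  refine mul_le_mul_of_nonneg_right ((norm_add_le _ _).trans (add_le_add ?_ ?_)) (norm_nonneg _)
  · rw [norm_mul]
    exact mul_le_mul hb (hψ hκ) (norm_nonneg _) ((norm_nonneg _).trans hb)
  · rw [norm_mul]
    by_cases hx : ψx = 0
    · simpa [hx] using hη
    · exact (mul_le_of_le_one_left (norm_nonneg _) hψ1).trans (hbb hκ hx)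

variable [SFinite μ] {s S δ C : ℝ} {k : Plane → ℂ}

theorem commutator_right (hS : SchurBound μ s S) (hp1 : 1 < p) (hp : p < ∞)
    (hk : Continuous k) (hb : ∀ z, ‖k z‖ ≤ C * wt s z) {a b a' b' : Plane → ℂ} {Ca Cb : ℝ}
    (ha : BddMeas a Ca) (hbm : BddMeas b Cb) (ha' : BddMeas a' Ca) (hbm' : BddMeas b' Cb)
    {R L η : ℝ} (hR : 0 ≤ R) (hL : R + 1 ≤ L) (hη : 0 ≤ η) {c : Plane}
    (hclose : ∀ x ∈ Metric.closedBall c (4 * L), ‖a x - a' x‖ ≤ η ∧ ‖b x - b' x‖ ≤ η) :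
    mulOp μ p (chi (Metric.closedBall c (4 * L))) *
      (abOp μ p a b (trunc R k) * mulOp μ p (bump L c) -
        mulOp μ p (bump L c) * abOp μ p a' b' (trunc R k)) =
      abOp μ p a b (trunc R k) * mulOp μ p (bump L c) -
        mulOp μ p (bump L c) * abOp μ p a' b' (trunc R k) ∧
    ‖abOp μ p a b (trunc R k) * mulOp μ p (bump L c) -
        mulOp μ p (bump L c) * abOp μ p a' b' (trunc R k)‖ ≤
      η + (Cb * ((R + 1) / L) + η) * C * S := by
  have hL0 : 0 < L := by linarith
  have hT := isKer_trunc hk hb R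
  have hψ := bddMeas_bump L c
  have hN : BddMeas (chi (Metric.closedBall c (4 * L))) 1 :=
    bddMeas_chi Metric.isClosed_closedBall.measurableSet
  set κ := trunc R k with hκ
  set ψ := bump L c with hψdef
  set G : Plane → Plane → ℂ := fun x y => b x * κ (x - y) * ψ y - ψ x * (b' x * κ (x - y)) with hG
  have hG0 : IsKer s G _ := ((hT.mul_left hbm).mul_right hψ).sub ((hT.mul_left hbm').mul_left hψ)
  have hfar : ∀ z, κ z ≠ 0 → ‖z‖ < R + 1 := fun z hz => by
    by_contra h
    exact hz (trunc_eq_zero (not_lt.1 h))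
  have hψx : ∀ x, ψ x ≠ 0 → ‖x - c‖ < 3 * L := fun x hx => by
    by_contra h
    exact hx (bump_eq_zero hL0 (not_lt.1 h))
  have hcb : 0 ≤ Cb * ((R + 1) / L) + η := by
    have := hbm.nonneg
    positivity
  have hGk : IsKer s G ((Cb * ((R + 1) / L) + η) * C) := by
    refine ⟨hG0.meas, fun x y => ?_⟩
    refine (norm_commutator_le (η := η) (d := (R + 1) / L) (hbm.bound x) (hψ.bound x) (fun h => ?_)
      hη fun _ h => ?_).trans ?_
    · rw [norm_sub_rev]
      refine (norm_bump_sub_le hL0 c x y).trans ?_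
      gcongr
      exact (hfar _ h).le
    · exact (hclose x (mem_closedBall_iff_norm.2 (by linarith [hψx x h]))).2
    · rw [mul_assoc _ C]
      exact mul_le_mul_of_nonneg_left (hT.bound x y) hcb
  have haa : BddMeas (fun x => (a x - a' x) * ψ x) η := by
    refine ⟨(ha.meas.sub ha'.meas).mul hψ.meas, fun x => ?_⟩
    by_cases hx : ψ x = 0
    · simpa [hx] using hη
    · rw [norm_mul]
      exact (mul_le_of_le_one_right (norm_nonneg _) (hψ.bound x)).trans
        (hclose x (mem_closedBall_iff_norm.2 (by linarith [hψx x hx]))).1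
  have hF : abOp μ p a b κ * mulOp μ p ψ - mulOp μ p ψ * abOp μ p a' b' κ =
      mulOp μ p (fun x => (a x - a' x) * ψ x) + kerOp μ p G := by
    rw [abOp, abOp, add_mul, mul_add, mulOp_mul_kerOp hbm hT hS hp1 hp,
      mulOp_mul_kerOp hbm' hT hS hp1 hp, kerOp_mul_mulOp hψ (hT.mul_left hbm) hS hp1 hp,
      mulOp_mul_kerOp hψ (hT.mul_left hbm') hS hp1 hp, mulOp_mul_mulOp ha hψ,
      mulOp_mul_mulOp hψ ha', add_sub_add_comm, mulOp_sub (ha.mul hψ) (hψ.mul ha'),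
      kerOp_sub ((hT.mul_left hbm).mul_right hψ) ((hT.mul_left hbm').mul_left hψ) hS hp1 hp]
    congr 2
    funext x
    ring
  rw [hF]
  constructor
  · rw [mul_add, mulOp_mul_mulOp hN haa, mulOp_mul_kerOp hN hGk hS hp1 hp]
    congr 2
    · funext x
      by_cases hx : x ∈ Metric.closedBall c (4 * L)
      · rw [chi_of_mem hx, one_mul]
      · rw [mem_closedBall_iff_norm, not_le] at hx
        rw [hψdef, bump_eq_zero hL0 (by linarith)]
        simp
    · funext x y
      by_cases hx : x ∈ Metric.closedBall c (4 * L)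
      · rw [chi_of_mem hx, one_mul]
      · rw [chi_of_notMem hx, zero_mul]
        rw [mem_closedBall_iff_norm, not_le] at hx
        have h1 : ψ x = 0 := bump_eq_zero hL0 (by linarith)
        by_cases hκ0 : κ (x - y) = 0
        · simp [hG, hκ0]
        · have h2 := hfar _ hκ0
          have h3 := norm_sub_norm_le (x - c) (x - y)
          rw [sub_sub_sub_cancel_left] at h3
          have h4 : ψ y = 0 := bump_eq_zero hL0 (by linarith)
          simp [hG, h1, h4]
  · exact (norm_add_le _ _).trans (add_le_add haa.norm_mulOp_le (hGk.norm_kerOp_le hS hp1 hp))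

theorem commutator_left (hS : SchurBound μ s S) (hp1 : 1 < p) (hp : p < ∞)
    (hk : Continuous k) (hb : ∀ z, ‖k z‖ ≤ C * wt s z) {a b a' b' : Plane → ℂ} {Ca Cb : ℝ}
    (ha : BddMeas a Ca) (hbm : BddMeas b Cb) (ha' : BddMeas a' Ca) (hbm' : BddMeas b' Cb)
    {R L η : ℝ} (hR : 0 ≤ R) (hL : R + 1 ≤ L) (hη : 0 ≤ η) {c : Plane}
    (hclose : ∀ x ∈ Metric.closedBall c (4 * L), ‖a x - a' x‖ ≤ η ∧ ‖b x - b' x‖ ≤ η) :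
    (mulOp μ p (bump L c) * abOp μ p a b (trunc R k) -
        abOp μ p a' b' (trunc R k) * mulOp μ p (bump L c)) *
      mulOp μ p (chi (Metric.closedBall c (4 * L))) =
      mulOp μ p (bump L c) * abOp μ p a b (trunc R k) -
        abOp μ p a' b' (trunc R k) * mulOp μ p (bump L c) ∧
    ‖mulOp μ p (bump L c) * abOp μ p a b (trunc R k) -
        abOp μ p a' b' (trunc R k) * mulOp μ p (bump L c)‖ ≤
      η + (Cb * ((R + 1) / L) + η) * C * S := by
  have hL0 : 0 < L := by linarith
  have hT := isKer_trunc hk hb R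
  have hψ := bddMeas_bump L c
  have hN : BddMeas (chi (Metric.closedBall c (4 * L))) 1 :=
    bddMeas_chi Metric.isClosed_closedBall.measurableSet
  set κ := trunc R k with hκ
  set ψ := bump L c with hψdef
  set G : Plane → Plane → ℂ := fun x y => ψ x * (b x * κ (x - y)) - b' x * κ (x - y) * ψ y with hG
  have hG0 : IsKer s G _ := ((hT.mul_left hbm).mul_left hψ).sub ((hT.mul_left hbm').mul_right hψ)
  have hfar : ∀ z, κ z ≠ 0 → ‖z‖ < R + 1 := fun z hz => by
    by_contra h
    exact hz (trunc_eq_zero (not_lt.1 h))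
  have hψx : ∀ x, ψ x ≠ 0 → ‖x - c‖ < 3 * L := fun x hx => by
    by_contra h
    exact hx (bump_eq_zero hL0 (not_lt.1 h))
  have hcb : 0 ≤ Cb * ((R + 1) / L) + η := by
    have := hbm.nonneg
    positivity
  have hGk : IsKer s G ((Cb * ((R + 1) / L) + η) * C) := by
    refine ⟨hG0.meas, fun x y => ?_⟩
    have h0 : G x y = b x * κ (x - y) * ψ x - ψ y * (b' x * κ (x - y)) := by
      simp only [hG]
      ring
    rw [h0]
    refine (norm_commutator_le (η := η) (d := (R + 1) / L) (hbm.bound x) (hψ.bound y) (fun h => ?_)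
      hη fun h1 h => ?_).trans ?_
    · refine (norm_bump_sub_le hL0 c x y).trans ?_
      gcongr
      exact (hfar _ h).le
    · refine (hclose x (mem_closedBall_iff_norm.2 ?_)).2
      have h2 := hfar _ h1
      have h3 : ‖x - c‖ ≤ ‖x - y‖ + ‖y - c‖ := norm_sub_le_norm_sub_add_norm_sub x y c
      linarith [hψx y h]
    · rw [mul_assoc _ C]
      exact mul_le_mul_of_nonneg_left (hT.bound x y) hcb
  have haa : BddMeas (fun x => (a x - a' x) * ψ x) η := by
    refine ⟨(ha.meas.sub ha'.meas).mul hψ.meas, fun x => ?_⟩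
    by_cases hx : ψ x = 0
    · simpa [hx] using hη
    · rw [norm_mul]
      exact (mul_le_of_le_one_right (norm_nonneg _) (hψ.bound x)).trans
        (hclose x (mem_closedBall_iff_norm.2 (by linarith [hψx x hx]))).1
  have hF : mulOp μ p ψ * abOp μ p a b κ - abOp μ p a' b' κ * mulOp μ p ψ =
      mulOp μ p (fun x => (a x - a' x) * ψ x) + kerOp μ p G := by
    rw [abOp, abOp, add_mul, mul_add, mulOp_mul_kerOp hbm hT hS hp1 hp,
      mulOp_mul_kerOp hbm' hT hS hp1 hp, kerOp_mul_mulOp hψ (hT.mul_left hbm') hS hp1 hp,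
      mulOp_mul_kerOp hψ (hT.mul_left hbm) hS hp1 hp, mulOp_mul_mulOp ha' hψ,
      mulOp_mul_mulOp hψ ha, add_sub_add_comm, mulOp_sub (hψ.mul ha) (ha'.mul hψ),
      kerOp_sub ((hT.mul_left hbm).mul_left hψ) ((hT.mul_left hbm').mul_right hψ) hS hp1 hp]
    congr 2
    funext x
    ring
  rw [hF]
  constructor
  · rw [add_mul, mulOp_mul_mulOp haa hN, kerOp_mul_mulOp hN hGk hS hp1 hp]
    congr 2
    · funext x
      by_cases hx : x ∈ Metric.closedBall c (4 * L)
      · rw [chi_of_mem hx, mul_one]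
      · rw [mem_closedBall_iff_norm, not_le] at hx
        rw [hψdef, bump_eq_zero hL0 (by linarith)]
        simp
    · funext x y
      by_cases hy : y ∈ Metric.closedBall c (4 * L)
      · rw [chi_of_mem hy, mul_one]
      · rw [chi_of_notMem hy, mul_zero]
        rw [mem_closedBall_iff_norm, not_le] at hy
        have h1 : ψ y = 0 := bump_eq_zero hL0 (by linarith)
        by_cases hκ0 : κ (x - y) = 0
        · simp [hG, hκ0]
        · have h2 := hfar _ hκ0
          have h3 : ‖y - c‖ ≤ ‖y - x‖ + ‖x - c‖ := norm_sub_le_norm_sub_add_norm_sub y x c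
          rw [norm_sub_rev y x] at h3
          have h4 : ψ x = 0 := bump_eq_zero hL0 (by linarith)
          simp [hG, h1, h4]
  · exact (norm_add_le _ _).trans (add_le_add haa.norm_mulOp_le (hGk.norm_kerOp_le hS hp1 hp))

end Parametrix

/-! ### Assembling the parametrix -/

section Blocks

variable {𝔸 : Type*} [NormedRing 𝔸]

/-- `Z` and `W` are supported, from both sides, where the idempotent `ν` is, with norms at most `z`
and `w`. -/
structure IsBlock (ν : 𝔸) (z w : ℝ) (Z W : 𝔸) : Prop where
  norm_left : ‖Z‖ ≤ z
  norm_right : ‖W‖ ≤ w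
  mul_left : ν * Z = Z
  mul_right : Z * ν = Z
  mul_left' : ν * W = W
  mul_right' : W * ν = W

theorem norm_mul_mul_le {f g h : 𝔸} {x y z : ℝ} (hf : ‖f‖ ≤ x) (hg : ‖g‖ ≤ y) (hh : ‖h‖ ≤ z) :
    ‖f * g * h‖ ≤ x * y * z :=
  (norm_mul_le _ _).trans (mul_le_mul ((norm_mul_le _ _).trans
    (mul_le_mul hf hg (norm_nonneg _) ((norm_nonneg _).trans hf))) hh (norm_nonneg _)
    (mul_nonneg ((norm_nonneg _).trans hf) ((norm_nonneg _).trans hg)))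

theorem exists_isBlock_right {ν ψ χ X X' A B : 𝔸} {D θ t : ℝ} (hνψ : ν * ψ = ψ)
    (hψχ : ψ * χ = χ) (hχν : χ * ν = χ) (hν : ν * (A * ψ - ψ * X') = A * ψ - ψ * X')
    (hXB : X * B = 1) (hψ : ‖ψ‖ ≤ 1) (hχ : ‖χ‖ ≤ 1) (hB : ‖B‖ ≤ D)
    (hF : ‖A * ψ - ψ * X'‖ ≤ θ) (hX : ‖X - X'‖ ≤ t) :
    ∃ Z W : 𝔸, IsBlock ν D (θ * D + t * D) Z W ∧ A * Z = χ + W := by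
  have hD := (norm_nonneg _).trans hB
  have ht := (norm_nonneg _).trans hX
  refine ⟨ψ * B * χ, (A * ψ - ψ * X') * B * χ - ψ * ((X - X') * B) * χ, ⟨?_, ?_, ?_, ?_, ?_, ?_⟩, ?_⟩
  · exact (norm_mul_mul_le hψ hB hχ).trans_eq (by ring)
  · refine (norm_sub_le _ _).trans (add_le_add ?_ ?_)
    · exact (norm_mul_mul_le hF hB hχ).trans_eq (by ring)
    · exact (norm_mul_mul_le hψ ((norm_mul_le _ _).trans (mul_le_mul hX hB (norm_nonneg _) ht))
        hχ).trans_eq (by ring)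
  · rw [← mul_assoc, ← mul_assoc, hνψ]
  · rw [mul_assoc, hχν]
  · rw [mul_sub, ← mul_assoc, ← mul_assoc, hν, ← mul_assoc, ← mul_assoc, hνψ]
  · rw [sub_mul, mul_assoc, hχν, mul_assoc _ _ ν, hχν]
  · rw [sub_mul X, hXB]
    nth_rewrite 2 [← hψχ]
    noncomm_ring

theorem exists_isBlock_left {ν ψ χ X X' A B : 𝔸} {D θ t : ℝ} (hψν : ψ * ν = ψ)
    (hχψ : χ * ψ = χ) (hνχ : ν * χ = χ) (hν : (ψ * A - X' * ψ) * ν = ψ * A - X' * ψ)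
    (hBX : B * X = 1) (hψ : ‖ψ‖ ≤ 1) (hχ : ‖χ‖ ≤ 1) (hB : ‖B‖ ≤ D)
    (hF : ‖ψ * A - X' * ψ‖ ≤ θ) (hX : ‖X - X'‖ ≤ t) :
    ∃ Z W : 𝔸, IsBlock ν D (θ * D + t * D) Z W ∧ Z * A = χ + W := by
  have hD := (norm_nonneg _).trans hB
  refine ⟨χ * B * ψ, χ * B * (ψ * A - X' * ψ) - χ * (B * (X - X')) * ψ, ⟨?_, ?_, ?_, ?_, ?_, ?_⟩, ?_⟩
  · exact (norm_mul_mul_le hχ hB hψ).trans_eq (by ring)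
  · refine (norm_sub_le _ _).trans (add_le_add ?_ ?_)
    · exact (norm_mul_mul_le hχ hB hF).trans_eq (by ring)
    · exact (norm_mul_mul_le hχ ((norm_mul_le _ _).trans (mul_le_mul hB hX (norm_nonneg _) hD))
        hψ).trans_eq (by ring)
  · rw [← mul_assoc, ← mul_assoc, hνχ]
  · rw [mul_assoc, hψν]
  · rw [mul_sub, ← mul_assoc, ← mul_assoc, hνχ, ← mul_assoc, ← mul_assoc, hνχ]
  · rw [sub_mul, mul_assoc, hν, mul_assoc _ _ ν, hψν]
  · rw [mul_sub B, hBX]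
    nth_rewrite 2 [← hχψ]
    noncomm_ring

end Blocks

section Assembly

variable {μ : Measure Plane} {p : ℝ≥0∞} [Fact (1 ≤ p)]

theorem exists_right_cellSum (hp1 : 1 < p) (hp : p < ∞) {L : ℝ} (hL : 0 < L) (ρ : ℝ)
    {A : Lp ℂ p μ →L[ℂ] Lp ℂ p μ} {Z W : farCells L ρ → Lp ℂ p μ →L[ℂ] Lp ℂ p μ} {z w : ℝ}
    (hz0 : 0 ≤ z) (hw0 : 0 ≤ w) (hz : ∀ i, ‖Z i‖ ≤ z) (hw : ∀ i, ‖W i‖ ≤ w)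
    (hZl : ∀ i : farCells L ρ, mulOp μ p (chi (Metric.closedBall (cellPt L i) (4 * L))) * Z i = Z i)
    (hZr : ∀ i, Z i * mulOp μ p (chi (Metric.closedBall (cellPt L i) (4 * L))) = Z i)
    (hWl : ∀ i : farCells L ρ, mulOp μ p (chi (Metric.closedBall (cellPt L i) (4 * L))) * W i = W i)
    (hWr : ∀ i, W i * mulOp μ p (chi (Metric.closedBall (cellPt L i) (4 * L))) = W i) :
    ∃ P E : Lp ℂ p μ →L[ℂ] Lp ℂ p μ, ‖P‖ ≤ 100 * z ∧ ‖E‖ ≤ 100 * w ∧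
      ((∀ i, A * Z i = mulOp μ p (chi (cell L i)) + W i) →
        A * P = mulOp μ p (chi (farSet L ρ)) + E) ∧
      ((∀ i, Z i * A = mulOp μ p (chi (cell L i)) + W i) →
        P * A = mulOp μ p (chi (farSet L ρ)) + E) := by
  obtain ⟨P, hP, hPn⟩ := exists_blockSum (μ := μ) hp1 hp
    (N := fun i : farCells L ρ => Metric.closedBall (cellPt L i) (4 * L))
    (fun i => Metric.isClosed_closedBall.measurableSet) (farCells_overlap hL ρ) hZl hZr hz0 hz
  obtain ⟨E, hE, hEn⟩ := exists_blockSum (μ := μ) hp1 hp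
    (N := fun i : farCells L ρ => Metric.closedBall (cellPt L i) (4 * L))
    (fun i => Metric.isClosed_closedBall.measurableSet) (farCells_overlap hL ρ) hWl hWr hw0 hw
  refine ⟨P, E, by simpa using hPn, by simpa using hEn, fun h => ?_, fun h => ?_⟩
  · refine ContinuousLinearMap.ext fun u => ?_
    refine ((hP u).mapL A).unique ?_
    refine ((hasSum_chi_cells hp1 hp hL ρ u).add (hE u)).congr_fun fun i => ?_
    have h1 := congrArg (fun T : Lp ℂ p μ →L[ℂ] Lp ℂ p μ => T u) (h i)
    simpa only [mul_apply_eq_comp, add_apply] using h1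
  · refine ContinuousLinearMap.ext fun u => ?_
    refine (hP (A u)).unique ?_
    refine ((hasSum_chi_cells hp1 hp hL ρ u).add (hE u)).congr_fun fun i => ?_
    have h1 := congrArg (fun T : Lp ℂ p μ →L[ℂ] Lp ℂ p μ => T u) (h i)
    simpa only [mul_apply_eq_comp, add_apply] using h1

variable [SFinite μ] {s S δ C : ℝ} {k : Plane → ℂ}

/-- Near infinity, `aI + bT` is close, on balls of arbitrary radius, to operators of the same form
with inverses of norm at most `D`. -/
def HasFrozenInverses (μ : Measure Plane) (p : ℝ≥0∞) [Fact (1 ≤ p)] (a b k : Plane → ℂ)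
    (Ca Cb D : ℝ) : Prop :=
  ∀ η > 0, ∀ r : ℝ, ∃ ρ : ℝ, ∀ z : Plane, ρ ≤ ‖z‖ → ∃ a' b' : Plane → ℂ,
    ∃ B : Lp ℂ p μ →L[ℂ] Lp ℂ p μ, BddMeas a' Ca ∧ BddMeas b' Cb ∧
      abOp μ p a' b' k * B = 1 ∧ B * abOp μ p a' b' k = 1 ∧ ‖B‖ ≤ D ∧
      ∀ x ∈ Metric.closedBall z r, ‖a x - a' x‖ ≤ η ∧ ‖b x - b' x‖ ≤ η

omit [SFinite μ] in
theorem norm_abOp_sub_le {a b : Plane → ℂ} {Cb : ℝ} (hb : BddMeas b Cb) (k k' : Plane → ℂ) :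
    ‖abOp μ p a b k - abOp μ p a b k'‖ ≤
      Cb * ‖(kerOp μ p fun x y => k (x - y)) - kerOp μ p fun x y => k' (x - y)‖ := by
  rw [abOp, abOp, add_sub_add_left_eq_sub, ← mul_sub]
  exact (norm_mul_le _ _).trans (mul_le_mul_of_nonneg_right hb.norm_mulOp_le (norm_nonneg _))

omit [SFinite μ] in
theorem bump_mul_chi_ball {L : ℝ} (hL : 0 < L) (c : Plane) :
    mulOp μ p (bump L c) * mulOp μ p (chi (Metric.closedBall c (4 * L))) =
      mulOp μ p (bump L c) ∧
    mulOp μ p (chi (Metric.closedBall c (4 * L))) * mulOp μ p (bump L c) =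
      mulOp μ p (bump L c) := by
  have hN : BddMeas (chi (Metric.closedBall c (4 * L))) 1 :=
    bddMeas_chi Metric.isClosed_closedBall.measurableSet
  rw [mulOp_mul_mulOp (bddMeas_bump L c) hN, mulOp_mul_mulOp hN (bddMeas_bump L c)]
  constructor
  all_goals
    congr 1
    funext x
    by_cases hx : x ∈ Metric.closedBall c (4 * L)
    · simp [chi_of_mem hx]
    · rw [mem_closedBall_iff_norm, not_le] at hx
      simp [bump_eq_zero hL (c := c) (x := x) (by linarith)]

omit [SFinite μ] in
theorem bump_mul_chi_cell {L : ℝ} (hL : 0 < L) (i : Fin 2 → ℤ) :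
    mulOp μ p (bump L (cellPt L i)) * mulOp μ p (chi (cell L i)) = mulOp μ p (chi (cell L i)) ∧
    mulOp μ p (chi (cell L i)) * mulOp μ p (bump L (cellPt L i)) = mulOp μ p (chi (cell L i)) := by
  have hN := bddMeas_chi (measurableSet_cell L i)
  rw [mulOp_mul_mulOp (bddMeas_bump L _) hN, mulOp_mul_mulOp hN (bddMeas_bump L _)]
  constructor
  all_goals
    congr 1
    funext x
    by_cases hx : x ∈ cell L i
    · simp [bump_eq_one hL (norm_sub_cellPt_le_of_mem hL hx)]
    · simp [chi_of_notMem hx]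

theorem exists_parametrix (hS : SchurBound μ s S) (hp1 : 1 < p) (hp : p < ∞)
    (hk : Continuous k) (hδ : 0 < δ) (hC : 0 ≤ C) (hb : ∀ z, ‖k z‖ ≤ C * wt (s + δ) z)
    {a b : Plane → ℂ} {Ca Cb D : ℝ} (ha : BddMeas a Ca) (hbm : BddMeas b Cb) (hD : 0 ≤ D)
    (hfr : HasFrozenInverses μ p a b k Ca Cb D) {ε : ℝ} (hε : 0 < ε) :
    ∃ L ρ : ℝ, 0 < L ∧ ∃ P Q E₁ E₂ : Lp ℂ p μ →L[ℂ] Lp ℂ p μ, ‖E₁‖ ≤ ε ∧ ‖E₂‖ ≤ ε ∧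
      abOp μ p a b k * P = mulOp μ p (chi (farSet L ρ)) + E₁ ∧
      Q * abOp μ p a b k = mulOp μ p (chi (farSet L ρ)) + E₂ := by
  have hb' : ∀ z, ‖k z‖ ≤ C * wt s z := fun z => (hb z).trans (mul_le_mul_of_nonneg_left
    (by rw [wt_add]; exact mul_le_of_le_one_right (wt_pos _ _).le (wt_le_one hδ.le z)) hC)
  have hCb := hbm.nonneg
  have hS0 := hS.nonneg
  set τ := ε / (400 * (Cb * D + 1)) with hτ
  have hτ0 : 0 < τ := by positivity
  have hτ1 : 200 * (Cb * τ * D) ≤ ε / 2 := by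
    have h : Cb * τ * D = (Cb * D) * τ := by ring
    rw [h, hτ, mul_div_assoc', mul_div_assoc', div_le_iff₀ (by positivity)]
    have : 0 ≤ Cb * D := by positivity
    nlinarith
  set θ := ε / (200 * (D + 1)) with hθ
  have hθ0 : 0 < θ := by positivity
  have hθ1 : 100 * (θ * D) ≤ ε / 2 := by
    rw [hθ, div_mul_eq_mul_div, mul_div_assoc', div_le_iff₀ (by positivity)]
    nlinarith
  obtain ⟨R, hR, hRτ⟩ := exists_trunc_norm_lt (p := p) hS hp1 hp hk hδ hC hb hτ0
  set L := R + 1 + 2 * (Cb * (R + 1) * C * S) / θ with hLdef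
  have hLR : R + 1 ≤ L := le_add_of_nonneg_right (by positivity)
  have hL : 0 < L := by linarith
  set η := θ / (2 * (1 + C * S)) with hη
  have hη0 : 0 < η := by positivity
  have hfb : η + (Cb * ((R + 1) / L) + η) * C * S ≤ θ := by
    have h1 : η * (1 + C * S) = θ / 2 := by
      rw [hη]; field_simp
    have h2 : Cb * ((R + 1) / L) * C * S ≤ θ / 2 := by
      have h3 : Cb * ((R + 1) / L) * C * S = (Cb * (R + 1) * C * S) / L := by ring
      rw [h3, div_le_iff₀ hL]
      have h4 : 2 * (Cb * (R + 1) * C * S) / θ ≤ L := le_add_of_nonneg_left (by positivity)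
      rw [div_le_iff₀ hθ0] at h4
      linarith
    nlinarith
  obtain ⟨ρ, hρ⟩ := hfr η hη0 (4 * L)
  choose! a' b' B ha' hbm' hB1 hB2 hBD hclose using hρ
  set A := abOp μ p a b k with hA
  set A' := abOp μ p a b (trunc R k) with hA'
  have hAA' : ‖A - A'‖ ≤ Cb * τ := (norm_abOp_sub_le hbm _ _).trans
    (mul_le_mul_of_nonneg_left hRτ.le hCb)
  have hblockR : ∀ i : farCells L ρ, ∃ Z W : Lp ℂ p μ →L[ℂ] Lp ℂ p μ,
      IsBlock (mulOp μ p (chi (Metric.closedBall (cellPt L i) (4 * L)))) D (θ * D + Cb * τ * D) Z W ∧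
        A' * Z = mulOp μ p (chi (cell L i)) + W := by
    intro i
    obtain ⟨h1, h2⟩ := commutator_right (p := p) hS hp1 hp hk hb' ha hbm (ha' _ i.2)
      (hbm' _ i.2) hR hLR hη0.le (hclose _ i.2)
    have hXX := (norm_abOp_sub_le (μ := μ) (p := p) (a := a' (cellPt L i)) (hbm' _ i.2) k
      (trunc R k)).trans (mul_le_mul_of_nonneg_left hRτ.le hCb)
    have hχ := chi_mul_chi_of_subset (μ := μ) (p := p) (measurableSet_cell L i)
      (Metric.isClosed_closedBall.measurableSet) (cell_subset_closedBall hL i)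
    exact exists_isBlock_right (bump_mul_chi_ball hL _).2 (bump_mul_chi_cell hL i).1 hχ.1
      h1 (hB1 _ i.2) (bddMeas_bump L _).norm_mulOp_le
      (bddMeas_chi (measurableSet_cell L i)).norm_mulOp_le (hBD _ i.2) (h2.trans hfb) hXX
  have hblockL : ∀ i : farCells L ρ, ∃ Z W : Lp ℂ p μ →L[ℂ] Lp ℂ p μ,
      IsBlock (mulOp μ p (chi (Metric.closedBall (cellPt L i) (4 * L)))) D (θ * D + Cb * τ * D) Z W ∧
        Z * A' = mulOp μ p (chi (cell L i)) + W := by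
    intro i
    obtain ⟨h1, h2⟩ := commutator_left (p := p) hS hp1 hp hk hb' ha hbm (ha' _ i.2)
      (hbm' _ i.2) hR hLR hη0.le (hclose _ i.2)
    have hXX := (norm_abOp_sub_le (μ := μ) (p := p) (a := a' (cellPt L i)) (hbm' _ i.2) k
      (trunc R k)).trans (mul_le_mul_of_nonneg_left hRτ.le hCb)
    have hχ := chi_mul_chi_of_subset (μ := μ) (p := p) (measurableSet_cell L i)
      (Metric.isClosed_closedBall.measurableSet) (cell_subset_closedBall hL i)
    exact exists_isBlock_left (bump_mul_chi_ball hL _).1 (bump_mul_chi_cell hL i).2 hχ.2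
      h1 (hB2 _ i.2) (bddMeas_bump L _).norm_mulOp_le
      (bddMeas_chi (measurableSet_cell L i)).norm_mulOp_le (hBD _ i.2) (h2.trans hfb) hXX
  choose Z W hZW hA'Z using hblockR
  choose Z' W' hZW' hA'Z' using hblockL
  have hw0 : 0 ≤ θ * D + Cb * τ * D := by positivity
  obtain ⟨P, E, hPn, hEn, hPE, -⟩ := exists_right_cellSum (μ := μ) hp1 hp hL ρ (A := A') hD hw0
    (fun i => (hZW i).norm_left) (fun i => (hZW i).norm_right) (fun i => (hZW i).mul_left)
    (fun i => (hZW i).mul_right) (fun i => (hZW i).mul_left') (fun i => (hZW i).mul_right')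
  obtain ⟨Q, E', hQn, hEn', -, hQE⟩ := exists_right_cellSum (μ := μ) hp1 hp hL ρ (A := A') hD hw0
    (fun i => (hZW' i).norm_left) (fun i => (hZW' i).norm_right) (fun i => (hZW' i).mul_left)
    (fun i => (hZW' i).mul_right) (fun i => (hZW' i).mul_left') (fun i => (hZW' i).mul_right')
  have hPE' := hPE hA'Z
  have hQE' := hQE hA'Z'
  refine ⟨L, ρ, hL, P, Q, E + (A - A') * P, E' + Q * (A - A'), ?_, ?_, ?_, ?_⟩
  · have h1 : ‖(A - A') * P‖ ≤ (Cb * τ) * (100 * D) := (norm_mul_le _ _).trans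
      (mul_le_mul hAA' hPn (norm_nonneg _) (by positivity))
    refine (norm_add_le _ _).trans ?_
    linarith
  · have h1 : ‖Q * (A - A')‖ ≤ (100 * D) * (Cb * τ) := (norm_mul_le _ _).trans
      (mul_le_mul hQn hAA' (norm_nonneg _) (by positivity))
    refine (norm_add_le _ _).trans ?_
    linarith
  · rw [← add_assoc, ← hPE', sub_mul]
    abel
  · rw [← add_assoc, ← hQE', mul_sub]
    abel

theorem isFredholm_of_frozen (hS : SchurBound μ s S) (hp1 : 1 < p) (hp : p < ∞)
    (hk : Continuous k) (hδ : 0 < δ) (hC : 0 ≤ C) (hb : ∀ z, ‖k z‖ ≤ C * wt (s + δ) z)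
    {a b : Plane → ℂ} {Ca Cb D Ci : ℝ} (ha : BddMeas a Ca) (hbm : BddMeas b Cb) (hD : 0 ≤ D)
    (hai : BddMeas (fun x => (a x)⁻¹) Ci) (ha0 : ∀ᵐ x ∂μ, a x ≠ 0)
    (hfr : HasFrozenInverses μ p a b k Ca Cb D) : (abOp μ p a b k).IsFredholm := by
  obtain ⟨L, ρ, hL, P, Q, E₁, E₂, hE₁, hE₂, hP, hQ⟩ :=
    exists_parametrix (p := p) hS hp1 hp hk hδ hC hb ha hbm hD hfr (ε := 1 / 2) (by norm_num)
  set V := (farSet L ρ)ᶜ with hV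
  have hVm : MeasurableSet V := (measurableSet_farSet L ρ).compl
  have hVb : Bornology.IsBounded V := isBounded_compl_farSet hL ρ
  set T := kerOp μ p fun x y => k (x - y) with hT
  set Mi := mulOp μ p fun x => (a x)⁻¹ with hMi
  set MV := mulOp μ p (chi V) with hMV
  have hχV := bddMeas_chi hVm
  have hone : mulOp μ p (chi (farSet L ρ)) + MV = 1 := by
    rw [hMV, mulOp_add (bddMeas_chi (measurableSet_farSet L ρ)) hχV, ← mulOp_one]
    congr 1
    funext x
    by_cases hx : x ∈ farSet L ρ
    · rw [chi_of_mem hx, chi_of_notMem (M := V) fun h => h hx, add_zero]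
    · rw [chi_of_notMem hx, chi_of_mem (M := V) hx, zero_add]
  have hcomm : Mi * MV = MV * Mi := by
    rw [hMi, hMV, mulOp_mul_mulOp hai hχV, mulOp_mul_mulOp hχV hai]
    congr 1
    funext x
    ring
  have hB1 : BddMeas (fun _ : Plane => (1 : ℂ)) 1 := ⟨measurable_const, fun x => by simp⟩
  have hai1 : mulOp μ p a * Mi = 1 := by
    rw [hMi, mulOp_mul_mulOp ha hai, ← mulOp_one]
    refine mulOp_congr_ae hB1 ?_
    filter_upwards [ha0] with x hx
    exact mul_inv_cancel₀ hx
  have hai2 : Mi * mulOp μ p a = 1 := by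
    rw [hMi, mulOp_mul_mulOp hai ha, ← mulOp_one]
    refine mulOp_congr_ae hB1 ?_
    filter_upwards [ha0] with x hx
    exact inv_mul_cancel₀ hx
  refine isFredholm_of_near (P := P + Mi * MV) (Q := Q + MV * Mi) (E₁ := E₁) (E₂ := E₂)
    (T₁ := mulOp μ p b * ((T * MV) * Mi)) (T₂ := Mi * mulOp μ p b * (MV * T)) ?_ ?_ hE₁ hE₂ ?_ ?_
  · rw [mul_add, hP, ← hone, abOp, add_mul, ← mul_assoc, hai1, one_mul, hcomm]
    simp only [mul_assoc]
    abel
  · have h1 : MV * Mi * mulOp μ p b * T = Mi * mulOp μ p b * (MV * T) := by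
      have h2 : mulOp μ p b * MV = MV * mulOp μ p b := by
        rw [hMV, mulOp_mul_mulOp hbm hχV, mulOp_mul_mulOp hχV hbm]
        congr 1
        funext x
        ring
      rw [← hcomm, mul_assoc Mi, ← h2]
      simp only [mul_assoc]
    rw [add_mul, hQ, ← hone, abOp, mul_add, mul_assoc MV, hai2, mul_one, ← mul_assoc, h1]
    abel
  · exact ((isFinRankLimit_mul_chi hS hp1 hp hk hδ hC hb hVm hVb).mul_right _).mul_left _
  · exact (isFinRankLimit_chi_mul hS hp1 hp hk hδ hC hb hVm hVb).mul_left _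

end Assembly

/-! ### Geometry of periodic plane graphs -/

namespace PlaneGraph

variable (G : PlaneGraph)

theorem carrier_eq_iUnion : G.carrier = ⋃ e : G.edges, segment ℝ e.1.1 e.1.2 := by
  rw [carrier, Set.biUnion_eq_iUnion]

theorem isClosed_segment (x y : Plane) : IsClosed (segment ℝ x y) := by
  rw [segment_eq_image_lineMap]
  exact (isCompact_Icc.image AffineMap.lineMap_continuous).isClosed

theorem isClosed_carrier : IsClosed G.carrier := by
  rw [carrier_eq_iUnion]
  exact G.locallyFinite.isClosed_iUnion fun e => isClosed_segment _ _

theorem measurableSet_carrier : MeasurableSet G.carrier := G.isClosed_carrier.measurableSet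

theorem measure_lt_top_of_isCompact {K : Set Plane} (hK : IsCompact K) : G.measure K < ∞ := by
  have hfin := G.locallyFinite.finite_nonempty_inter_compact hK
  rw [measure, Measure.restrict_apply hK.measurableSet]
  have hsub : K ∩ G.carrier ⊆ ⋃ e ∈ hfin.toFinset, segment ℝ e.1.1 e.1.2 := by
    rintro x ⟨hxK, hx⟩
    rw [carrier_eq_iUnion, Set.mem_iUnion] at hx
    obtain ⟨e, he⟩ := hx
    simp only [Set.mem_iUnion]
    exact ⟨e, hfin.mem_toFinset.2 ⟨x, he, hxK⟩, he⟩
  refine (measure_mono hsub).trans_lt ?_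
  refine (measure_biUnion_finset_le _ _).trans_lt (ENNReal.sum_lt_top.2 fun e _ => ?_)
  rw [hausdorffMeasure_segment]
  exact edist_lt_top _ _

instance : IsFiniteMeasureOnCompacts G.measure := ⟨fun _ hK => G.measure_lt_top_of_isCompact hK⟩

instance : SFinite G.measure := by
  have : IsLocallyFiniteMeasure G.measure := isLocallyFiniteMeasure_of_isFiniteMeasureOnCompacts
  infer_instance

theorem ae_mem_carrier : ∀ᵐ x ∂G.measure, x ∈ G.carrier :=
  ae_restrict_mem G.measurableSet_carrier

theorem exists_edge : ∃ e, e ∈ G.edges := by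
  obtain ⟨v, hv⟩ := G.infinite_vertices.nonempty
  obtain ⟨e, he, -⟩ := G.valency_pos v hv
  exact ⟨e, he⟩

theorem segment_subset_carrier {e : Plane × Plane} (he : e ∈ G.edges) :
    segment ℝ e.1 e.2 ⊆ G.carrier := fun x hx => by
  rw [carrier, Set.mem_iUnion₂]
  exact ⟨e, he, hx⟩

theorem carrier_nonempty : G.carrier.Nonempty := by
  obtain ⟨e, he⟩ := G.exists_edge
  exact ⟨e.1, G.segment_subset_carrier he (left_mem_segment ℝ _ _)⟩

theorem exists_common_edge {x : Plane} : ∃ δ > 0, ∀ y ∈ G.carrier, dist y x < δ →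
    ∃ e ∈ G.edges, x ∈ segment ℝ e.1 e.2 ∧ y ∈ segment ℝ e.1 e.2 := by
  have h := G.locallyFinite.iInter_compl_mem_nhds (fun e => isClosed_segment _ _) x
  obtain ⟨δ, hδ, hsub⟩ := Metric.mem_nhds_iff.1 h
  refine ⟨δ, hδ, fun y hy hyx => ?_⟩
  rw [carrier_eq_iUnion, Set.mem_iUnion] at hy
  obtain ⟨e, he⟩ := hy
  refine ⟨e.1, e.2, ?_, he⟩
  by_contra hx
  have h2 := hsub hyx
  simp only [Set.mem_iInter] at h2
  exact h2 e hx he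

theorem pathEDist_le_edist {x y : Plane} {e : Plane × Plane} (he : e ∈ G.edges)
    (hx : x ∈ segment ℝ e.1 e.2) (hy : y ∈ segment ℝ e.1 e.2) : G.pathEDist x y ≤ edist x y := by
  refine iInf_le_of_le 1 (iInf_le_of_le (fun i => if i = 0 then x else y) (iInf_le_of_le ?_ ?_))
  · refine ⟨rfl, rfl, fun i hi => ⟨e, he, ?_⟩⟩
    obtain rfl : i = 0 := by omega
    exact ⟨hx, hy⟩
  · simp

end PlaneGraph

namespace PeriodicPlaneGraph

variable {n : ℕ} (G : PeriodicPlaneGraph n)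

theorem trans_injective : Function.Injective G.trans :=
  (injective_iff_map_eq_zero G.trans).2 G.free

theorem finite_trans_norm_le (R : ℝ) : {g | ‖G.trans g‖ ≤ R}.Finite := by
  obtain ⟨e, he⟩ := G.exists_edge
  have hfin := G.locallyFinite.finite_nonempty_inter_compact
    (isCompact_closedBall (0 : Plane) (‖e.1‖ + R))
  have hE : (⋃ f ∈ hfin.toFinset, ({f.1.1, f.1.2} : Set Plane)).Finite :=
    Set.Finite.biUnion (Finset.finite_toSet _) fun f _ => by simp
  refine Set.Finite.of_finite_image (f := fun g => e.1 + G.trans g) (hE.subset ?_)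
    (fun g _ g' _ h => G.trans_injective (add_left_cancel h))
  rintro _ ⟨g, hg, rfl⟩
  have hball : e.1 + G.trans g ∈ Metric.closedBall (0 : Plane) (‖e.1‖ + R) :=
    mem_closedBall_zero_iff.2 ((norm_add_le _ _).trans (add_le_add le_rfl hg))
  simp only [Set.mem_iUnion]
  rcases G.edges_add g e he with h | h
  · exact ⟨⟨_, h⟩, hfin.mem_toFinset.2 ⟨_, left_mem_segment ℝ _ _, hball⟩, by simp⟩
  · exact ⟨⟨_, h⟩, hfin.mem_toFinset.2 ⟨_, right_mem_segment ℝ _ _, hball⟩, by simp⟩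

theorem cobounded_eq_cofinite : Bornology.cobounded (Fin n → ℤ) = cofinite := by
  rw [Metric.cobounded_eq_cocompact, cocompact_eq_cofinite]

theorem tendsto_norm_trans :
    Tendsto (fun g => ‖G.trans g‖) (Bornology.cobounded (Fin n → ℤ)) atTop := by
  rw [cobounded_eq_cofinite, tendsto_atTop]
  intro R
  have := (G.finite_trans_norm_le R).compl_mem_cofinite
  filter_upwards [this] with g hg
  exact (not_le.1 (show ¬‖G.trans g‖ ≤ R from hg)).le

theorem tendsto_cobounded_of_norm_trans {h : ℕ → Fin n → ℤ}
    (hh : Tendsto (fun m => ‖G.trans (h m)‖) atTop atTop) :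
    Tendsto h atTop (Bornology.cobounded (Fin n → ℤ)) := by
  rw [cobounded_eq_cofinite]
  refine le_cofinite_iff_eventually_ne.2 fun g => ?_
  rw [eventually_map]
  filter_upwards [hh.eventually (eventually_gt_atTop ‖G.trans g‖)] with m hm hmg
  rw [hmg] at hm
  exact lt_irrefl _ hm

theorem summable_wt_trans (hn : n ≤ 2) {s : ℝ} (hs : 2 < s) :
    Summable fun g => wt s (G.trans g) := by
  let f : (Fin n → ℤ) →ₗ[ℤ] Plane := G.trans.toIntLinearMap
  have hf : Function.Injective f := G.trans_injective
  let e := LinearEquiv.ofInjective f hf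
  have hdisc : DiscreteTopology (LinearMap.range f) := by
    refine discreteTopology_of_isOpen_singleton_zero ?_
    refine isOpen_singleton_of_finite_mem_nhds 0 (Metric.ball_mem_nhds 0 one_pos) ?_
    have hfin := (G.finite_trans_norm_le 1).image e
    refine hfin.subset fun z hz => ?_
    obtain ⟨g, rfl⟩ := e.surjective z
    refine ⟨g, ?_, rfl⟩
    exact (mem_ball_zero_iff.1 hz).le
  have hrank : Module.finrank ℤ (LinearMap.range f) = n := by
    rw [← e.finrank_eq]
    simp
  have hsum := ZLattice.summable_norm_rpow (LinearMap.range f) (-s) (by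
    rw [hrank]
    have : (n : ℝ) ≤ 2 := by exact_mod_cast hn
    linarith)
  have hsum2 : Summable fun g => ‖G.trans g‖ ^ (-s) := e.toEquiv.summable_iff.2 hsum
  refine Summable.of_nonneg_of_le (fun g => (wt_pos _ _).le) (fun g => ?_)
    (hsum2.add (summable_of_ne_finset_zero (f := fun g : Fin n → ℤ => if g = 0 then (1 : ℝ) else 0)
      (s := {0}) (fun g hg => if_neg (by simpa using hg))))
  by_cases hg : g = 0
  · rw [if_pos hg]
    have := wt_le_one (by linarith : 0 ≤ s) (G.trans g)
    have h2 : 0 ≤ ‖G.trans g‖ ^ (-s) := by positivity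
    linarith
  · rw [if_neg hg, add_zero]
    have : 0 < ‖G.trans g‖ := norm_pos_iff.2 fun h => hg (G.free g h)
    exact Real.rpow_le_rpow_of_nonpos this (by linarith) (by linarith)

theorem wt_le_mul_wt {s c : ℝ} (hs : 0 ≤ s) (hc : 0 < c) {z w : Plane}
    (h : 1 + ‖w‖ ≤ c * (1 + ‖z‖)) : wt s z ≤ c ^ s * wt s w := by
  rw [wt, wt, Real.rpow_neg (by positivity), Real.rpow_neg (by positivity), ← div_eq_mul_inv,
    le_div_iff₀ (by positivity), inv_mul_le_iff₀ (by positivity), mul_comm,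
    ← Real.mul_rpow hc.le (by positivity)]
  exact Real.rpow_le_rpow (by positivity) h hs

theorem exists_schurBound (hn : n ≤ 2) {s : ℝ} (hs : 2 < s) : ∃ S, SchurBound G.measure s S := by
  obtain ⟨K, hK, hKΓ, hcov⟩ := G.cocompact
  obtain ⟨r₀, hr₀⟩ := hK.isBounded.subset_closedBall 0
  set r := max r₀ 0 with hr
  have hr0 : 0 ≤ r := le_max_right _ _
  have hKr : ∀ y ∈ K, ‖y‖ ≤ r := fun y hy =>
    (mem_closedBall_zero_iff.1 (hr₀ hy)).trans (le_max_left _ _)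
  have hs0 : 0 ≤ s := by linarith
  set c := 2 + 2 * r with hc
  have hc0 : 0 < c := by positivity
  have hsum := G.summable_wt_trans hn hs
  set κ := (G.measure K).toReal with hκ
  have hκ' : G.measure K = ENNReal.ofReal κ :=
    (ENNReal.ofReal_toReal (G.measure_lt_top_of_isCompact hK).ne).symm
  have hts : 0 ≤ ∑' g, wt s (G.trans g) := tsum_nonneg fun g => (wt_pos _ _).le
  refine ⟨c ^ s * (∑' g, wt s (G.trans g)) * κ, hs0, by positivity, fun x => ?_⟩
  obtain ⟨x', hx', hdist⟩ := G.isClosed_carrier.exists_infDist_eq_dist G.carrier_nonempty x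
  obtain ⟨g₀, y₀, hy₀, rfl⟩ := hcov x' hx'
  let Kg : (Fin n → ℤ) → Set Plane := fun g => (fun y => y - G.trans g) ⁻¹' K
  have hKg : ∀ g, MeasurableSet (Kg g) := fun g =>
    hK.measurableSet.preimage (by fun_prop)
  have hpt : ∀ g, ∀ y ∈ Kg g ∩ G.carrier,
      ENNReal.ofReal (wt s (x - y)) ≤ ENNReal.ofReal (c ^ s * wt s (G.trans (g - g₀))) := by
    rintro g y ⟨hy, hyΓ⟩
    refine ENNReal.ofReal_le_ofReal (wt_le_mul_wt hs0 hc0 ?_)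
    have h1 : ‖x - (y₀ + G.trans g₀)‖ ≤ ‖x - y‖ := by
      rw [← dist_eq_norm, ← dist_eq_norm, ← hdist]
      exact Metric.infDist_le_dist_of_mem hyΓ
    have h2 : G.trans (g - g₀) = (x - (y₀ + G.trans g₀)) - (x - y) - (y - G.trans g) + y₀ := by
      rw [map_sub]; abel
    have h3 : ‖G.trans (g - g₀)‖ ≤ ‖x - y‖ + ‖x - y‖ + r + r := by
      rw [h2]
      refine (norm_add_le _ _).trans (add_le_add ((norm_sub_le _ _).trans (add_le_add
        ((norm_sub_le _ _).trans (add_le_add h1 le_rfl)) (hKr _ hy))) (hKr _ hy₀))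
    have h4 := norm_nonneg (x - y)
    nlinarith
  have hrestr : G.measure = G.measure.restrict (⋃ g, Kg g ∩ G.carrier) := by
    refine (Measure.restrict_eq_self_of_ae_mem ?_).symm
    filter_upwards [G.ae_mem_carrier] with y hy
    obtain ⟨g, z, hz, rfl⟩ := hcov y hy
    rw [Set.mem_iUnion]
    exact ⟨g, by simpa [Kg] using hz, hy⟩
  calc ∫⁻ y, ENNReal.ofReal (wt s (x - y)) ∂G.measure
      = ∫⁻ y in ⋃ g, Kg g ∩ G.carrier, ENNReal.ofReal (wt s (x - y)) ∂G.measure := by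
        rw [← hrestr]
    _ ≤ ∑' g, ∫⁻ y in Kg g ∩ G.carrier, ENNReal.ofReal (wt s (x - y)) ∂G.measure :=
        lintegral_iUnion_le _ _
    _ ≤ ∑' g, ENNReal.ofReal (c ^ s * wt s (G.trans (g - g₀))) * G.measure K := by
        refine ENNReal.tsum_le_tsum fun g => ?_
        refine (setLIntegral_mono' ((hKg g).inter G.measurableSet_carrier) (hpt g)).trans ?_
        rw [setLIntegral_const]
        refine mul_le_mul_right ?_ _
        refine (measure_mono (μ := G.measure) Set.inter_subset_left).trans ?_
        rw [(G.measurePreserving_sub g).measure_preimage hK.measurableSet.nullMeasurableSet]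
    _ = ENNReal.ofReal (c ^ s * (∑' g, wt s (G.trans g)) * κ) := by
        rw [ENNReal.tsum_mul_right, hκ', ENNReal.ofReal_mul (by positivity)]
        congr 1
        refine ((Equiv.subRight g₀).tsum_eq
          fun g => ENNReal.ofReal (c ^ s * wt s (G.trans g))).trans ?_
        rw [← tsum_mul_left, ENNReal.ofReal_tsum_of_nonneg
            (fun g => mul_nonneg (by positivity) (wt_pos _ _).le) (hsum.mul_left _)]

theorem pathEDist_add_le {x y : Plane} {e : Plane × Plane} (he : e ∈ G.edges)
    (hx : x ∈ segment ℝ e.1 e.2) (hy : y ∈ segment ℝ e.1 e.2) (g : Fin n → ℤ) :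
    G.pathEDist (x + G.trans g) (y + G.trans g) ≤ edist x y := by
  have h : ∀ z ∈ segment ℝ e.1 e.2,
      z + G.trans g ∈ segment ℝ (e.1 + G.trans g) (e.2 + G.trans g) := fun z hz => by
    rw [add_comm z, add_comm e.1, add_comm e.2]
    exact (mem_segment_translate ℝ _).2 hz
  rw [← edist_add_right x y (G.trans g)]
  rcases G.edges_add g e he with h1 | h1
  · exact G.pathEDist_le_edist h1 (h x hx) (h y hy)
  · exact G.pathEDist_le_edist h1 (by rw [segment_symm]; exact h x hx)
      (by rw [segment_symm]; exact h y hy)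

theorem equicontinuous_translates {a : Plane → ℂ} (ha : G.IsBUC a) {x : Plane}
    (hx : x ∈ G.carrier) {ε : ℝ} (hε : 0 < ε) : ∃ δ > 0, ∀ y ∈ G.carrier, dist y x < δ →
      ∀ g, ‖a (x + G.trans g) - a (y + G.trans g)‖ < ε := by
  obtain ⟨δ₁, hδ₁, h1⟩ := G.exists_common_edge (x := x)
  obtain ⟨δ₂, hδ₂, h2⟩ := ha.2 ε hε
  refine ⟨min δ₁ δ₂, lt_min hδ₁ hδ₂, fun y hy hyx g => ?_⟩
  obtain ⟨e, he, hxe, hye⟩ := h1 y hy (hyx.trans_le (min_le_left _ _))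
  refine h2 _ (G.add_mem_carrier g hx) _ (G.add_mem_carrier g hy) ?_
  refine (G.pathEDist_add_le he hxe hye g).trans_lt ?_
  rw [edist_dist, dist_comm]
  exact (ENNReal.ofReal_lt_ofReal_iff hδ₂).2 (hyx.trans_le (min_le_right _ _))

end PeriodicPlaneGraph

/-! ### Limit functions and limit operators -/

namespace PeriodicPlaneGraph

variable {n : ℕ} (G : PeriodicPlaneGraph n)

/-- `f` is measurable, bounded by `C`, and vanishes off the graph. -/
structure IsCoeff (f : Plane → ℂ) (C : ℝ) : Prop where
  bdd : BddMeas f C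
  zero : ∀ x, x ∉ G.carrier → f x = 0

variable {G}

theorem isCoeff_of_continuousOn {f : Plane → ℂ} (hf : ContinuousOn f G.carrier)
    (h0 : ∀ x, x ∉ G.carrier → f x = 0) {C : ℝ} (hC : 0 ≤ C) (hb : ∀ x ∈ G.carrier, ‖f x‖ ≤ C) :
    G.IsCoeff f C := by
  classical
  refine ⟨⟨?_, fun x => ?_⟩, h0⟩
  · have h : f = G.carrier.piecewise f fun _ => 0 := by
      funext x
      by_cases hx : x ∈ G.carrier
      · rw [Set.piecewise_eq_of_mem _ _ _ hx]
      · rw [Set.piecewise_eq_of_notMem _ _ _ hx, h0 x hx]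
    rw [h]
    exact hf.measurable_piecewise continuousOn_const G.measurableSet_carrier
  · by_cases hx : x ∈ G.carrier
    · exact hb x hx
    · rw [h0 x hx, norm_zero]
      exact hC

theorem continuousOn_of_isBUC {a : Plane → ℂ} (ha : G.IsBUC a) : ContinuousOn a G.carrier := by
  intro x hx
  rw [ContinuousWithinAt, Metric.tendsto_nhdsWithin_nhds]
  intro ε hε
  obtain ⟨δ, hδ, h⟩ := G.equicontinuous_translates ha hx hε
  refine ⟨δ, hδ, fun y hy hyx => ?_⟩
  have h1 := h y hy hyx 0
  rw [map_zero, add_zero, add_zero] at h1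
  rwa [dist_comm, dist_eq_norm]

theorem isCoeff_indicator {a : Plane → ℂ} (ha : G.IsBUC a) {C : ℝ} (hC : 0 ≤ C)
    (hb : ∀ x ∈ G.carrier, ‖a x‖ ≤ C) : G.IsCoeff (G.carrier.indicator a) C :=
  isCoeff_of_continuousOn
    ((continuousOn_of_isBUC ha).congr fun x hx => Set.indicator_of_mem hx a)
    (fun x hx => Set.indicator_of_notMem hx a) hC
    fun x hx => by rw [Set.indicator_of_mem hx]; exact hb x hx

theorem exists_limitFunction {a : Plane → ℂ} (ha : G.IsBUC a) {C : ℝ} (hC : 0 ≤ C)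
    (hb : ∀ x ∈ G.carrier, ‖a x‖ ≤ C) (h : ℕ → Fin n → ℤ) :
    ∃ φ : ℕ → ℕ, StrictMono φ ∧ ∃ a' : Plane → ℂ, G.IsLimitFunction a (h ∘ φ) a' ∧
      G.IsCoeff a' C := by
  have hemb : IsClosedEmbedding (Subtype.val : G.carrier → Plane) :=
    G.isClosed_carrier.isClosedEmbedding_subtypeVal
  have : LocallyCompactSpace G.carrier := hemb.locallyCompactSpace
  have : SigmaCompactSpace G.carrier := hemb.sigmaCompactSpace
  choose δ hδ hδa using fun (x : G.carrier) (ε : {ε : ℝ // 0 < ε}) =>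
    G.equicontinuous_translates ha x.2 ε.2
  let P : (G.carrier → ℂ) → Prop := fun f => (∀ x, ‖f x‖ ≤ C) ∧
    ∀ (x : G.carrier) (ε : {ε : ℝ // 0 < ε}) (y : G.carrier), dist (y : Plane) x < δ x ε →
      ‖f x - f y‖ ≤ ε
  have hPeq : Equicontinuous (fun f : {f // P f} => (f : G.carrier → ℂ)) := by
    intro x
    rw [Metric.equicontinuousAt_iff]
    intro ε hε
    refine ⟨δ x ⟨ε / 2, by positivity⟩, hδ _ _, fun y hy f => ?_⟩
    rw [dist_eq_norm]
    refine (f.2.2 x ⟨ε / 2, by positivity⟩ y hy).trans_lt ?_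
    exact half_lt_self hε
  have hPc : IsClosed {f | P f} := by
    have h1 : ∀ x : G.carrier, Continuous fun f : G.carrier → ℂ => f x := continuous_apply
    simp only [P, Set.ofPred_and, Set.ofPred_forall]
    refine (isClosed_iInter fun x => isClosed_le (h1 x).norm continuous_const).inter ?_
    refine isClosed_iInter fun x => isClosed_iInter fun ε => isClosed_iInter fun y =>
      isClosed_iInter fun _ => isClosed_le ((h1 x).sub (h1 y)).norm continuous_const
  have hPk : IsCompact {f | P f} :=
    (isCompact_univ_pi fun _ : G.carrier => isCompact_closedBall (0 : ℂ) C).of_isClosed_subset hPc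
      fun f hf x _ => mem_closedBall_zero_iff.2 (hf.1 x)
  let S : Set C(G.carrier, ℂ) := {f | P f}
  have hS : IsCompact S := by
    refine ArzelaAscoli.isCompact_of_equicontinuous S ?_ ?_
    · convert hPk
      ext f
      constructor
      · rintro ⟨g, hg, rfl⟩
        exact hg
      · intro hf
        exact ⟨⟨f, hPeq.continuous ⟨f, hf⟩⟩, hf, rfl⟩
    · intro x U hU
      filter_upwards [hPeq x U hU] with y hy f
      exact hy ⟨f.1, f.2⟩
  have hFP : ∀ m, P fun x => a (x + G.trans (h m)) := fun m =>
    ⟨fun x => hb _ (G.add_mem_carrier _ x.2), fun x ε y hxy => (hδa x ε y y.2 hxy _).le⟩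
  let F : ℕ → C(G.carrier, ℂ) := fun m =>
    ⟨fun x => a (x + G.trans (h m)), hPeq.continuous ⟨_, hFP m⟩⟩
  obtain ⟨f, hf, φ, hφ, hlim⟩ := hS.isSeqCompact (x := F) fun m => hFP m
  classical
  let a' : Plane → ℂ := fun x => if hx : x ∈ G.carrier then f ⟨x, hx⟩ else 0
  have ha'f : ∀ x : G.carrier, a' x = f x := fun x => dif_pos x.2
  refine ⟨φ, hφ, a', fun M hM hMΓ => ?_, isCoeff_of_continuousOn ?_ (fun x hx => dif_neg hx) hC
    fun x hx => ?_⟩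
  · have h1 := ContinuousMap.tendsto_iff_forall_isCompact_tendstoUniformlyOn.1 hlim
      (Subtype.val ⁻¹' M) (hemb.isCompact_preimage hM)
    rw [Metric.tendstoUniformlyOn_iff] at h1 ⊢
    intro ε hε
    filter_upwards [h1 ε hε] with m hm x hx
    have h2 := hm ⟨x, hMΓ hx⟩ hx
    rwa [← ha'f] at h2
  · rw [continuousOn_iff_continuous_domRestrict]
    exact f.continuous.congr fun x => (ha'f x).symm
  · have := hf.1 ⟨x, hx⟩
    rwa [← ha'f] at this

theorem IsLimitFunction.comp {a a' : Plane → ℂ} {h : ℕ → Fin n → ℤ}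
    (ha : G.IsLimitFunction a h a') {φ : ℕ → ℕ} (hφ : StrictMono φ) :
    G.IsLimitFunction a (h ∘ φ) a' := by
  intro M hM hMΓ U hU
  exact hφ.tendsto_atTop.eventually (ha M hM hMΓ U hU)

theorem IsLimitFunction.eventually_norm_sub_le {a a' : Plane → ℂ} {h : ℕ → Fin n → ℤ} {C : ℝ}
    (ha : G.IsLimitFunction a h a') (ha' : G.IsCoeff a' C) (r : ℝ) {ε : ℝ} (hε : 0 < ε) :
    ∀ᶠ m in atTop, ∀ x ∈ Metric.closedBall (0 : Plane) r,
      ‖G.carrier.indicator a (x + G.trans (h m)) - a' x‖ ≤ ε := by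
  have hK : IsCompact (Metric.closedBall (0 : Plane) r ∩ G.carrier) :=
    (isCompact_closedBall _ _).inter_right G.isClosed_carrier
  have h1 := Metric.tendstoUniformlyOn_iff.1 (ha _ hK Set.inter_subset_right) ε hε
  filter_upwards [h1] with m hm x hx
  by_cases hxΓ : x ∈ G.carrier
  · have h2 := hm x ⟨hx, hxΓ⟩
    rw [dist_comm, dist_eq_norm] at h2
    rw [Set.indicator_of_mem (G.add_mem_carrier _ hxΓ)]
    exact h2.le
  · rw [ha'.zero x hxΓ, Set.indicator_of_notMem, sub_zero, norm_zero]
    · exact hε.le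
    · intro hmem
      refine hxΓ ((G.sub_mem_carrier_iff (-h m) x).1 ?_)
      rwa [map_neg, sub_neg_eq_add]

theorem IsLimitFunction.tendsto {a a' : Plane → ℂ} {h : ℕ → Fin n → ℤ}
    (ha : G.IsLimitFunction a h a') {x : Plane} (hx : x ∈ G.carrier) :
    Tendsto (fun m => a (x + G.trans (h m))) atTop (𝓝 (a' x)) :=
  (ha {x} isCompact_singleton (Set.singleton_subset_iff.2 hx)).tendsto_at rfl

theorem IsLimitFunction.periodic {a a' : Plane → ℂ} {h : ℕ → Fin n → ℤ} {C : ℝ}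
    (ha : G.IsLimitFunction a h a') (ha' : G.IsCoeff a' C) (hso : G.IsSO a)
    (hh : Tendsto h atTop (Bornology.cobounded (Fin n → ℤ))) (β : Fin n → ℤ) (x : Plane) :
    a' (x + G.trans β) = a' x := by
  by_cases hx : x ∈ G.carrier
  · have h1 := ha.tendsto (G.add_mem_carrier β hx)
    have h2 := ha.tendsto hx
    have h3 := ((hso β {x} isCompact_singleton (Set.singleton_subset_iff.2 hx)).tendsto_at
      rfl).comp hh
    have h4 := h1.sub h2
    refine sub_eq_zero.1 (tendsto_nhds_unique h4 (h3.congr fun m => ?_))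
    simp only [Function.comp_apply, map_add, add_assoc]
  · rw [ha'.zero x hx, ha'.zero]
    intro h
    refine hx ((G.sub_mem_carrier_iff (-β) x).1 ?_)
    rwa [map_neg, sub_neg_eq_add]

section Operators

variable {p : ℝ≥0∞} [Fact (1 ≤ p)]

theorem shift_ae (g : Fin n → ℤ) (u : G.LpSpace p) :
    G.shift p g u =ᵐ[G.measure] fun x => u (x - G.trans g) :=
  Lp.coeFn_compMeasurePreserving u (G.measurePreserving_sub g)

theorem ae_comp_sub (g : Fin n → ℤ) {q : Plane → Prop} (hq : ∀ᵐ x ∂G.measure, q x) :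
    ∀ᵐ x ∂G.measure, q (x - G.trans g) :=
  (G.measurePreserving_sub g).quasiMeasurePreserving.tendsto_ae.eventually hq

theorem norm_shift (g : Fin n → ℤ) (u : G.LpSpace p) : ‖G.shift p g u‖ = ‖u‖ :=
  (Lp.compMeasurePreservingₗᵢ ℂ _ (G.measurePreserving_sub g)).norm_map u

theorem shift_mul_shift_neg (g : Fin n → ℤ) : G.shift p g * G.shift p (-g) = 1 := by
  refine clm_ext_ae fun u => ?_
  filter_upwards [shift_ae g (G.shift p (-g) u), ae_comp_sub g (shift_ae (-g) u)] with x h1 h2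
  rw [mul_apply_eq_comp, h1, h2, map_neg, sub_neg_eq_add, sub_add_cancel]
  rfl

theorem shift_neg_mul_shift (g : Fin n → ℤ) : G.shift p (-g) * G.shift p g = 1 := by
  simpa using shift_mul_shift_neg (G := G) (p := p) (-g)

theorem norm_shift_le (g : Fin n → ℤ) : ‖G.shift p g‖ ≤ 1 :=
  ContinuousLinearMap.opNorm_le_bound _ zero_le_one fun u => by rw [norm_shift, one_mul]

theorem shift_conj_mulOp {f : Plane → ℂ} {C : ℝ} (hf : BddMeas f C) (g : Fin n → ℤ) :
    G.shift p (-g) * mulOp G.measure p f * G.shift p g =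
      mulOp G.measure p fun x => f (x + G.trans g) :=
  (mulOp_eq fun u => by
    filter_upwards [shift_ae (-g) (mulOp G.measure p f (G.shift p g u)),
      ae_comp_sub (-g) (hf.mulOp_ae (G.shift p g u)),
      ae_comp_sub (-g) (shift_ae g u)] with x h1 h2 h3
    rw [mul_apply_eq_comp, mul_apply_eq_comp, h1, h2, h3, map_neg, sub_neg_eq_add,
      add_sub_cancel_right]).symm

theorem shift_conj_kerOp {s S C : ℝ} {k : Plane → ℂ} (hS : SchurBound G.measure s S)
    (hp1 : 1 < p) (hp : p < ∞) (hk : Continuous k) (hb : ∀ z, ‖k z‖ ≤ C * wt s z)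
    (g : Fin n → ℤ) :
    G.shift p (-g) * (kerOp G.measure p fun x y => k (x - y)) * G.shift p g =
      kerOp G.measure p fun x y => k (x - y) := by
  refine (kerOp_eq fun u => ?_).symm
  filter_upwards [shift_ae (-g) (kerOp G.measure p (fun x y => k (x - y)) (G.shift p g u)),
    ae_comp_sub (-g) ((isKer_conv hk hb).kerOp_ae hS hp1 hp (G.shift p g u))] with x h1 h2
  rw [mul_apply_eq_comp, mul_apply_eq_comp, h1, h2, map_neg, sub_neg_eq_add]
  have h3 : ∫ y, k (x + G.trans g - y) * (G.shift p g u : Plane → ℂ) y ∂G.measure =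
      ∫ y, (fun y : Plane => k (x - y) * (u : Plane → ℂ) y) (y - G.trans g) ∂G.measure := by
    refine integral_congr_ae ?_
    filter_upwards [shift_ae g u] with y hy
    rw [hy]
    congr 2
    abel
  rw [h3]
  exact (G.measurePreserving_sub g).integral_comp
    (MeasurableEquiv.subRight (G.trans g)).measurableEmbedding
    fun y : Plane => k (x - y) * (u : Plane → ℂ) y

theorem shift_conj_abOp {s S C : ℝ} {k : Plane → ℂ} (hS : SchurBound G.measure s S)
    (hp1 : 1 < p) (hp : p < ∞) (hk : Continuous k) (hb : ∀ z, ‖k z‖ ≤ C * wt s z)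
    {a b : Plane → ℂ} {Ca Cb : ℝ} (ha : BddMeas a Ca) (hbm : BddMeas b Cb) (g : Fin n → ℤ) :
    G.shift p (-g) * abOp G.measure p a b k * G.shift p g =
      abOp G.measure p (fun x => a (x + G.trans g)) (fun x => b (x + G.trans g)) k := by
  have h1 : ∀ X Y : G.LpSpace p →L[ℂ] G.LpSpace p, G.shift p (-g) * (X * Y) * G.shift p g =
      (G.shift p (-g) * X * G.shift p g) * (G.shift p (-g) * Y * G.shift p g) := by
    intro X Y
    have h2 : (G.shift p (-g) * X * G.shift p g) * (G.shift p (-g) * Y * G.shift p g) =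
      G.shift p (-g) * X * (G.shift p g * G.shift p (-g)) * Y * G.shift p g := by
      simp only [mul_assoc]
    rw [h2, shift_mul_shift_neg, mul_one]
    simp only [mul_assoc]
  rw [abOp, mul_add, add_mul, h1, shift_conj_mulOp ha, shift_conj_mulOp hbm,
    shift_conj_kerOp hS hp1 hp hk hb, abOp]

theorem IsCoeff.translate {a : Plane → ℂ} {C : ℝ} (ha : G.IsCoeff a C) (g : Fin n → ℤ) :
    G.IsCoeff (fun x => a (x + G.trans g)) C :=
  ⟨⟨ha.bdd.meas.comp (by fun_prop), fun x => ha.bdd.bound _⟩, fun x hx => ha.zero _ fun h => by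
    refine hx ((G.sub_mem_carrier_iff (-g) x).1 ?_)
    rwa [map_neg, sub_neg_eq_add]⟩

theorem actsAs_abOp {s S C : ℝ} {k : Plane → ℂ} (hS : SchurBound G.measure s S)
    (hp1 : 1 < p) (hp : p < ∞) (hk : Continuous k) (hb : ∀ z, ‖k z‖ ≤ C * wt s z)
    {a b a₀ b₀ : Plane → ℂ} {Ca Cb : ℝ} (ha : BddMeas a Ca) (hbm : BddMeas b Cb)
    (ha₀ : ∀ x ∈ G.carrier, a x = a₀ x) (hb₀ : ∀ x ∈ G.carrier, b x = b₀ x) :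
    G.ActsAs p a₀ b₀ k (abOp G.measure p a b k) := by
  intro u
  have hT := isKer_conv hk hb
  refine ⟨fun x _ => hT.integrable hS hp1 hp u x, ?_⟩
  filter_upwards [Lp.coeFn_add (mulOp G.measure p a u)
      (mulOp G.measure p b (kerOp G.measure p (fun x y => k (x - y)) u)),
    ha.mulOp_ae u, hbm.mulOp_ae (kerOp G.measure p (fun x y => k (x - y)) u),
    hT.kerOp_ae hS hp1 hp u, G.ae_mem_carrier] with x h1 h2 h3 h4 h5
  rw [abOp, add_apply, mul_apply_eq_comp, h1, Pi.add_apply, h2, h3, h4, ha₀ x h5, hb₀ x h5]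

theorem abOp_sub_abOp {a b a' b' : Plane → ℂ} {Ca Cb Ca' Cb' : ℝ} (ha : BddMeas a Ca)
    (hbm : BddMeas b Cb) (ha' : BddMeas a' Ca') (hbm' : BddMeas b' Cb') (k : Plane → ℂ) :
    abOp G.measure p a b k - abOp G.measure p a' b' k =
      abOp G.measure p (fun x => a x - a' x) (fun x => b x - b' x) k := by
  rw [abOp, abOp, abOp, ← mulOp_sub ha ha', ← mulOp_sub hbm hbm', sub_mul]
  abel

theorem norm_mulOp_mul_kerOp_mul_chi_le {s S C : ℝ} {k : Plane → ℂ}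
    (hS : SchurBound G.measure s S)
    (hp1 : 1 < p) (hp : p < ∞) (hk : Continuous k) (hb : ∀ z, ‖k z‖ ≤ C * wt s z)
    {β : Plane → ℂ} {Cβ R r ε τ : ℝ} (hβ : BddMeas β Cβ) {M : Set Plane} (hM : MeasurableSet M)
    (hMr : M ⊆ Metric.closedBall 0 r) (hε : 0 ≤ ε)
    (hβε : ∀ x ∈ Metric.closedBall (0 : Plane) (r + R + 1), ‖β x‖ ≤ ε)
    (hτ : ‖(kerOp G.measure p fun x y => k (x - y)) -
      kerOp G.measure p fun x y => trunc R k (x - y)‖ ≤ τ) :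
    ‖mulOp G.measure p β * (kerOp G.measure p fun x y => k (x - y)) *
      mulOp G.measure p (chi M)‖ ≤ Cβ * τ + ε * (C * S) := by
  set T := kerOp G.measure p fun x y => k (x - y)
  set T' := kerOp G.measure p fun x y => trunc R k (x - y) with hT'
  set N := Metric.closedBall (0 : Plane) (r + R + 1)
  have hN := bddMeas_chi
    (Metric.isClosed_closedBall (x := (0 : Plane)) (ε := r + R + 1)).measurableSet
  have hβN : BddMeas (fun x => β x * chi N x) ε := by
    refine ⟨hβ.meas.mul hN.meas, fun x => ?_⟩
    by_cases hx : x ∈ N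
    · rw [chi_of_mem hx, mul_one]
      exact hβε x hx
    · rw [chi_of_notMem hx, mul_zero, norm_zero]
      exact hε
  have h1 : mulOp G.measure p β * T * mulOp G.measure p (chi M) =
      mulOp G.measure p β * (T - T') * mulOp G.measure p (chi M) +
      mulOp G.measure p (fun x => β x * chi N x) * T' * mulOp G.measure p (chi M) := by
    rw [← mulOp_mul_mulOp hβ hN]
    have h2 : mulOp G.measure p (chi N) * T' * mulOp G.measure p (chi M) =
        T' * mulOp G.measure p (chi M) := trunc_mul_chi hS hp1 hp hk hb hM hMr
    rw [mul_assoc (mulOp G.measure p β) (mulOp G.measure p (chi N)) T',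
      mul_assoc (mulOp G.measure p β) (mulOp G.measure p (chi N) * T'), h2]
    noncomm_ring
  have hMn := (bddMeas_chi hM).norm_mulOp_le (μ := G.measure) (p := p)
  rw [h1]
  refine (norm_add_le _ _).trans (add_le_add ?_ ?_)
  · exact (norm_mul_mul_le hβ.norm_mulOp_le hτ hMn).trans_eq (mul_one _)
  · exact (norm_mul_mul_le hβN.norm_mulOp_le
      ((isKer_trunc hk hb R).norm_kerOp_le hS hp1 hp) hMn).trans_eq (mul_one _)

theorem isLimitOperator_abOp {s S δ C : ℝ} {k : Plane → ℂ} (hS : SchurBound G.measure s S)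
    (hp1 : 1 < p) (hp : p < ∞) (hk : Continuous k) (hδ : 0 < δ) (hC : 0 ≤ C)
    (hb : ∀ z, ‖k z‖ ≤ C * wt (s + δ) z)
    {a b a' b' : Plane → ℂ} {Ca Cb : ℝ} (ha : G.IsCoeff (G.carrier.indicator a) Ca)
    (hbm : G.IsCoeff (G.carrier.indicator b) Cb)
    (ha' : G.IsCoeff a' Ca) (hbm' : G.IsCoeff b' Cb) {h : ℕ → Fin n → ℤ}
    (hh : Tendsto h atTop (Bornology.cobounded (Fin n → ℤ)))
    (hla : G.IsLimitFunction a h a') (hlb : G.IsLimitFunction b h b') :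
    G.IsLimitOperator p (abOp G.measure p (G.carrier.indicator a) (G.carrier.indicator b) k) h
      (abOp G.measure p a' b' k) := by
  have hb' : ∀ z, ‖k z‖ ≤ C * wt s z := fun z => (hb z).trans (mul_le_mul_of_nonneg_left
    (by rw [wt_add]; exact mul_le_of_le_one_right (wt_pos _ _).le (wt_le_one hδ.le z)) hC)
  refine ⟨hh, fun M hM hMΓ => ?_⟩
  obtain ⟨r, hr⟩ := hM.isBounded.subset_closedBall 0
  have hMm := hM.measurableSet
  have hχ := bddMeas_chi hMm
  have hCS : 0 ≤ C * S := mul_nonneg hC hS.nonneg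
  have hCb := hbm.bdd.nonneg
  set T := kerOp G.measure p fun x y => k (x - y) with hT
  have hTn : ‖T‖ ≤ C * S := (isKer_conv hk hb').norm_kerOp_le hS hp1 hp
  let α : ℕ → Plane → ℂ := fun m x => G.carrier.indicator a (x + G.trans (h m)) - a' x
  let β : ℕ → Plane → ℂ := fun m x => G.carrier.indicator b (x + G.trans (h m)) - b' x
  have hα : ∀ m, BddMeas (α m) (Ca + Ca) := fun m => (ha.translate (h m)).bdd.sub ha'.bdd
  have hβ : ∀ m, BddMeas (β m) (Cb + Cb) := fun m => (hbm.translate (h m)).bdd.sub hbm'.bdd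
  have hΔ : ∀ m, G.shift p (-h m) *
      abOp G.measure p (G.carrier.indicator a) (G.carrier.indicator b) k * G.shift p (h m) -
      abOp G.measure p a' b' k = mulOp G.measure p (α m) + mulOp G.measure p (β m) * T := by
    intro m
    rw [shift_conj_abOp hS hp1 hp hk hb' ha.bdd hbm.bdd, abOp_sub_abOp (ha.translate (h m)).bdd
      (hbm.translate (h m)).bdd ha'.bdd hbm'.bdd]
    rfl
  have hsmall : ∀ {f : Plane → ℂ} {D ε : ℝ}, BddMeas f D → 0 ≤ ε →
      (∀ x ∈ Metric.closedBall (0 : Plane) r, ‖f x‖ ≤ ε) →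
      BddMeas (fun x => chi M x * f x) ε := by
    intro f D ε hf hε hfε
    refine ⟨hχ.meas.mul hf.meas, fun x => ?_⟩
    by_cases hx : x ∈ M
    · rw [chi_of_mem hx, one_mul]
      exact hfε x (hr hx)
    · rw [chi_of_notMem hx, zero_mul, norm_zero]
      exact hε
  have hcut : G.cutoff p M hMm = mulOp G.measure p (chi M) := indicatorOp_eq_mulOp hMm
  simp only [hΔ, hcut]
  have hlim0 : ∀ f : ℕ → ℝ, (∀ m, 0 ≤ f m) → (∀ ε > 0, ∀ᶠ m in atTop, f m ≤ ε) →
      Tendsto f atTop (𝓝 0) := by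
    intro f hf hfε
    refine tendsto_order.2 ⟨fun c hc => Eventually.of_forall fun m => hc.trans_le (hf m),
      fun c hc => ?_⟩
    filter_upwards [hfε (c / 2) (by positivity)] with m hm
    linarith
  constructor
  · refine hlim0 _ (fun m => norm_nonneg _) fun ε hε => ?_
    set τ := ε / (4 * (Cb + 1)) with hτ
    have hτ0 : 0 < τ := by positivity
    obtain ⟨R, hR, hRτ⟩ := exists_trunc_norm_lt (p := p) hS hp1 hp hk hδ hC hb hτ0
    set η := ε / (4 * (C * S + 1)) with hη
    have hη0 : 0 < η := by positivity
    filter_upwards [hla.eventually_norm_sub_le ha' r (ε := ε / 4) (by positivity),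
      hlb.eventually_norm_sub_le hbm' (r + R + 1) hη0] with m hm1 hm2
    have h1 := norm_mulOp_mul_kerOp_mul_chi_le hS hp1 hp hk hb' (hβ m) hMm hr hη0.le hm2 hRτ.le
    have h2 : ‖mulOp G.measure p (α m) * mulOp G.measure p (chi M)‖ ≤ ε / 4 := by
      rw [mulOp_mul_mulOp (hα m) hχ]
      have h3 := hsmall (hα m) (by positivity) hm1
      simp only [mul_comm (chi M _)] at h3
      exact h3.norm_mulOp_le
    rw [add_mul]
    refine (norm_add_le _ _).trans ((add_le_add h2 h1).trans ?_)
    have h4 : (Cb + Cb) * τ ≤ ε / 2 := by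
      rw [hτ, mul_div_assoc', div_le_iff₀ (by positivity)]
      nlinarith
    have h5 : η * (C * S) ≤ ε / 4 := by
      rw [hη, div_mul_eq_mul_div, div_le_iff₀ (by positivity)]
      nlinarith
    linarith
  · refine hlim0 _ (fun m => norm_nonneg _) fun ε hε => ?_
    set η := ε / (1 + C * S) with hη
    have hη0 : 0 < η := by positivity
    filter_upwards [hla.eventually_norm_sub_le ha' r hη0,
      hlb.eventually_norm_sub_le hbm' r hη0] with m hm1 hm2
    rw [mul_add, ← mul_assoc, mulOp_mul_mulOp hχ (hα m), mulOp_mul_mulOp hχ (hβ m)]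
    have h1 := (hsmall (hα m) hη0.le hm1).norm_mulOp_le (μ := G.measure) (p := p)
    have h2 := (hsmall (hβ m) hη0.le hm2).norm_mulOp_le (μ := G.measure) (p := p)
    have h3 : η * (1 + C * S) = ε := by rw [hη]; field_simp
    refine (norm_add_le _ _).trans ((add_le_add h1 ((norm_mul_le _ _).trans
      (mul_le_mul h2 hTn (norm_nonneg _) hη0.le))).trans_eq ?_)
    rw [← h3]
    ring

end Operators

end PeriodicPlaneGraph

/-! ### Fredholmness forces invertibility of the limit operators -/

theorem isUnit_of_bounded_below {E : Type*} [NormedAddCommGroup E] [NormedSpace ℂ E]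
    [CompleteSpace E] {X : E →L[ℂ] E} {c : ℝ} (hc : 0 ≤ c) (h1 : ∀ u, ‖u‖ ≤ c * ‖X u‖)
    (h2 : ∀ φ : E →L[ℂ] ℂ, φ.comp X = 0 → φ = 0) : IsUnit X := by
  lift c to NNReal using hc
  have hanti : AntilipschitzWith c X := X.antilipschitz_of_bound h1
  have hcl : IsClosed (X.toLinearMap.range : Set E) := by
    have h := hanti.isClosed_range X.uniformContinuous
    rwa [LinearMap.coe_range]
  rw [ContinuousLinearMap.isUnit_iff_bijective]
  refine ⟨hanti.injective, fun x => ?_⟩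
  by_contra hx
  have hx' : x ∉ X.toLinearMap.range := fun ⟨y, hy⟩ => hx ⟨y, hy⟩
  have : IsClosed (X.toLinearMap.range : Set E) := hcl
  have hq : X.toLinearMap.range.mkQ x ≠ 0 := by
    rwa [Submodule.mkQ_apply, Ne, Submodule.Quotient.mk_eq_zero]
  obtain ⟨f, hf⟩ := SeparatingDual.exists_ne_zero (R := ℂ) hq
  have h3 := h2 (f.comp X.toLinearMap.range.mkQL) (by
    ext y
    have h4 : X.toLinearMap.range.mkQ (X y) = 0 := by
      rw [Submodule.mkQ_apply, Submodule.Quotient.mk_eq_zero]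
      exact ⟨y, rfl⟩
    change f (X.toLinearMap.range.mkQ (X y)) = 0
    rw [h4, map_zero])
  exact hf (DFunLike.congr_fun h3 x)

namespace PeriodicPlaneGraph

variable {n : ℕ} {G : PeriodicPlaneGraph n} {p : ℝ≥0∞} [Fact (1 ≤ p)]

theorem ballOp_mul_shift_mul_ballOp {N r : ℝ} {g : Fin n → ℤ} (h : N + r < ‖G.trans g‖) :
    ballOp G.measure p N * G.shift p g * ballOp G.measure p r = 0 := by
  refine clm_ext_ae fun u => ?_
  filter_upwards [ballOp_ae N (G.shift p g (ballOp G.measure p r u)),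
    shift_ae g (ballOp G.measure p r u), ae_comp_sub g (ballOp_ae r u),
    Lp.coeFn_zero ℂ p G.measure] with x h1 h2 h3 h4
  rw [mul_apply_eq_comp, mul_apply_eq_comp, h1, h2, h3, zero_apply, h4, Pi.zero_apply]
  by_cases hx : x ∈ Metric.closedBall (0 : Plane) N
  · rw [chi_of_notMem (M := Metric.closedBall 0 r), zero_mul, mul_zero]
    intro hxr
    rw [mem_closedBall_zero_iff] at hx hxr
    have h5 := norm_sub_le x (x - G.trans g)
    rw [sub_sub_cancel] at h5
    linarith
  · rw [chi_of_notMem hx, zero_mul]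

theorem tendsto_dual_shift (hp1 : 1 < p) (hp : p < ∞) {h : ℕ → Fin n → ℤ}
    (hh : Tendsto h atTop (Bornology.cobounded (Fin n → ℤ))) (φ : G.LpSpace p →L[ℂ] ℂ)
    (u : G.LpSpace p) : Tendsto (fun m => φ (G.shift p (h m) u)) atTop (𝓝 0) := by
  rw [Metric.tendsto_nhds]
  intro ε hε
  set η := ε / (2 * (‖u‖ + ‖φ‖ + 1)) with hη
  have hη0 : 0 < η := by positivity
  obtain ⟨N, hN⟩ :=
    ((tendsto_norm_dual_comp_ballOp hp1 hp φ).eventually (gt_mem_nhds hη0)).exists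
  obtain ⟨r, hr⟩ := ((tendsto_iff_norm_sub_tendsto_zero.1 (tendsto_ballOp hp1 hp u)).eventually
    (gt_mem_nhds hη0)).exists
  filter_upwards [(G.tendsto_norm_trans.comp hh).eventually (eventually_gt_atTop ((N : ℝ) + r))]
    with m hm
  have h0 := DFunLike.congr_fun (ballOp_mul_shift_mul_ballOp (p := p) hm) u
  rw [mul_apply_eq_comp, mul_apply_eq_comp, zero_apply] at h0
  have h1 : φ (G.shift p (h m) u) = φ.comp (1 - ballOp G.measure p N) (G.shift p (h m) u) -
      φ (ballOp G.measure p N (G.shift p (h m) (ballOp G.measure p r u - u))) := by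
    rw [map_sub, map_sub, h0]
    simp
  rw [dist_zero_right, h1]
  have h2 : ‖φ.comp (1 - ballOp G.measure p N) (G.shift p (h m) u)‖ ≤ η * ‖u‖ := by
    refine (ContinuousLinearMap.le_opNorm _ _).trans ?_
    rw [norm_shift]
    gcongr
  have h3 : ‖φ (ballOp G.measure p N (G.shift p (h m) (ballOp G.measure p r u - u)))‖ ≤
      ‖φ‖ * η := by
    refine (ContinuousLinearMap.le_opNorm _ _).trans ?_
    gcongr
    refine ((ballOp G.measure p N).le_of_opNorm_le (norm_ballOp_le _) _).trans ?_
    rw [one_mul, norm_shift]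
    exact hr.le
  have h4 : η * (2 * (‖u‖ + ‖φ‖ + 1)) = ε := by rw [hη]; field_simp
  refine (norm_sub_le _ _).trans_lt ?_
  nlinarith

theorem tendsto_neg_cobounded {h : ℕ → Fin n → ℤ}
    (hh : Tendsto h atTop (Bornology.cobounded (Fin n → ℤ))) :
    Tendsto (fun m => -h m) atTop (Bornology.cobounded (Fin n → ℤ)) :=
  tendsto_norm_atTop_iff_cobounded.1 (by
    simpa only [norm_neg] using tendsto_norm_atTop_iff_cobounded.2 hh)

theorem tendsto_shift_conj_finiteRange (hp1 : 1 < p) (hp : p < ∞) {h : ℕ → Fin n → ℤ}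
    (hh : Tendsto h atTop (Bornology.cobounded (Fin n → ℤ)))
    {F : G.LpSpace p →L[ℂ] G.LpSpace p} (hF : F.toLinearMap.HasFiniteRange) (u : G.LpSpace p) :
    Tendsto (fun m => (G.shift p (-h m) * F * G.shift p (h m)) u) atTop (𝓝 0) := by
  obtain ⟨N, f, y, hfy⟩ := exists_eq_sum_smulRight hF
  rw [tendsto_zero_iff_norm_tendsto_zero]
  have h1 : Tendsto (fun m => ‖∑ j, f j (G.shift p (h m) u) • y j‖) atTop (𝓝 0) := by
    have h2 : Tendsto (fun m => ∑ j, f j (G.shift p (h m) u) • y j) atTop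
        (𝓝 (∑ j, (0 : ℂ) • y j)) :=
      tendsto_finsetSum _ fun j _ => (tendsto_dual_shift hp1 hp hh (f j) u).smul_const _
    simpa using h2.norm
  refine h1.congr fun m => ?_
  rw [mul_apply_eq_comp, mul_apply_eq_comp, norm_shift, hfy]

theorem tendsto_dual_comp_shift_conj_finiteRange (hp1 : 1 < p) (hp : p < ∞)
    {h : ℕ → Fin n → ℤ} (hh : Tendsto h atTop (Bornology.cobounded (Fin n → ℤ)))
    {F : G.LpSpace p →L[ℂ] G.LpSpace p} (hF : F.toLinearMap.HasFiniteRange)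
    (φ : G.LpSpace p →L[ℂ] ℂ) :
    Tendsto (fun m => ‖φ.comp (G.shift p (-h m) * F * G.shift p (h m))‖) atTop (𝓝 0) := by
  obtain ⟨N, f, y, hfy⟩ := exists_eq_sum_smulRight hF
  have h1 : Tendsto (fun m => ∑ j, ‖f j‖ * ‖φ (G.shift p (-h m) (y j))‖) atTop (𝓝 0) := by
    have h2 : Tendsto (fun m => ∑ j, ‖f j‖ * ‖φ (G.shift p (-h m) (y j))‖) atTop
        (𝓝 (∑ j, ‖f j‖ * ‖(0 : ℂ)‖)) :=
      tendsto_finsetSum _ fun j _ =>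
        (tendsto_dual_shift hp1 hp (tendsto_neg_cobounded hh) φ (y j)).norm.const_mul _
    simpa using h2
  refine squeeze_zero (fun m => norm_nonneg _) (fun m => ?_) h1
  refine ContinuousLinearMap.opNorm_le_bound _ (by positivity) fun u => ?_
  rw [ContinuousLinearMap.comp_apply, mul_apply_eq_comp, mul_apply_eq_comp, hfy, map_sum, map_sum,
    Finset.sum_mul]
  refine (norm_sum_le _ _).trans (Finset.sum_le_sum fun j _ => ?_)
  rw [map_smul, map_smul, norm_smul]
  have h3 := (f j).le_opNorm (G.shift p (h m) u)
  rw [norm_shift] at h3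
  calc ‖f j (G.shift p (h m) u)‖ * ‖φ (G.shift p (-h m) (y j))‖
      ≤ (‖f j‖ * ‖u‖) * ‖φ (G.shift p (-h m) (y j))‖ := by gcongr
    _ = _ := by ring

theorem ballOp_eq_cutoff (r : ℝ) : ballOp G.measure p r =
    G.cutoff p (Metric.closedBall 0 r ∩ G.carrier)
      ((isCompact_closedBall _ _).inter_right G.isClosed_carrier).measurableSet := by
  rw [cutoff, indicatorOp_eq_mulOp]
  refine mulOp_congr_ae (bddMeas_chi
    ((isCompact_closedBall (0 : Plane) r).inter_right G.isClosed_carrier).measurableSet) ?_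
  filter_upwards [G.ae_mem_carrier] with x hx
  by_cases hxr : x ∈ Metric.closedBall (0 : Plane) r
  · rw [chi_of_mem hxr, chi_of_mem (M := Metric.closedBall 0 r ∩ G.carrier) ⟨hxr, hx⟩]
  · rw [chi_of_notMem hxr, chi_of_notMem (M := Metric.closedBall 0 r ∩ G.carrier) fun h => hxr h.1]

theorem norm_shift_conj_le (A : G.LpSpace p →L[ℂ] G.LpSpace p) (g : Fin n → ℤ) :
    ‖G.shift p (-g) * A * G.shift p g‖ ≤ ‖A‖ :=
  (norm_mul_mul_le (norm_shift_le _) le_rfl (norm_shift_le _)).trans_eq (by ring)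

theorem IsLimitOperator.tendsto_apply (hp1 : 1 < p) (hp : p < ∞)
    {A X : G.LpSpace p →L[ℂ] G.LpSpace p} {h : ℕ → Fin n → ℤ} (hX : G.IsLimitOperator p A h X)
    (u : G.LpSpace p) :
    Tendsto (fun m => (G.shift p (-h m) * A * G.shift p (h m)) u) atTop (𝓝 (X u)) := by
  rw [tendsto_iff_norm_sub_tendsto_zero, Metric.tendsto_nhds]
  intro ε hε
  set η := ε / (2 * (‖A‖ + ‖X‖ + ‖u‖ + 1)) with hη
  have hη0 : 0 < η := by positivity
  obtain ⟨r, hr⟩ := ((tendsto_iff_norm_sub_tendsto_zero.1 (tendsto_ballOp hp1 hp u)).eventually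
    (gt_mem_nhds hη0)).exists
  have h1 := (hX.2 _ ((isCompact_closedBall 0 (r : ℝ)).inter_right G.isClosed_carrier)
    Set.inter_subset_right).1
  simp only [← ballOp_eq_cutoff] at h1
  filter_upwards [h1.eventually (gt_mem_nhds hη0)] with m hm
  set Y := G.shift p (-h m) * A * G.shift p (h m)
  have hY : ‖Y - X‖ ≤ ‖A‖ + ‖X‖ :=
    (norm_sub_le _ _).trans (add_le_add_left (norm_shift_conj_le A _) _)
  have h2 : Y u - X u = ((Y - X) * ballOp G.measure p r) u -
      (Y - X) (ballOp G.measure p r u - u) := by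
    rw [mul_apply_eq_comp (Y - X), map_sub, sub_sub_cancel]
    rfl
  rw [dist_zero_right, norm_norm, h2]
  have h3 := ((Y - X) * ballOp G.measure p r).le_of_opNorm_le hm.le u
  have h4 := (Y - X).le_of_opNorm_le hY (ballOp G.measure p r u - u)
  have h5 : η * (2 * (‖A‖ + ‖X‖ + ‖u‖ + 1)) = ε := by rw [hη]; field_simp
  have h6 : (‖A‖ + ‖X‖) * ‖ballOp G.measure p r u - u‖ ≤ (‖A‖ + ‖X‖) * η := by gcongr
  refine (norm_sub_le _ _).trans_lt ?_
  nlinarith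

theorem IsLimitOperator.tendsto_dual_comp (hp1 : 1 < p) (hp : p < ∞)
    {A X : G.LpSpace p →L[ℂ] G.LpSpace p} {h : ℕ → Fin n → ℤ} (hX : G.IsLimitOperator p A h X)
    (φ : G.LpSpace p →L[ℂ] ℂ) :
    Tendsto (fun m => ‖φ.comp (G.shift p (-h m) * A * G.shift p (h m) - X)‖) atTop (𝓝 0) := by
  rw [Metric.tendsto_nhds]
  intro ε hε
  set η := ε / (2 * (‖A‖ + ‖X‖ + ‖φ‖ + 1)) with hη
  have hη0 : 0 < η := by positivity
  obtain ⟨r, hr⟩ :=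
    ((tendsto_norm_dual_comp_ballOp hp1 hp φ).eventually (gt_mem_nhds hη0)).exists
  have h1 := (hX.2 _ ((isCompact_closedBall 0 (r : ℝ)).inter_right G.isClosed_carrier)
    Set.inter_subset_right).2
  simp only [← ballOp_eq_cutoff] at h1
  filter_upwards [h1.eventually (gt_mem_nhds hη0)] with m hm
  set Y := G.shift p (-h m) * A * G.shift p (h m)
  have hY : ‖Y - X‖ ≤ ‖A‖ + ‖X‖ :=
    (norm_sub_le _ _).trans (add_le_add_left (norm_shift_conj_le A _) _)
  have h2 : φ.comp (Y - X) = φ.comp (ballOp G.measure p r * (Y - X)) +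
      (φ.comp (1 - ballOp G.measure p r)).comp (Y - X) := by
    ext u
    simp only [ContinuousLinearMap.comp_apply, add_apply, sub_apply, mul_apply_eq_comp,
      one_apply_eq_self, map_sub]
    ring
  rw [dist_zero_right, norm_norm, h2]
  have h3 : ‖φ.comp (ballOp G.measure p r * (Y - X))‖ ≤ ‖φ‖ * η :=
    (ContinuousLinearMap.opNorm_comp_le _ _).trans (by gcongr)
  have h4 : ‖(φ.comp (1 - ballOp G.measure p r)).comp (Y - X)‖ ≤ η * (‖A‖ + ‖X‖) :=
    (ContinuousLinearMap.opNorm_comp_le _ _).trans (by gcongr)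
  have h5 : η * (2 * (‖A‖ + ‖X‖ + ‖φ‖ + 1)) = ε := by rw [hη]; field_simp
  refine (norm_add_le _ _).trans_lt ?_
  nlinarith

theorem IsLimitOperator.isUnit_of_isFredholm (hp1 : 1 < p) (hp : p < ∞)
    {A X : G.LpSpace p →L[ℂ] G.LpSpace p} (hA : A.IsFredholm) {h : ℕ → Fin n → ℤ}
    (hX : G.IsLimitOperator p A h X) : IsUnit X := by
  obtain ⟨B, F₁, F₂, h1, h2, hF₁, hF₂⟩ := exists_left_right_of_isFredholm hA
  have hconj : ∀ (g : Fin n → ℤ) (U V : G.LpSpace p →L[ℂ] G.LpSpace p),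
      (G.shift p (-g) * U * G.shift p g) * (G.shift p (-g) * V * G.shift p g) =
        G.shift p (-g) * (U * V) * G.shift p g := by
    intro g U V
    have h3 : (G.shift p (-g) * U * G.shift p g) * (G.shift p (-g) * V * G.shift p g) =
      G.shift p (-g) * U * (G.shift p g * G.shift p (-g)) * V * G.shift p g := by
      simp only [mul_assoc]
    rw [h3, shift_mul_shift_neg, mul_one]
    simp only [mul_assoc]
  have hone : ∀ (g : Fin n → ℤ) (F : G.LpSpace p →L[ℂ] G.LpSpace p),
      G.shift p (-g) * (1 + F) * G.shift p g = 1 + G.shift p (-g) * F * G.shift p g := by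
    intro g F
    rw [mul_add, add_mul, mul_one, shift_neg_mul_shift]
  refine isUnit_of_bounded_below (norm_nonneg B) (fun u => ?_) fun φ hφ => ?_
  · have h3 := ((hX.tendsto_apply hp1 hp u).norm.const_mul ‖B‖).add
      (tendsto_shift_conj_finiteRange hp1 hp hX.1 hF₂ u).norm
    rw [norm_zero, add_zero] at h3
    refine ge_of_tendsto' h3 fun m => ?_
    have h4 := DFunLike.congr_fun ((hconj (h m) B A).trans ((congrArg (fun Y =>
      G.shift p (-h m) * Y * G.shift p (h m)) h2).trans (hone _ _))) u
    have h5 : u = (G.shift p (-h m) * B * G.shift p (h m))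
        ((G.shift p (-h m) * A * G.shift p (h m)) u) -
          (G.shift p (-h m) * F₂ * G.shift p (h m)) u := by
      rw [← mul_apply_eq_comp, h4]
      simp
    calc ‖u‖ = _ := congrArg _ h5
      _ ≤ _ := (norm_sub_le _ _).trans (add_le_add_left
        (ContinuousLinearMap.le_of_opNorm_le _ (norm_shift_conj_le B _) _) _)
  · have h3 := ((hX.tendsto_dual_comp hp1 hp φ).mul_const ‖B‖).add
      (tendsto_dual_comp_shift_conj_finiteRange hp1 hp hX.1 hF₁ φ)
    rw [zero_mul, add_zero] at h3
    refine norm_le_zero_iff.1 (ge_of_tendsto' h3 fun m => ?_)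
    have h4 := (hconj (h m) A B).trans ((congrArg (fun Y =>
      G.shift p (-h m) * Y * G.shift p (h m)) h1).trans (hone _ _))
    have h5 : φ = (φ.comp (G.shift p (-h m) * A * G.shift p (h m) - X)).comp
        (G.shift p (-h m) * B * G.shift p (h m)) -
          φ.comp (G.shift p (-h m) * F₁ * G.shift p (h m)) := by
      rw [ContinuousLinearMap.comp_sub, hφ, sub_zero, ContinuousLinearMap.comp_assoc]
      change φ = φ.comp ((G.shift p (-h m) * A * G.shift p (h m)) *
        (G.shift p (-h m) * B * G.shift p (h m))) - _
      rw [h4]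
      ext u
      simp
    calc ‖φ‖ = _ := congrArg _ h5
      _ ≤ _ := (norm_sub_le _ _).trans (add_le_add_left
        ((ContinuousLinearMap.opNorm_comp_le _ _).trans
          (mul_le_mul_of_nonneg_left (norm_shift_conj_le B _) (norm_nonneg _))) _)

end PeriodicPlaneGraph

/-! ### Fredholmness forces the multiplier to be bounded away from zero -/

theorem tendsto_finiteRange_of_weaklyNull {E : Type*} [NormedAddCommGroup E] [NormedSpace ℂ E]
    {F : E →L[ℂ] E} (hF : F.toLinearMap.HasFiniteRange) {u : ℕ → E}
    (hu : ∀ φ : E →L[ℂ] ℂ, Tendsto (fun m => φ (u m)) atTop (𝓝 0)) :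
    Tendsto (fun m => F (u m)) atTop (𝓝 0) := by
  obtain ⟨N, f, y, hfy⟩ := exists_eq_sum_smulRight hF
  have h2 : Tendsto (fun m => ∑ j, f j (u m) • y j) atTop (𝓝 (∑ j, (0 : ℂ) • y j)) :=
    tendsto_finsetSum _ fun j _ => (hu (f j)).smul_const _
  simpa [hfy] using h2

theorem IsFinRankLimit.tendsto_of_weaklyNull {E : Type*} [NormedAddCommGroup E] [NormedSpace ℂ E]
    {T : E →L[ℂ] E} (hT : IsFinRankLimit T) {u : ℕ → E} (hu1 : ∀ m, ‖u m‖ ≤ 1)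
    (hu : ∀ φ : E →L[ℂ] ℂ, Tendsto (fun m => φ (u m)) atTop (𝓝 0)) :
    Tendsto (fun m => T (u m)) atTop (𝓝 0) := by
  rw [Metric.tendsto_nhds]
  intro ε hε
  obtain ⟨F, hF, hFT⟩ := hT (ε / 2) (by positivity)
  filter_upwards [Metric.tendsto_nhds.1 (tendsto_finiteRange_of_weaklyNull hF hu) (ε / 2)
    (by positivity)] with m hm
  rw [dist_zero_right] at hm ⊢
  have h1 : ‖(T - F) (u m)‖ ≤ ε / 2 := by
    refine ((T - F).le_of_opNorm_le hFT.le _).trans ?_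
    exact mul_le_of_le_one_right (by positivity) (hu1 m)
  calc ‖T (u m)‖ = ‖(T - F) (u m) + F (u m)‖ := by simp
    _ ≤ _ := norm_add_le _ _
    _ < ε := by linarith

namespace PlaneGraph

variable (G : PlaneGraph)

theorem exists_disjoint_segments {x : Plane} (hx : x ∈ G.carrier) {δ : ℝ} (hδ : 0 < δ) :
    ∃ s : ℕ → Set Plane, (Pairwise fun i j => Disjoint (s i) (s j)) ∧
      (∀ m, MeasurableSet (s m)) ∧ (∀ m, s m ⊆ Metric.ball x δ) ∧
      ∀ m, G.measure (s m) ≠ 0 ∧ G.measure (s m) ≠ ∞ := by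
  obtain ⟨e, he, hxe⟩ := Set.mem_iUnion₂.1 hx
  obtain ⟨w, hw, hwx⟩ : ∃ w ∈ segment ℝ e.1 e.2, x ≠ w := by
    by_cases h : x = e.1
    · exact ⟨e.2, right_mem_segment ℝ _ _, h ▸ G.no_loop e he⟩
    · exact ⟨e.1, left_mem_segment ℝ _ _, h⟩
  have hd : 0 < dist x w := dist_pos.2 hwx
  set τ := min 1 (δ / (2 * dist x w)) with hτ
  have hτ0 : 0 < τ := lt_min one_pos (by positivity)
  have hτδ : τ * dist x w < δ := by
    have h1 : τ * dist x w ≤ δ / (2 * dist x w) * dist x w := by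
      gcongr
      exact min_le_right _ _
    have h2 : δ / (2 * dist x w) * dist x w = δ / 2 := by field_simp
    linarith
  let t : ℕ → ℝ := fun j => τ / (j + 1)
  have ht0 : ∀ j, 0 < t j := fun j => by positivity
  have ht : StrictAnti t := fun i j hij => by
    have : (i : ℝ) < j := by exact_mod_cast hij
    exact div_lt_div_of_pos_left hτ0 (by positivity) (by linarith)
  have htτ : ∀ j, t j ≤ τ := fun j => div_le_self hτ0.le (by linarith [Nat.cast_nonneg (α := ℝ) j])
  let f : ℝ →ᵃ[ℝ] Plane := AffineMap.lineMap x w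
  have hf : Function.Injective f := AffineMap.lineMap_injective ℝ hwx
  let s : ℕ → Set Plane := fun m => f '' Set.Icc (t (2 * m + 1)) (t (2 * m))
  have hseg : ∀ m, s m = segment ℝ (f (t (2 * m + 1))) (f (t (2 * m))) := fun m => by
    rw [← image_segment, segment_eq_Icc (ht (Nat.lt_succ_self _)).le]
  have hsub : ∀ m, s m ⊆ G.carrier := by
    rintro m _ ⟨r, hr, rfl⟩
    refine G.segment_subset_carrier he ((convex_segment e.1 e.2).segment_subset hxe hw ?_)
    rw [segment_eq_image_lineMap]
    exact ⟨r, ⟨(ht0 _).le.trans hr.1, hr.2.trans ((htτ _).trans (min_le_left _ _))⟩, rfl⟩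
  have hμ : ∀ m, G.measure (s m) = edist (f (t (2 * m + 1))) (f (t (2 * m))) := fun m => by
    rw [measure, Measure.restrict_eq_self _ (hsub m), hseg, hausdorffMeasure_segment]
  refine ⟨s, ?_, fun m => ?_, ?_, fun m => ⟨?_, ?_⟩⟩
  · have hlt : ∀ i j, i < j → Disjoint (s i) (s j) := fun i j hij => by
      refine (Set.disjoint_image_iff hf).2 (Set.disjoint_left.2 fun r hr hr' => ?_)
      exact absurd (hr.1.trans hr'.2) (not_le.2 (ht (by omega)))
    intro i j hij
    rcases lt_or_gt_of_ne hij with h | h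
    · exact hlt i j h
    · exact (hlt j i h).symm
  · rw [hseg]
    exact (isClosed_segment _ _).measurableSet
  · rintro m _ ⟨r, hr, rfl⟩
    rw [Metric.mem_ball, dist_lineMap_left, Real.norm_of_nonneg ((ht0 _).le.trans hr.1)]
    refine lt_of_le_of_lt ?_ hτδ
    gcongr
    exact hr.2.trans (htτ _)
  · rw [hμ, Ne, edist_eq_zero]
    exact fun h => (ht (Nat.lt_succ_self (2 * m))).ne (hf h)
  · rw [hμ]
    exact edist_ne_top _ _

theorem exists_weaklyNull {p : ℝ≥0∞} [Fact (1 ≤ p)] (hp1 : 1 < p) (hp : p < ∞) {x : Plane}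
    (hx : x ∈ G.carrier) {δ : ℝ} (hδ : 0 < δ) :
    ∃ u : ℕ → Lp ℂ p G.measure, (∀ m, ‖u m‖ = 1) ∧
      (∀ φ : Lp ℂ p G.measure →L[ℂ] ℂ, Tendsto (fun m => φ (u m)) atTop (𝓝 0)) ∧
      ∀ m, mulOp G.measure p (chi (Metric.ball x δ)) (u m) = u m := by
  obtain ⟨s, hs, hsm, hsb, hsμ⟩ := G.exists_disjoint_segments hx hδ
  have hr := toReal_one_lt hp1 hp
  let c : ℕ → ℂ := fun m => ((G.measure.real (s m) ^ (1 / p.toReal))⁻¹ : ℝ)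
  let u : ℕ → Lp ℂ p G.measure := fun m => indicatorConstLp p (hsm m) (hsμ m).2 (c m)
  have hu0 : ∀ m, ∀ᵐ x ∂G.measure, x ∉ s m → u m x = 0 := fun m => by
    filter_upwards [indicatorConstLp_coeFn (p := p) (hs := hsm m) (hμs := (hsμ m).2) (c := c m)]
      with x hx hxs
    exact hx.trans (Set.indicator_of_notMem hxs _)
  have hu1 : ∀ m, ‖u m‖ = 1 := fun m => by
    have h0 : 0 < G.measure.real (s m) := ENNReal.toReal_pos (hsμ m).1 (hsμ m).2
    have h1 : 0 < G.measure.real (s m) ^ (1 / p.toReal) := Real.rpow_pos_of_pos h0 _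
    rw [norm_indicatorConstLp (by positivity) hp.ne, Complex.norm_real, norm_inv,
      Real.norm_of_nonneg h1.le, inv_mul_cancel₀ h1.ne']
  refine ⟨u, hu1, fun φ => tendsto_dual_of_disjoint hp1 hp hs hu0 (fun m => (hu1 m).le) φ,
    fun m => ?_⟩
  refine Lp.ext ?_
  filter_upwards [(bddMeas_chi Metric.isOpen_ball.measurableSet).mulOp_ae (u m), hu0 m]
    with y h1 h2
  rw [h1]
  by_cases hy : y ∈ s m
  · rw [chi_of_mem (hsb m hy), one_mul]
  · rw [h2 hy, mul_zero]

theorem exists_le_norm_of_isFredholm {p : ℝ≥0∞} [Fact (1 ≤ p)] {s S δ C : ℝ} {k : Plane → ℂ}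
    (hS : SchurBound G.measure s S)
    (hp1 : 1 < p) (hp : p < ∞) (hk : Continuous k) (hδ : 0 < δ) (hC : 0 ≤ C)
    (hb : ∀ z, ‖k z‖ ≤ C * wt (s + δ) z) {a b : Plane → ℂ} {Ca : ℝ} (ha : BddMeas a Ca)
    (hac : ContinuousOn a G.carrier) (hA : (abOp G.measure p a b k).IsFredholm) :
    ∃ c > 0, ∀ x ∈ G.carrier, c ≤ ‖a x‖ := by
  obtain ⟨B, F₁, F₂, -, hBA, -, hF₂⟩ := exists_left_right_of_isFredholm hA
  refine ⟨1 / (‖B‖ + 1), by positivity, fun x hx => ?_⟩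
  set c := 1 / (‖B‖ + 1) with hc
  have hc0 : 0 < c := by positivity
  by_contra! hlt
  obtain ⟨r, hr, hra⟩ := Metric.mem_nhdsWithin_iff.1
    ((hac x hx).norm.eventually (gt_mem_nhds hlt))
  set D := Metric.ball x r
  have hD : MeasurableSet D := Metric.isOpen_ball.measurableSet
  obtain ⟨u, hu1, hu, huD⟩ := G.exists_weaklyNull (p := p) hp1 hp hx hr
  set T := kerOp G.measure p fun x y => k (x - y)
  have hK : Tendsto (fun m => T (u m)) atTop (𝓝 0) := by
    have h := (isFinRankLimit_mul_chi hS hp1 hp hk hδ hC hb hD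
      Metric.isBounded_ball).tendsto_of_weaklyNull (fun m => (hu1 m).le) hu
    refine h.congr fun m => ?_
    rw [mul_apply_eq_comp, huD]
  have haD : ∀ m, ‖mulOp G.measure p a (u m)‖ ≤ c := by
    intro m
    have hE : MeasurableSet (D ∩ G.carrier) := hD.inter G.measurableSet_carrier
    have h1 : BddMeas (fun x => a x * chi (D ∩ G.carrier) x) c := by
      refine ⟨ha.meas.mul (bddMeas_chi hE).meas, fun y => ?_⟩
      by_cases hy : y ∈ D ∩ G.carrier
      · rw [chi_of_mem hy, mul_one]
        exact (hra hy).le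
      · rw [chi_of_notMem hy, mul_zero, norm_zero]
        exact hc0.le
    have h2 : mulOp G.measure p (chi D) = mulOp G.measure p (chi (D ∩ G.carrier)) := by
      refine mulOp_congr_ae (bddMeas_chi hE) ?_
      filter_upwards [G.ae_mem_carrier] with y hy
      by_cases hyD : y ∈ D
      · rw [chi_of_mem hyD, chi_of_mem (M := D ∩ G.carrier) ⟨hyD, hy⟩]
      · rw [chi_of_notMem hyD, chi_of_notMem (M := D ∩ G.carrier) fun h => hyD h.1]
    rw [← huD m, h2, ← mul_apply_eq_comp, mulOp_mul_mulOp ha (bddMeas_chi hE)]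
    refine ((mulOp G.measure p _).le_of_opNorm_le h1.norm_mulOp_le _).trans_eq ?_
    rw [hu1, mul_one]
  have hlim : Tendsto (fun m => ‖B‖ * (c + ‖mulOp G.measure p b‖ * ‖T (u m)‖) + ‖F₂ (u m)‖) atTop
      (𝓝 (‖B‖ * (c + ‖mulOp G.measure p b‖ * ‖(0 : Lp ℂ p G.measure)‖) +
        ‖(0 : Lp ℂ p G.measure)‖)) :=
    (((hK.norm.const_mul _).const_add _).const_mul _).add
      (tendsto_finiteRange_of_weaklyNull hF₂ hu).norm
  have h1 : 1 ≤ ‖B‖ * (c + ‖mulOp G.measure p b‖ * ‖(0 : Lp ℂ p G.measure)‖) +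
      ‖(0 : Lp ℂ p G.measure)‖ := by
    refine ge_of_tendsto' hlim fun m => ?_
    have h2 := DFunLike.congr_fun hBA (u m)
    rw [mul_apply_eq_comp, add_apply, one_apply_eq_self] at h2
    have h3 : u m = B (abOp G.measure p a b k (u m)) - F₂ (u m) := by rw [h2, add_sub_cancel_right]
    have h4 : ‖abOp G.measure p a b k (u m)‖ ≤ c + ‖mulOp G.measure p b‖ * ‖T (u m)‖ := by
      rw [abOp, add_apply, mul_apply_eq_comp]
      exact (norm_add_le _ _).trans (add_le_add (haD m) (ContinuousLinearMap.le_opNorm _ _))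
    calc 1 = ‖u m‖ := (hu1 m).symm
      _ = _ := congrArg _ h3
      _ ≤ _ := (norm_sub_le _ _).trans (add_le_add_left ((B.le_opNorm _).trans
        (mul_le_mul_of_nonneg_left h4 (norm_nonneg _))) _)
  rw [norm_zero, mul_zero, add_zero, add_zero, hc, mul_one_div, le_div_iff₀ (by positivity)] at h1
  linarith

end PlaneGraph

/-! ### Uniformly bounded inverses of the limit operators -/

namespace PeriodicPlaneGraph

variable {n : ℕ} {G : PeriodicPlaneGraph n} {p : ℝ≥0∞} [Fact (1 ≤ p)]

/-- `a'` and `b'` are the limit functions of `a` and `b` along a common sequence. -/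
def IsLimitPair (G : PeriodicPlaneGraph n) (a b : Plane → ℂ) (Ca Cb : ℝ) (h : ℕ → Fin n → ℤ)
    (a' b' : Plane → ℂ) : Prop :=
  G.IsLimitFunction a h a' ∧ G.IsLimitFunction b h b' ∧ G.IsCoeff a' Ca ∧ G.IsCoeff b' Cb

theorem exists_isLimitPair {a b : Plane → ℂ} (ha : G.IsBUC a) (hbu : G.IsBUC b) {Ca Cb : ℝ}
    (hCa : 0 ≤ Ca) (hCb : 0 ≤ Cb) (haC : ∀ x ∈ G.carrier, ‖a x‖ ≤ Ca)
    (hbC : ∀ x ∈ G.carrier, ‖b x‖ ≤ Cb) (h : ℕ → Fin n → ℤ) :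
    ∃ φ : ℕ → ℕ, StrictMono φ ∧ ∃ a' b', G.IsLimitPair a b Ca Cb (h ∘ φ) a' b' := by
  obtain ⟨φ, hφ, a', ha', haC'⟩ := exists_limitFunction ha hCa haC h
  obtain ⟨ψ, hψ, b', hb', hbC'⟩ := exists_limitFunction hbu hCb hbC (h ∘ φ)
  exact ⟨φ ∘ ψ, hφ.comp hψ, a', b', ha'.comp hψ, hb', haC', hbC'⟩

theorem norm_le_of_periodic {f : Plane → ℂ} (hf : ∀ β x, f (x + G.trans β) = f x)
    (h0 : ∀ x, x ∉ G.carrier → f x = 0) {K : Set Plane}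
    (hK : ∀ x ∈ G.carrier, ∃ g, ∃ y ∈ K, x = y + G.trans g) {ε : ℝ} (hε : 0 ≤ ε)
    (h : ∀ x ∈ K, ‖f x‖ ≤ ε) (x : Plane) : ‖f x‖ ≤ ε := by
  by_cases hx : x ∈ G.carrier
  · obtain ⟨g, y, hy, rfl⟩ := hK x hx
    rw [hf]
    exact h y hy
  · rw [h0 x hx, norm_zero]
    exact hε

theorem norm_abOp_le {s S C : ℝ} {k : Plane → ℂ} (hS : SchurBound G.measure s S)
    (hp1 : 1 < p) (hp : p < ∞) (hk : Continuous k) (hb : ∀ z, ‖k z‖ ≤ C * wt s z)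
    {a b : Plane → ℂ} {ε : ℝ} (ha : BddMeas a ε) (hbm : BddMeas b ε) :
    ‖abOp G.measure p a b k‖ ≤ ε * (1 + C * S) := by
  rw [abOp]
  refine (norm_add_le _ _).trans ((add_le_add ha.norm_mulOp_le ((norm_mul_le _ _).trans
    (mul_le_mul hbm.norm_mulOp_le ((isKer_conv hk hb).norm_kerOp_le hS hp1 hp)
      (norm_nonneg _) ha.nonneg))).trans_eq (by ring))

theorem exists_norm_inverse_le {s S C : ℝ} {k : Plane → ℂ} (hS : SchurBound G.measure s S)
    (hp1 : 1 < p) (hp : p < ∞) (hk : Continuous k) (hC : 0 ≤ C) (hb : ∀ z, ‖k z‖ ≤ C * wt s z)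
    {a b : Plane → ℂ} (ha : G.IsBUC a) (hbu : G.IsBUC b) (haso : G.IsSO a) (hbso : G.IsSO b)
    {Ca Cb : ℝ} (hCa : 0 ≤ Ca) (hCb : 0 ≤ Cb) (haC : ∀ x ∈ G.carrier, ‖a x‖ ≤ Ca)
    (hbC : ∀ x ∈ G.carrier, ‖b x‖ ≤ Cb)
    (hunit : ∀ h a' b', Tendsto h atTop (Bornology.cobounded (Fin n → ℤ)) →
      G.IsLimitPair a b Ca Cb h a' b' → IsUnit (abOp G.measure p a' b' k)) :
    ∃ D : ℝ, 0 ≤ D ∧ ∀ h a' b', Tendsto h atTop (Bornology.cobounded (Fin n → ℤ)) →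
      G.IsLimitPair a b Ca Cb h a' b' → ‖Ring.inverse (abOp G.measure p a' b' k)‖ ≤ D := by
  by_contra! hcon
  choose h a' b' hh hab hlt using fun j : ℕ => hcon j j.cast_nonneg
  obtain ⟨K, hK, hKΓ, hcov⟩ := G.cocompact
  obtain ⟨r, hr⟩ := hK.isBounded.subset_closedBall 0
  have hex : ∀ j : ℕ, ∃ m : ℕ, (j : ℝ) ≤ ‖G.trans (h j m)‖ ∧
      (∀ x ∈ Metric.closedBall (0 : Plane) r,
        ‖G.carrier.indicator a (x + G.trans (h j m)) - a' j x‖ ≤ 1 / ((j : ℝ) + 1)) ∧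
      ∀ x ∈ Metric.closedBall (0 : Plane) r,
        ‖G.carrier.indicator b (x + G.trans (h j m)) - b' j x‖ ≤ 1 / ((j : ℝ) + 1) := fun j =>
    (((G.tendsto_norm_trans.comp (hh j)).eventually (eventually_ge_atTop (j : ℝ))).and
      (((hab j).1.eventually_norm_sub_le (hab j).2.2.1 r Nat.one_div_pos_of_nat).and
        ((hab j).2.1.eventually_norm_sub_le (hab j).2.2.2 r Nat.one_div_pos_of_nat))).exists
  choose μ hμ1 hμ2 hμ3 using hex
  have hg : Tendsto (fun j => h j (μ j)) atTop (Bornology.cobounded (Fin n → ℤ)) :=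
    G.tendsto_cobounded_of_norm_trans (tendsto_atTop_mono hμ1 tendsto_natCast_atTop_atTop)
  obtain ⟨φ, hφ, a₀, b₀, hab₀⟩ := exists_isLimitPair ha hbu hCa hCb haC hbC fun j => h j (μ j)
  have hg' := hg.comp hφ.tendsto_atTop
  have hclose : ∀ {f f₀ : Plane → ℂ} {f' : ℕ → Plane → ℂ} {Cf : ℝ}, G.IsSO f →
      (∀ j, G.IsLimitFunction f (h j) (f' j)) → (∀ j, G.IsCoeff (f' j) Cf) →
      (∀ j, ∀ x ∈ Metric.closedBall (0 : Plane) r,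
        ‖G.carrier.indicator f (x + G.trans (h j (μ j))) - f' j x‖ ≤ 1 / ((j : ℝ) + 1)) →
      G.IsLimitFunction f ((fun j => h j (μ j)) ∘ φ) f₀ → G.IsCoeff f₀ Cf → ∀ ε > 0,
      ∀ᶠ j in atTop, BddMeas (fun x => f' (φ j) x - f₀ x) ε := by
    intro f f₀ f' Cf hfso hf' hfC' hμf hf₀ hfC₀ ε hε
    have h1 : Tendsto (fun j : ℕ => 1 / ((φ j : ℝ) + 1)) atTop (𝓝 0) :=
      tendsto_one_div_add_atTop_nhds_zero_nat.comp hφ.tendsto_atTop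
    filter_upwards [h1.eventually (gt_mem_nhds (half_pos hε)),
      hf₀.eventually_norm_sub_le hfC₀ r (half_pos hε)] with j hj1 hj2
    refine ⟨(hfC' (φ j)).bdd.meas.sub hfC₀.bdd.meas, norm_le_of_periodic (G := G) (fun β x => ?_)
      (fun x hx => ?_) hcov hε.le fun x hx => ?_⟩
    · rw [(hf' _).periodic (hfC' _) hfso (hh _), hf₀.periodic hfC₀ hfso hg']
    · rw [(hfC' _).zero x hx, hfC₀.zero x hx, sub_zero]
    · have h2 := hμf (φ j) x (hr hx)
      have h3 := hj2 x (hr hx)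
      simp only [Function.comp_apply] at h3
      rw [← sub_sub_sub_cancel_left _ _ (G.carrier.indicator f (x + G.trans (h (φ j) (μ (φ j)))))]
      refine (norm_sub_le _ _).trans ?_
      linarith
  have hlim : Tendsto (fun j => abOp G.measure p (a' (φ j)) (b' (φ j)) k) atTop
      (𝓝 (abOp G.measure p a₀ b₀ k)) := by
    rw [Metric.tendsto_nhds]
    intro ε hε
    have hCS : 0 ≤ C * S := mul_nonneg hC hS.nonneg
    set η := ε / (2 * (1 + C * S)) with hη
    have hη0 : 0 < η := by positivity
    filter_upwards [hclose haso (fun j => (hab j).1) (fun j => (hab j).2.2.1) hμ2 hab₀.1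
      hab₀.2.2.1 η hη0, hclose hbso (fun j => (hab j).2.1) (fun j => (hab j).2.2.2) hμ3 hab₀.2.1
      hab₀.2.2.2 η hη0] with j hj1 hj2
    rw [dist_eq_norm, abOp_sub_abOp (hab _).2.2.1.bdd (hab _).2.2.2.bdd hab₀.2.2.1.bdd
      hab₀.2.2.2.bdd]
    refine (norm_abOp_le hS hp1 hp hk hb hj1 hj2).trans_lt ?_
    have h1 : η * (1 + C * S) = ε / 2 := by rw [hη]; field_simp
    rw [h1]
    exact half_lt_self hε
  obtain ⟨U, hU⟩ := hunit _ _ _ hg' hab₀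
  have hinv : Tendsto (fun j => ‖Ring.inverse (abOp G.measure p (a' (φ j)) (b' (φ j)) k)‖) atTop
      (𝓝 ‖Ring.inverse (abOp G.measure p a₀ b₀ k)‖) := by
    rw [← hU] at hlim ⊢
    exact ((NormedRing.inverse_continuousAt U).tendsto.comp hlim).norm
  refine not_tendsto_nhds_of_tendsto_atTop ?_ _ hinv
  exact tendsto_atTop_mono (fun j => (hlt (φ j)).le)
    (tendsto_natCast_atTop_atTop.comp hφ.tendsto_atTop)

theorem exists_tendsto_cobounded (hn : 0 < n) :
    ∃ h : ℕ → Fin n → ℤ, Tendsto h atTop (Bornology.cobounded (Fin n → ℤ)) := by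
  have : Nonempty (Fin n) := ⟨⟨0, hn⟩⟩
  refine ⟨fun m _ => m, tendsto_norm_atTop_iff_cobounded.1 ?_⟩
  simpa using tendsto_natCast_atTop_atTop (R := ℝ)

theorem hasFrozenInverses (hn : 0 < n) {k : Plane → ℂ}
    {a b : Plane → ℂ} (ha : G.IsBUC a) (hbu : G.IsBUC b) (haso : G.IsSO a) (hbso : G.IsSO b)
    {Ca Cb D : ℝ} (hCa : 0 ≤ Ca) (hCb : 0 ≤ Cb) (haC : ∀ x ∈ G.carrier, ‖a x‖ ≤ Ca)
    (hbC : ∀ x ∈ G.carrier, ‖b x‖ ≤ Cb)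
    (hunit : ∀ h a' b', Tendsto h atTop (Bornology.cobounded (Fin n → ℤ)) →
      G.IsLimitPair a b Ca Cb h a' b' → IsUnit (abOp G.measure p a' b' k))
    (hD : ∀ h a' b', Tendsto h atTop (Bornology.cobounded (Fin n → ℤ)) →
      G.IsLimitPair a b Ca Cb h a' b' → ‖Ring.inverse (abOp G.measure p a' b' k)‖ ≤ D) :
    HasFrozenInverses G.measure p (G.carrier.indicator a) (G.carrier.indicator b) k Ca Cb D := by
  intro η hη r
  by_contra hcon
  have hfail : ∀ m : ℕ, ∃ z : Plane, (m : ℝ) ≤ ‖z‖ ∧ ∀ h a' b',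
      Tendsto h atTop (Bornology.cobounded (Fin n → ℤ)) → G.IsLimitPair a b Ca Cb h a' b' →
      ¬ ∀ x ∈ Metric.closedBall z r, ‖G.carrier.indicator a x - a' x‖ ≤ η ∧
        ‖G.carrier.indicator b x - b' x‖ ≤ η := by
    intro m
    by_contra! hcon2
    refine hcon ⟨m, fun z hz => ?_⟩
    obtain ⟨h, a', b', hh, hab, hx⟩ := hcon2 z hz
    exact ⟨a', b', Ring.inverse (abOp G.measure p a' b' k), hab.2.2.1.bdd, hab.2.2.2.bdd,
      Ring.mul_inverse_cancel _ (hunit h a' b' hh hab),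
      Ring.inverse_mul_cancel _ (hunit h a' b' hh hab), hD h a' b' hh hab, hx⟩
  choose z hz hzf using hfail
  obtain ⟨K, hK, hKΓ, hcov⟩ := G.cocompact
  obtain ⟨r₀, hr₀⟩ := hK.isBounded.subset_closedBall 0
  have hα : ∀ m, ∃ α, ‖G.trans α - z m‖ ≤ r + r₀ := by
    intro m
    by_contra! hcon2
    have hout : ∀ x ∈ Metric.closedBall (z m) r, x ∉ G.carrier := by
      intro x hx hxΓ
      obtain ⟨g, y, hy, rfl⟩ := hcov x hxΓ
      have h1 := hcon2 g
      have h2 := mem_closedBall_zero_iff.1 (hr₀ hy)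
      rw [mem_closedBall_iff_norm] at hx
      have h3 : G.trans g - z m = (y + G.trans g - z m) - y := by abel
      rw [h3] at h1
      linarith [norm_sub_le (y + G.trans g - z m) y]
    obtain ⟨h, hh⟩ := exists_tendsto_cobounded hn
    obtain ⟨φ, hφ, a', b', hab⟩ := exists_isLimitPair ha hbu hCa hCb haC hbC h
    refine hzf m _ a' b' (hh.comp hφ.tendsto_atTop) hab fun x hx => ?_
    have hxΓ := hout x hx
    rw [Set.indicator_of_notMem hxΓ, Set.indicator_of_notMem hxΓ, hab.2.2.1.zero x hxΓ,
      hab.2.2.2.zero x hxΓ, sub_zero, norm_zero]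
    exact ⟨hη.le, hη.le⟩
  choose α hα using hα
  have hα' : Tendsto α atTop (Bornology.cobounded (Fin n → ℤ)) := by
    refine G.tendsto_cobounded_of_norm_trans (tendsto_atTop_mono (fun m => ?_)
      (tendsto_atTop_add_const_right _ (-(r + r₀)) (tendsto_natCast_atTop_atTop (R := ℝ))))
    have h1 := norm_sub_norm_le (z m) (G.trans (α m))
    rw [norm_sub_rev] at h1
    linarith [hα m, hz m]
  obtain ⟨φ, hφ, a', b', hab⟩ := exists_isLimitPair ha hbu hCa hCb haC hbC α
  have hαφ := hα'.comp hφ.tendsto_atTop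
  obtain ⟨m, hm1, hm2⟩ := ((hab.1.eventually_norm_sub_le hab.2.2.1 (r + (r + r₀)) hη).and
    (hab.2.1.eventually_norm_sub_le hab.2.2.2 (r + (r + r₀)) hη)).exists
  refine hzf (φ m) _ a' b' hαφ hab fun x hx => ?_
  have hx' : x - G.trans (α (φ m)) ∈ Metric.closedBall (0 : Plane) (r + (r + r₀)) := by
    rw [mem_closedBall_zero_iff]
    rw [mem_closedBall_iff_norm] at hx
    have h1 := hα (φ m)
    have h2 : x - G.trans (α (φ m)) = (x - z (φ m)) - (G.trans (α (φ m)) - z (φ m)) := by abel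
    rw [h2]
    exact (norm_sub_le _ _).trans (add_le_add hx h1)
  have h1 := hm1 _ hx'
  have h2 := hm2 _ hx'
  have h3 := hab.1.periodic hab.2.2.1 haso hαφ (-α (φ m)) x
  have h4 := hab.2.1.periodic hab.2.2.2 hbso hαφ (-α (φ m)) x
  rw [map_neg, ← sub_eq_add_neg] at h3 h4
  rw [Function.comp_apply, sub_add_cancel] at h1 h2
  rw [h3] at h1
  rw [h4] at h2
  exact ⟨h1, h2⟩

end PeriodicPlaneGraph

theorem mainTheorem3 {n : ℕ} (hn : n = 1 ∨ n = 2) (G : PeriodicPlaneGraph n)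
    (p : ℝ≥0∞) [Fact (1 ≤ p)] (hp1 : 1 < p) (hp : p < ∞)
    (a b : Plane → ℂ) (ha : G.IsBUC a) (ha' : G.IsSO a) (hb : G.IsBUC b) (hb' : G.IsSO b)
    (k : Plane → ℂ) (hk : Continuous k)
    (hk' : ∃ C : ℝ, 0 < C ∧ ∃ ε : ℝ, 0 < ε ∧ ∀ z : Plane, ‖k z‖ ≤ C * (1 + ‖z‖) ^ (-2 - ε : ℝ)) :
    ∃ A : G.LpSpace p →L[ℂ] G.LpSpace p, G.ActsAs p a b k A ∧
      (A.IsFredholm ↔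
        0 < (⨅ x : G.carrier, ‖a x‖) ∧
        ∀ (g : ℕ → Fin n → ℤ) (B : G.LpSpace p →L[ℂ] G.LpSpace p),
          G.IsLimitOperator p A g B → IsUnit B) ∧
      (∀ h : ℕ → Fin n → ℤ, Tendsto h atTop (Bornology.cobounded (Fin n → ℤ)) →
        ∃ φ : ℕ → ℕ, StrictMono φ ∧ ∃ (a' b' : Plane → ℂ)
          (B : G.LpSpace p →L[ℂ] G.LpSpace p),
          G.IsLimitFunction a (h ∘ φ) a' ∧ G.IsLimitFunction b (h ∘ φ) b' ∧
          G.ActsAs p a' b' k B ∧ G.IsLimitOperator p A (h ∘ φ) B) := by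
  obtain ⟨C, hC, ε, hε, hkC⟩ := hk'
  have hkδ : ∀ z, ‖k z‖ ≤ C * wt (2 + ε / 2 + ε / 2) z := fun z => by
    rw [wt, show -(2 + ε / 2 + ε / 2) = -2 - ε by ring]
    exact hkC z
  have hks : ∀ z, ‖k z‖ ≤ C * wt (2 + ε / 2) z := fun z =>
    (hkδ z).trans (mul_le_mul_of_nonneg_left (by
      rw [wt_add]
      exact mul_le_of_le_one_right (wt_pos _ _).le (wt_le_one (by positivity) z)) hC.le)
  obtain ⟨S, hS⟩ := G.exists_schurBound (s := 2 + ε / 2) (by omega) (by linarith)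
  obtain ⟨Ca, hCa, haC⟩ : ∃ Ca, 0 ≤ Ca ∧ ∀ x ∈ G.carrier, ‖a x‖ ≤ Ca := by
    obtain ⟨c, hc⟩ := ha.1
    exact ⟨max c 0, le_max_right _ _, fun x hx => (hc x hx).trans (le_max_left _ _)⟩
  obtain ⟨Cb, hCb, hbC⟩ : ∃ Cb, 0 ≤ Cb ∧ ∀ x ∈ G.carrier, ‖b x‖ ≤ Cb := by
    obtain ⟨c, hc⟩ := hb.1
    exact ⟨max c 0, le_max_right _ _, fun x hx => (hc x hx).trans (le_max_left _ _)⟩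
  have hac := PeriodicPlaneGraph.isCoeff_indicator ha hCa haC
  have hbc := PeriodicPlaneGraph.isCoeff_indicator hb hCb hbC
  have hlimit : ∀ h a' b', Tendsto h atTop (Bornology.cobounded (Fin n → ℤ)) →
      G.IsLimitPair a b Ca Cb h a' b' → G.IsLimitOperator p (abOp G.measure p
        (G.carrier.indicator a) (G.carrier.indicator b) k) h (abOp G.measure p a' b' k) :=
    fun h a' b' hh hab => PeriodicPlaneGraph.isLimitOperator_abOp hS hp1 hp hk (half_pos hε) hC.le
      hkδ hac hbc hab.2.2.1 hab.2.2.2 hh hab.1 hab.2.1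
  refine ⟨abOp G.measure p (G.carrier.indicator a) (G.carrier.indicator b) k, ?_, ⟨fun hA => ?_,
    fun ⟨hinf, hall⟩ => ?_⟩, fun h hh => ?_⟩
  · exact PeriodicPlaneGraph.actsAs_abOp hS hp1 hp hk hks hac.bdd hbc.bdd
      (fun x hx => Set.indicator_of_mem hx a) fun x hx => Set.indicator_of_mem hx b
  · have : Nonempty G.carrier := G.carrier_nonempty.to_subtype
    refine ⟨?_, fun g B hB => hB.isUnit_of_isFredholm hp1 hp hA⟩
    obtain ⟨c, hc, hca⟩ := G.exists_le_norm_of_isFredholm hS hp1 hp hk (half_pos hε) hC.le hkδ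
      hac.bdd ((PeriodicPlaneGraph.continuousOn_of_isBUC ha).congr fun x hx =>
        Set.indicator_of_mem hx a) hA
    refine hc.trans_le (le_ciInf fun x => ?_)
    have h1 := hca x x.2
    rwa [Set.indicator_of_mem x.2] at h1
  · have hunit : ∀ h a' b', Tendsto h atTop (Bornology.cobounded (Fin n → ℤ)) →
        G.IsLimitPair a b Ca Cb h a' b' → IsUnit (abOp G.measure p a' b' k) :=
      fun h a' b' hh hab => hall h _ (hlimit h a' b' hh hab)
    obtain ⟨D, hD, hDinv⟩ := PeriodicPlaneGraph.exists_norm_inverse_le hS hp1 hp hk hC.le hks ha hb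
      ha' hb' hCa hCb haC hbC hunit
    have hle : ∀ x ∈ G.carrier, (⨅ x : G.carrier, ‖a x‖) ≤ ‖a x‖ := fun x hx =>
      ciInf_le ⟨0, by rintro _ ⟨y, rfl⟩; exact norm_nonneg _⟩ (⟨x, hx⟩ : G.carrier)
    refine isFredholm_of_frozen (Ci := (⨅ x : G.carrier, ‖a x‖)⁻¹) hS hp1 hp hk (half_pos hε) hC.le
      hkδ hac.bdd hbc.bdd hD ⟨hac.bdd.meas.inv, fun x => ?_⟩ ?_
      (PeriodicPlaneGraph.hasFrozenInverses (by omega) ha hb ha' hb' hCa hCb haC hbC hunit hDinv)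
    · by_cases hx : x ∈ G.carrier
      · rw [Set.indicator_of_mem hx, norm_inv]
        exact inv_anti₀ hinf (hle x hx)
      · rw [Set.indicator_of_notMem hx, inv_zero, norm_zero]
        exact (inv_pos.2 hinf).le
    · filter_upwards [G.ae_mem_carrier] with x hx
      rw [Set.indicator_of_mem hx]
      exact norm_pos_iff.1 (hinf.trans_le (hle x hx))
  · obtain ⟨φ, hφ, a₀, b₀, hab⟩ := PeriodicPlaneGraph.exists_isLimitPair ha hb hCa hCb haC hbC h
    exact ⟨φ, hφ, a₀, b₀, abOp G.measure p a₀ b₀ k, hab.1, hab.2.1,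
      PeriodicPlaneGraph.actsAs_abOp hS hp1 hp hk hks hab.2.2.1.bdd hab.2.2.2.bdd
        (fun _ _ => rfl) fun _ _ => rfl, hlimit _ _ _ (hh.comp hφ.tendsto_atTop) hab⟩
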